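/- Let $a>0$, let $q\in L^1(-a,a)$ be complex-valued, and let $\Omega_1=\{(u,v)\in\mathbb R^2: |u|+|v|\le a\}$ and $\Omega=[-a,a]\times[-a,a]$. All function spaces consist of complex-valued functions. The integral equation $$H(u,v)=\frac12\int_0^u q(s)\,ds+\int_0^u\int_0^v q(\alpha+\beta)H(\alpha,\beta)\,d\beta\,d\alpha,\qquad (u,v)\in\Omega_1,$$ has a unique continuous solution $H$ on $\Omega_1$. Put $K(x,t)=H\big(\frac{x+t}2,\frac{x-t}2\big)$ for $(x,t)\in\Omega$. Then: (1) $K$ is a weak solution of the Goursat problem $$(\partial_x^2-q(x))K(x,t)=\partial_t^2K(x,t)\ \text{ in }\Omega,\qquad K(x,x)=\frac12\int_0^xq(s)\,ds,\quad K(x,-x)=0\quad(|x|\le a),$$ that is, $K$ is continuous on $\Omega$, has weak partial derivatives $\partial_xK,\partial_tK\in L^1(\Omega)$, satisfies $\iint_\Omega[\partial_tK\,\partial_t\varphi-\partial_xK\,\partial_x\varphi-qK\varphi]\,dx\,dt=0$ for every $\varphi\in C_c^\infty$ of the interior of $\Omega$, and takes the prescribed values on the two diagonals. (2) The operator $$\mathbf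 Tu(x)=u(x)+\int_{-x}^xK(x,t)u(t)\,dt$$ is a bounded linear operator on $L^1(-a,a)$ and is an s-transmutation operator on $W^{2,1}(-a,a)$ corresponding to $L=\frac{d^2}{dx^2}-q$. This means: for every $u\in W^{2,1}(-a,a)$ one has $\mathbf Tu\in W^{2,1}(-a,a)$ and $(\mathbf Tu)''-q\,\mathbf Tu=\mathbf T(u'')$ almost everywhere; and the functions $\alpha_k=\mathbf T[x^k]$, $k\ge0$, belong to $W^{1,1}(-a,a)$, satisfy $L\alpha_0=L\alpha_1=0$ and $L\alpha_k=k(k-1)\alpha_{k-2}$ for $k\ge2$ in the sense of distributions, and have $C^1$ representatives with $\alpha_k(0)=\alpha_k'(0)=0$ for $k\ge2$. (3) $\alpha_0(0)=\alpha_1'(0)=1$ and $\alpha_0'(0)=\alpha_1(0)=0$. (4) $\mathbf T$ is invertible on $L^1(-a,a)$ with bounded inverse $$\mathbf T^{-1}u(x)=u(x)-\int_{-x}^xK(t,x)u(t)\,dt,$$ and it restricts to a bijection of $W^{2,1}(-a,a)$ onto itself. -/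

import Mathlib

open MeasureTheory Set TopologicalSpace

noncomputable section

namespace Transmutation

/-- The space `L¹(Ω)` of (classes of) complex-valued integrable functions on an open set `Ω`. -/
abbrev L1 {E : Type*} [NormedAddCommGroup E] [NormedSpace ℝ E] [MeasureSpace E]
    (Ω : Opens E) : Type _ :=
  Lp ℂ 1 ((volume : Measure E).restrict (Ω : Set E))

/-- `g` is the weak (distributional) derivative of `f` on `Ω` in the direction `v`. On the real
line, with `v = 1`, this is the usual weak derivative. -/
def HasWeakDeriv {E : Type*} [NormedAddCommGroup E] [NormedSpace ℝ E] [MeasureSpace E]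
    (Ω : Opens E) (v : E) (f g : E → ℂ) : Prop :=
  ∀ φ : TestFunction Ω ℂ ⊤,
    ∫ x in (Ω : Set E), f x * fderiv ℝ φ x v = -∫ x in (Ω : Set E), g x * φ x

/-- The open interval `(-a, a)`. -/
def I (a : ℝ) : Opens ℝ := ⟨Ioo (-a) a, isOpen_Ioo⟩

/-- The open square `(-a, a) × (-a, a)`. -/
def Q (a : ℝ) : Opens (ℝ × ℝ) := ⟨Ioo (-a) a ×ˢ Ioo (-a) a, isOpen_Ioo.prod isOpen_Ioo⟩

/-- The Sobolev space `W^{1,1}(-a, a)`. -/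
def W11 (a : ℝ) : Set (L1 (I a)) :=
  {u | ∃ u' : L1 (I a), HasWeakDeriv (I a) 1 u u'}

/-- `u''` is the second weak derivative of `u`, and both weak derivatives are in `L¹(-a, a)`. -/
def IsSecondDeriv (a : ℝ) (u u'' : L1 (I a)) : Prop :=
  ∃ u' : L1 (I a), HasWeakDeriv (I a) 1 u u' ∧ HasWeakDeriv (I a) 1 u' u''

/-- The Sobolev space `W^{2,1}(-a, a)`. -/
def W21 (a : ℝ) : Set (L1 (I a)) :=
  {u | ∃ u'' : L1 (I a), IsSecondDeriv a u u''}

/-- `T` is a transmutation operator on `χ ⊆ W^{2,1}(-a, a)` for `L = d²/dx² - q`: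
for `u ∈ χ` one has `T u ∈ W^{2,1}(-a, a)` and `(T u)'' - q (T u) = T (u'')`. -/
def IsTransmutationOn (a : ℝ) (q : ℝ → ℂ) (T : L1 (I a) →ₗ[ℂ] L1 (I a))
    (χ : Set (L1 (I a))) : Prop :=
  χ ⊆ W21 a ∧ ∀ u ∈ χ, T u ∈ W21 a ∧
    ∀ u'' w : L1 (I a), IsSecondDeriv a u u'' → IsSecondDeriv a (T u) w →
      ∀ᵐ x ∂(volume.restrict (I a : Set ℝ)), w x - q x * (T u) x = (T u'') x

/-- `u ∈ W^{1,1}(-a, a)` is a weak solution of `(d²/dx² - q) u = h`. -/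
def IsWeakSolution (a : ℝ) (q : ℝ → ℂ) (h u : L1 (I a)) : Prop :=
  u ∈ W11 a ∧ ∀ φ : TestFunction (I a) ℂ ⊤,
    ∫ x in (I a : Set ℝ), (u x * deriv (deriv φ) x - q x * u x * φ x) =
      ∫ x in (I a : Set ℝ), h x * φ x

/-- The class `u` has a `C¹` representative on `(-a, a)` with value `c₀` and
derivative `c₁` at `0`. -/
def HasInitialValues (a : ℝ) (u : L1 (I a)) (c₀ c₁ : ℂ) : Prop :=
  ∃ v : ℝ → ℂ, ContDiffOn ℝ 1 v (I a) ∧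
    (∀ᵐ x ∂(volume.restrict (I a : Set ℝ)), u x = v x) ∧ v 0 = c₀ ∧ deriv v 0 = c₁

/-- `φ` is an `L`-base for `L = d²/dx² - q`: `L φ₀ = L φ₁ = 0` and
`L φ_k = k (k - 1) φ_{k-2}` for `k ≥ 2`, in the sense of weak solutions. -/
def IsLBase (a : ℝ) (q : ℝ → ℂ) (φ : ℕ → L1 (I a)) : Prop :=
  IsWeakSolution a q 0 (φ 0) ∧ IsWeakSolution a q 0 (φ 1) ∧
    ∀ k : ℕ, IsWeakSolution a q ((((k : ℂ) + 2) * ((k : ℂ) + 1)) • φ k) (φ (k + 2))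

/-- A standard `L`-base: moreover `φ_k(0) = φ_k'(0) = 0` for `k ≥ 2`. -/
def IsStandardLBase (a : ℝ) (q : ℝ → ℂ) (φ : ℕ → L1 (I a)) : Prop :=
  IsLBase a q φ ∧ ∀ k : ℕ, 2 ≤ k → HasInitialValues a (φ k) 0 0

lemma integrable_pow (a : ℝ) (k : ℕ) :
    Integrable (fun x : ℝ => (x : ℂ) ^ k) (volume.restrict (I a : Set ℝ)) := by
  have h : Continuous (fun x : ℝ => (x : ℂ) ^ k) := by fun_prop
  exact (h.continuousOn.integrableOn_compact (isCompact_Icc (a := -a) (b := a))).mono_set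
    Ioo_subset_Icc_self

/-- The monomial `x ↦ x ^ k` as an element of `L¹(-a, a)`. -/
def monomial (a : ℝ) (k : ℕ) : L1 (I a) := (integrable_pow a k).toL1 _

/-- A standard transmutation operator on `χ`: a transmutation operator on `χ` that maps the powers
of the independent variable to a standard `L`-base. -/
def IsStandardTransmutationOn (a : ℝ) (q : ℝ → ℂ) (T : L1 (I a) →ₗ[ℂ] L1 (I a))
    (χ : Set (L1 (I a))) : Prop :=
  IsTransmutationOn a q T χ ∧ IsStandardLBase a q (fun k => T (monomial a k))

/-- The closed square `Ω₁` with vertices `(-a, 0), (0, a), (a, 0), (0, -a)`. -/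
def Diamond (a : ℝ) : Set (ℝ × ℝ) := {p | |p.1| + |p.2| ≤ a}

/-- `H` is a (continuous) solution on `Ω₁` of the integral equation
`H(u,v) = ½ ∫₀ᵘ q(s) ds + ∫₀ᵘ ∫₀ᵛ q(α+β) H(α,β) dβ dα`. -/
structure SolvesIntegralEq (a : ℝ) (q : ℝ → ℂ) (H : ℝ → ℝ → ℂ) : Prop where
  continuousOn : ContinuousOn (fun p : ℝ × ℝ => H p.1 p.2) (Diamond a)
  eq : ∀ u v : ℝ, (u, v) ∈ Diamond a →
    H u v = (1 / 2) * (∫ s in (0 : ℝ)..u, q s) +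
      ∫ α in (0 : ℝ)..u, ∫ β in (0 : ℝ)..v, q (α + β) * H α β

/-- The kernel `K(x, t) = H((x + t)/2, (x - t)/2)`. -/
def kernel (H : ℝ → ℝ → ℂ) (x t : ℝ) : ℂ := H ((x + t) / 2) ((x - t) / 2)

/-- `K` is a weak solution of the Goursat problem `(∂ₓ² - q(x)) K = ∂ₜ² K` on the square, with
`K(x,x) = ½ ∫₀ˣ q` and `K(x,-x) = 0`: it is continuous on the closed square, has integrable weak
partial derivatives, satisfies the equation tested against smooth functions compactly supported in
the open square, and takes the prescribed values on the diagonals. -/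
structure IsWeakGoursatSolution (a : ℝ) (q : ℝ → ℂ) (K : ℝ → ℝ → ℂ) : Prop where
  continuousOn : ContinuousOn (fun p : ℝ × ℝ => K p.1 p.2) (Icc (-a) a ×ˢ Icc (-a) a)
  weak : ∃ Kx Kt : L1 (Q a),
    HasWeakDeriv (Q a) (1, 0) (fun p => K p.1 p.2) Kx ∧
    HasWeakDeriv (Q a) (0, 1) (fun p => K p.1 p.2) Kt ∧
    ∀ φ : TestFunction (Q a) ℂ ⊤,
      ∫ p in (Q a : Set (ℝ × ℝ)), (Kt p * fderiv ℝ φ p (0, 1) - Kx p * fderiv ℝ φ p (1, 0) -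
        q p.1 * K p.1 p.2 * φ p) = 0
  diag : ∀ x ∈ Icc (-a) a, K x x = (1 / 2) * ∫ s in (0 : ℝ)..x, q s
  antidiag : ∀ x ∈ Icc (-a) a, K x (-x) = 0

end Transmutation

end

/-!
The potential `q` is extended by zero from `(-a, a)` to the line. Nothing on the closed square
changes, but the integral equation for `H` now makes sense on the whole plane. It is solved there by
the contraction principle in the norm weighted by `exp (-r |u|)` with `r` large
(`exists_isGlobalSolution`). The same weight gives uniqueness on the diamond: the weighted
difference of two solutions attains its maximum, and the equation bounds that maximum by half of
itself (`SolvesIntegralEq.unique_of_integrable`).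

The heart of the argument is `volterra_intertwining`. Let the kernel be given in characteristic
coordinates by `G(u, w) = ½ ∫₀ᵘ p + ∫₀ᵘ ∫₀ʷ q(α + ε β) h(α, β)`, and let `v'' = f` with `f` locally
integrable. Exchanging the order of integration on triangles expresses the Volterra operator
`𝒦 v(x) = ∫_{-x}^x G((x + t)/2, (x - t)/2) v(t) dt` through integrals of `v` over intervals, and
d'Alembert's formula for `v` then shows that `𝒦 v` is the twofold primitive of `𝒦 f`, plus `p v`,
plus the integral of `v` against `q h`. No derivative of `q` or of the kernel is needed, which is
why `q ∈ L¹` suffices. The case `ε = 1`, `p = q`, `h = H` gives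
`(T v)'' = T v'' + q T v` (`isTwicePrimitive_transmute`). The transposed kernel `-K(t, x)` of
`S u(x) = u(x) - ∫_{-x}^x K(t, x) u(t) dt` has the same shape with `ε = -1`, `p = -q` and
`h(α, β) = H(α, -β)`, and gives `(S v)'' = S (v'' - q v)` (`isTwicePrimitive_invTransmute`). In both
cases the value and the derivative at `0` are those of `v`.

Consequently `S T v` has the same initial values as `v` and second derivative `S T v''`. By
induction on the degree, `S T x ^ k = x ^ k` (`invTransmute_transmute_pow`), and the density of
polynomials in `L¹` yields `S T = 1` on `L¹(-a, a)` (`invTransmuteL_transmuteL`). Moreover `S` is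
injective, again by a maximum of a weighted modulus (`eq_zero_of_invTransmuteL_eq_zero`), so `S` is
the two-sided inverse of `T`.

The lemma of du Bois-Reymond (`ae_eq_const_of_weakDeriv_zero`) identifies the functions in
`W^{2,1}(-a, a)` with the restrictions of the functions `v` above
(`IsSecondDeriv.exists_isTwicePrimitive`), which turns the two identities into the statements about
`W^{2,1}`, the `L`-base and the initial values.

For the Goursat problem, `H` is absolutely continuous in each characteristic variable with
derivatives `H_u = ½ q(u) + ∫₀ᵛ q(u + β) H(u, β) dβ` and `H_v = ∫₀ᵘ q(α + v) H(α, v) dα`, and both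
mixed derivatives equal `q(u + v) H`. Fubini's theorem and integration by parts on lines give the
weak formulation in the coordinates `u, v`, and a linear change of variables transports it to the
square (`isWeakGoursatSolution_kernel`).
-/

open scoped BoundedContinuousFunction

namespace Transmutation

/-! ### Integration tools on the line and in the plane -/

/-- The linear automorphism of the plane with matrix `!![a, b; c, d]`. -/
noncomputable def planeEquiv (a b c d : ℝ) (h : a * d - b * c ≠ 0) : (ℝ × ℝ) ≃L[ℝ] (ℝ × ℝ) :=
  LinearEquiv.toContinuousLinearEquiv
    { toFun := fun p => (a * p.1 + b * p.2, c * p.1 + d * p.2)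
      invFun := fun p => ((d * p.1 - b * p.2) / (a * d - b * c),
        (a * p.2 - c * p.1) / (a * d - b * c))
      map_add' := fun p r => by ext <;> simp <;> ring
      map_smul' := fun r p => by ext <;> simp <;> ring
      left_inv := fun p => Prod.ext
        (show (d * (a * p.1 + b * p.2) - b * (c * p.1 + d * p.2)) / (a * d - b * c) = p.1 by
          rw [div_eq_iff h]; ring)
        (show (a * (c * p.1 + d * p.2) - c * (a * p.1 + b * p.2)) / (a * d - b * c) = p.2 by
          rw [div_eq_iff h]; ring)
      right_inv := fun p => Prod.ext
        (show a * ((d * p.1 - b * p.2) / (a * d - b * c)) +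
          b * ((a * p.2 - c * p.1) / (a * d - b * c)) = p.1 by
            rw [← mul_div_assoc, ← mul_div_assoc, ← add_div, div_eq_iff h]; ring)
        (show c * ((d * p.1 - b * p.2) / (a * d - b * c)) +
          d * ((a * p.2 - c * p.1) / (a * d - b * c)) = p.2 by
            rw [← mul_div_assoc, ← mul_div_assoc, ← add_div, div_eq_iff h]; ring) }

lemma planeEquiv_apply (a b c d : ℝ) (h : a * d - b * c ≠ 0) (p : ℝ × ℝ) :
    planeEquiv a b c d h p = (a * p.1 + b * p.2, c * p.1 + d * p.2) := rfl

lemma exists_map_volume_eq_smul (e : (ℝ × ℝ) ≃L[ℝ] (ℝ × ℝ)) :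
    ∃ c : ℝ, 0 < c ∧ Measure.map e (volume : Measure (ℝ × ℝ)) = ENNReal.ofReal c • volume := by
  have hd : LinearMap.det (e.toLinearEquiv : (ℝ × ℝ) →ₗ[ℝ] (ℝ × ℝ)) ≠ 0 :=
    (LinearEquiv.isUnit_det' e.toLinearEquiv).ne_zero
  refine ⟨_, ?_, Measure.map_linearMap_addHaar_eq_smul_addHaar (volume : Measure (ℝ × ℝ)) hd⟩
  exact abs_pos.2 (inv_ne_zero hd)

lemma locallyIntegrable_comp_equiv {f : ℝ × ℝ → ℂ} (hf : LocallyIntegrable f)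
    (e : (ℝ × ℝ) ≃L[ℝ] (ℝ × ℝ)) : LocallyIntegrable (fun p => f (e p)) := by
  obtain ⟨c, -, hm⟩ := exists_map_volume_eq_smul e
  have h := (locallyIntegrable_map_homeomorph e.toHomeomorph (f := f)
    (μ := (volume : Measure (ℝ × ℝ)))).1
  apply h
  change LocallyIntegrable f (Measure.map e volume)
  rw [hm]
  intro x
  obtain ⟨s, hs, hi⟩ := hf x
  refine ⟨s, hs, ?_⟩
  rw [IntegrableOn, Measure.restrict_smul]
  exact Integrable.smul_measure hi ENNReal.ofReal_ne_top

lemma integral_comp_equiv (e : (ℝ × ℝ) ≃L[ℝ] (ℝ × ℝ)) :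
    ∃ c : ℝ, 0 < c ∧ ∀ f : ℝ × ℝ → ℂ, ∫ p, f (e p) = c * ∫ p, f p := by
  obtain ⟨c, hc, hm⟩ := exists_map_volume_eq_smul e
  refine ⟨c, hc, fun f => ?_⟩
  have h := e.toHomeomorph.toMeasurableEquiv.measurableEmbedding.integral_map
    (μ := (volume : Measure (ℝ × ℝ))) f
  have h2 : Measure.map (e.toHomeomorph.toMeasurableEquiv) (volume : Measure (ℝ × ℝ))
      = ENNReal.ofReal c • volume := hm
  rw [h2, integral_smul_measure, ENNReal.toReal_ofReal hc.le] at h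
  rw [← Complex.real_smul, h]
  rfl

lemma locallyIntegrable_fst {f : ℝ → ℂ} (hf : LocallyIntegrable f) :
    LocallyIntegrable (fun p : ℝ × ℝ => f p.1) := by
  rw [locallyIntegrable_iff]
  intro K hK
  have h1 : IntegrableOn (fun p : ℝ × ℝ => f p.1) ((Prod.fst '' K) ×ˢ (Prod.snd '' K)) := by
    rw [IntegrableOn, Measure.volume_eq_prod, ← Measure.prod_restrict]
    have : IsFiniteMeasure (volume.restrict (Prod.snd '' K)) :=
      ⟨by simpa using (hK.image continuous_snd).measure_lt_top⟩
    exact Integrable.comp_fst (hf.integrableOn_isCompact (hK.image continuous_fst)) _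
  refine h1.mono_set fun p hp => ⟨⟨p, hp, rfl⟩, ⟨p, hp, rfl⟩⟩

lemma locallyIntegrable_comp_plane {f : ℝ → ℂ} (hf : LocallyIntegrable f) (a b : ℝ)
    (h : a ≠ 0 ∨ b ≠ 0) : LocallyIntegrable (fun p : ℝ × ℝ => f (a * p.1 + b * p.2)) := by
  have hd : a * a - b * (-b) ≠ 0 := by
    rcases h with h | h <;> nlinarith [sq_nonneg a, sq_nonneg b, sq_pos_of_ne_zero h]
  exact locallyIntegrable_comp_equiv (locallyIntegrable_fst hf) (planeEquiv a b (-b) a hd)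

lemma intervalIntegrable_of_locallyIntegrable {f : ℝ → ℂ} (hf : LocallyIntegrable f) (a b : ℝ) :
    IntervalIntegrable f volume a b :=
  intervalIntegrable_iff.2 ((hf.integrableOn_isCompact isCompact_uIcc).mono_set uIoc_subset_uIcc)

lemma locallyIntegrable_comp_affine {f : ℝ → ℂ} (hf : LocallyIntegrable f) (c : ℝ) (hc : c ≠ 0)
    (d : ℝ) : LocallyIntegrable (fun x : ℝ => f (c * x + d)) := by
  rw [locallyIntegrable_iff]
  intro K hK
  obtain ⟨r, hr⟩ := hK.isBounded.subset_closedBall 0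
  rw [Real.closedBall_eq_Icc] at hr
  have h1 : IntervalIntegrable (fun x => f (c * x + d)) volume (0 - r) (0 + r) := by
    have h2 : IntervalIntegrable (fun x => f (x + d)) volume (c * (0 - r)) (c * (0 + r)) := by
      have := (intervalIntegrable_of_locallyIntegrable hf (c * (0 - r) + d)
        (c * (0 + r) + d)).comp_add_right d
      simpa using this
    have := h2.comp_mul_left (c := c)
    rwa [mul_div_cancel_left₀ _ hc, mul_div_cancel_left₀ _ hc] at this
  rcases le_or_gt 0 r with h0 | h0
  · rw [intervalIntegrable_iff_integrableOn_Icc_of_le (by linarith)] at h1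
    exact h1.mono_set hr
  · rw [Icc_eq_empty (by linarith)] at hr
    simp [subset_empty_iff.1 hr]

/-- Fubini's theorem on the triangle with vertices `(0, 0)`, `(x, 0)`, `(x, x)`, for oriented
integrals, so that `x` may have any sign. -/
lemma triangle_swap {F : ℝ → ℝ → ℂ} (hF : LocallyIntegrable (Function.uncurry F)) (x : ℝ) :
    ∫ s in (0 : ℝ)..x, ∫ t in (0 : ℝ)..s, F s t = ∫ t in (0 : ℝ)..x, ∫ s in t..x, F s t := by
  have key : ∀ (F : ℝ → ℝ → ℂ), LocallyIntegrable (Function.uncurry F) → ∀ x : ℝ, 0 ≤ x →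
      ∫ s in (0 : ℝ)..x, ∫ t in (0 : ℝ)..s, F s t = ∫ t in (0 : ℝ)..x, ∫ s in t..x, F s t := by
    intro F hF x hx
    have h1 : ∫ s in (0 : ℝ)..x, ∫ t in (0 : ℝ)..s, F s t =
        ∫ s in (0 : ℝ)..x, ∫ t in (0 : ℝ)..x, indicator {p : ℝ × ℝ | p.2 ≤ p.1}
          (Function.uncurry F) (s, t) := by
      refine intervalIntegral.integral_congr fun s hs => ?_
      rw [uIcc_of_le hx] at hs
      rw [← intervalIntegral.integral_indicator hs]
      rfl
    have h2 : ∫ t in (0 : ℝ)..x, ∫ s in t..x, F s t =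
        ∫ t in (0 : ℝ)..x, ∫ s in (0 : ℝ)..x, indicator {p : ℝ × ℝ | p.2 ≤ p.1}
          (Function.uncurry F) (s, t) := by
      refine intervalIntegral.integral_congr fun t ht => ?_
      rw [uIcc_of_le hx] at ht
      have h3 : (fun s => indicator {p : ℝ × ℝ | p.2 ≤ p.1} (Function.uncurry F) (s, t)) =
          indicator (Ici t) (fun s => F s t) := by
        ext s
        simp [indicator, Function.uncurry]
      rw [h3, intervalIntegral.integral_of_le hx, setIntegral_indicator measurableSet_Ici,
        intervalIntegral.integral_of_le ht.2]
      refine setIntegral_congr_set ?_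
      rw [ae_eq_set]
      constructor
      · convert measure_empty (μ := (volume : Measure ℝ))
        ext s
        simp only [mem_sdiff, mem_Ioc, mem_inter_iff, mem_Ici, mem_empty_iff_false, iff_false]
        intro h
        exact h.2 ⟨⟨lt_of_le_of_lt ht.1 h.1.1, h.1.2⟩, h.1.1.le⟩
      · refine measure_mono_null (t := {t}) ?_ Real.volume_singleton
        intro s hs
        simp only [mem_sdiff, mem_Ioc, mem_inter_iff, mem_Ici] at hs
        by_contra hne
        exact hs.2 ⟨lt_of_le_of_ne hs.1.2 (Ne.symm hne), hs.1.1.2⟩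
    rw [h1, h2]
    refine intervalIntegral_intervalIntegral_swap ?_
    have h4 : IntegrableOn (Function.uncurry F) (uIcc 0 x ×ˢ uIcc 0 x) :=
      hF.integrableOn_isCompact (isCompact_uIcc.prod isCompact_uIcc)
    have h5 : IntegrableOn (indicator {p : ℝ × ℝ | p.2 ≤ p.1} (Function.uncurry F))
        (uIcc 0 x ×ˢ uIcc 0 x) :=
      Integrable.indicator h4 (measurableSet_le measurable_snd measurable_fst)
    exact h5.mono_set (prod_mono uIoc_subset_uIcc uIoc_subset_uIcc)
  rcases le_total 0 x with hx | hx
  · exact key F hF x hx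
  -- a negative `x` is reduced to the case above by reflecting both variables
  · have hG : LocallyIntegrable (Function.uncurry fun s t => F (-s) (-t)) := by
      have := locallyIntegrable_comp_equiv hF (planeEquiv (-1) 0 0 (-1) (by norm_num))
      refine this.congr (Filter.Eventually.of_forall fun p => ?_)
      simp [planeEquiv_apply, Function.uncurry]
    have h := key _ hG (-x) (by linarith)
    have e1 : ∀ s : ℝ, ∫ t in (0 : ℝ)..s, F (-s) (-t) = -∫ t in (0 : ℝ)..(-s), F (-s) t := by
      intro s
      rw [intervalIntegral.integral_comp_neg (fun t => F (-s) t), intervalIntegral.integral_symm]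
      simp
    have e2 : ∀ t : ℝ, ∫ s in t..(-x), F (-s) (-t) = -∫ s in (-t)..x, F s (-t) := by
      intro t
      rw [intervalIntegral.integral_comp_neg (fun s => F s (-t)), intervalIntegral.integral_symm]
      simp
    simp only [e1, e2, intervalIntegral.integral_neg, neg_inj] at h
    rw [intervalIntegral.integral_comp_neg (fun s => ∫ t in (0 : ℝ)..s, F s t),
      intervalIntegral.integral_comp_neg (fun t => ∫ s in t..x, F s t)] at h
    simp only [neg_neg, neg_zero] at h
    rw [intervalIntegral.integral_symm, h, ← intervalIntegral.integral_symm]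

/-- A locally integrable weight times a jointly continuous function, integrated between continuous
limits, depends continuously on the parameter. -/
lemma continuous_weighted_integral {X : Type*} [TopologicalSpace X] [FirstCountableTopology X]
    [LocallyCompactSpace X] {f : ℝ → ℂ} (hf : LocallyIntegrable f) {ψ : X → ℝ → ℂ}
    (hψ : Continuous (Function.uncurry ψ)) {l r : X → ℝ} (hl : Continuous l) (hr : Continuous r) :
    Continuous (fun x => ∫ s in (l x)..(r x), f s * ψ x s) := by
  have key : ∀ r : X → ℝ, Continuous r →
      Continuous (fun x => ∫ s in (0:ℝ)..(r x), f s * ψ x s) := by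
    intro r hr
    have h0 : Continuous (fun p : X × ℝ => ∫ s in (0:ℝ)..p.2, f s * ψ p.1 s) := by
      rw [continuous_iff_continuousAt]
      rintro ⟨x₀, b₀⟩
      obtain ⟨K, hK, hKx⟩ := exists_compact_mem_nhds x₀
      obtain ⟨a, ha⟩ := exists_lt (min 0 b₀)
      obtain ⟨b, hb⟩ := exists_gt (max 0 b₀)
      rw [lt_min_iff] at ha
      rw [max_lt_iff] at hb
      obtain ⟨C, hC⟩ := (hK.prod (isCompact_uIcc (a := a) (b := b))).exists_bound_of_continuousOn
        hψ.continuousOn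
      refine intervalIntegral.continuousAt_parametric_primitive_of_dominated
        (μ := volume) (F := fun x s => f s * ψ x s)
        (fun s => ‖f s‖ * C) a b (fun x => ?_) ?_ ?_ ?_ ⟨ha.1, hb.1⟩ ⟨ha.2, hb.2⟩
        Real.volume_singleton
      · exact (hf.aestronglyMeasurable.mul
          (hψ.comp (Continuous.prodMk_right x)).aestronglyMeasurable).restrict
      · filter_upwards [hKx] with x hx
        refine (ae_restrict_iff' measurableSet_uIoc).2 (Filter.Eventually.of_forall fun s hs => ?_)
        rw [norm_mul]
        exact mul_le_mul_of_nonneg_left (hC (x, s) ⟨hx, uIoc_subset_uIcc hs⟩) (norm_nonneg _)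
      · exact ((intervalIntegrable_of_locallyIntegrable hf _ _).norm.mul_const C)
      · refine Filter.Eventually.of_forall fun s => ?_
        exact (continuous_const.mul (hψ.comp (Continuous.prodMk_left s))).continuousAt
    exact h0.comp (continuous_id.prodMk hr)
  have hi : ∀ x a b, IntervalIntegrable (fun s => f s * ψ x s) volume a b := fun x a b =>
    (intervalIntegrable_of_locallyIntegrable hf _ _).mul_continuousOn
      (hψ.comp (Continuous.prodMk_right x)).continuousOn
  have : (fun x => ∫ s in (l x)..(r x), f s * ψ x s) = fun x =>
      (∫ s in (0:ℝ)..(r x), f s * ψ x s) - ∫ s in (0:ℝ)..(l x), f s * ψ x s := by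
    ext x
    rw [intervalIntegral.integral_interval_sub_left (hi _ _ _) (hi _ _ _)]
  rw [this]
  exact (key r hr).sub (key l hl)

/-- The variant of `continuous_weighted_integral` in which the weight is moved along with the
parameter. An affine substitution removes the motion. -/
lemma continuous_integral_affine_weight {X : Type*} [TopologicalSpace X]
    [FirstCountableTopology X] [LocallyCompactSpace X] {q : ℝ → ℂ} (hq : LocallyIntegrable q)
    {ε : ℝ} (hε : ε ≠ 0) {ψ : X → ℝ → ℂ} (hψ : Continuous (Function.uncurry ψ)) {c w : X → ℝ}
    (hc : Continuous c) (hw : Continuous w) :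
    Continuous (fun x => ∫ β in (0 : ℝ)..(w x), q (c x + ε * β) * ψ x β) := by
  have h : (fun x => ∫ β in (0 : ℝ)..(w x), q (c x + ε * β) * ψ x β) = fun x =>
      ε⁻¹ • ∫ s in (c x + ε * 0)..(c x + ε * w x), q s * ψ x ((s - c x) / ε) := by
    ext x
    rw [← intervalIntegral.integral_comp_add_mul (fun s => q s * ψ x ((s - c x) / ε)) hε]
    refine intervalIntegral.integral_congr fun β _ => ?_
    have h2 : (c x + ε * β - c x) / ε = β := by field_simp; ring
    rw [h2]
  rw [h]
  have h3 : Continuous (fun x => ∫ s in (c x + ε * 0)..(c x + ε * w x),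
      q s * ψ x ((s - c x) / ε)) := by
    refine continuous_weighted_integral hq (ψ := fun x s => ψ x ((s - c x) / ε)) ?_
      (by fun_prop) (by fun_prop)
    exact hψ.comp (f := fun p : X × ℝ => (p.1, (p.2 - c p.1) / ε)) (by fun_prop)
  exact h3.const_smul ε⁻¹

lemma norm_integral_translate_le {q : ℝ → ℂ} (hq : Integrable q) {g : ℝ → ℂ} {M : ℝ}
    (c v : ℝ) (hM : ∀ β ∈ uIcc 0 v, ‖g β‖ ≤ M) :
    ‖∫ β in (0 : ℝ)..v, q (c + β) * g β‖ ≤ (∫ s, ‖q s‖) * M := by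
  have hM0 : 0 ≤ M := (norm_nonneg _).trans (hM 0 left_mem_uIcc)
  have hqc : Integrable (fun β => ‖q (c + β)‖ * M) := ((hq.comp_add_left c).norm).mul_const M
  calc ‖∫ β in (0 : ℝ)..v, q (c + β) * g β‖ ≤ ∫ β in uIoc 0 v, ‖q (c + β) * g β‖ :=
        intervalIntegral.norm_integral_le_integral_norm_uIoc
    _ ≤ ∫ β in uIoc 0 v, ‖q (c + β)‖ * M := by
        refine integral_mono_of_nonneg (Filter.Eventually.of_forall fun _ => norm_nonneg _)
          hqc.integrableOn ?_
        refine (ae_restrict_iff' measurableSet_uIoc).2 (Filter.Eventually.of_forall fun β hβ => ?_)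
        simp only [norm_mul]
        exact mul_le_mul_of_nonneg_left (hM β (uIoc_subset_uIcc hβ)) (norm_nonneg _)
    _ ≤ ∫ β, ‖q (c + β)‖ * M :=
        setIntegral_le_integral hqc (Filter.Eventually.of_forall fun _ => by positivity)
    _ = (∫ s, ‖q s‖) * M := by
        rw [integral_mul_const, integral_add_left_eq_self (fun s => ‖q s‖) c]

lemma norm_integral_le_exp_weight {F : ℝ → ℂ} {C r u : ℝ} (hr : 0 < r)
    (hF : ∀ s ∈ uIcc 0 u, ‖F s‖ ≤ C * Real.exp (r * |s|)) :
    ‖∫ s in (0 : ℝ)..u, F s‖ ≤ C / r * Real.exp (r * |u|) := by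
  have key : ∀ (F : ℝ → ℂ) (u : ℝ), 0 ≤ u → (∀ s ∈ uIcc 0 u, ‖F s‖ ≤ C * Real.exp (r * |s|)) →
      ‖∫ s in (0 : ℝ)..u, F s‖ ≤ C / r * Real.exp (r * |u|) := by
    intro F u hu hF
    have hC : 0 ≤ C := by
      have := (norm_nonneg _).trans (hF 0 left_mem_uIcc)
      simpa using this
    have h1 : ‖∫ s in (0 : ℝ)..u, F s‖ ≤ ∫ s in (0 : ℝ)..u, C * Real.exp (r * s) := by
      refine intervalIntegral.norm_integral_le_of_norm_le hu ?_ ?_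
      · refine Filter.Eventually.of_forall fun s hs => ?_
        have := hF s (by rw [uIcc_of_le hu]; exact Ioc_subset_Icc_self hs)
        rwa [abs_of_pos hs.1] at this
      · exact Continuous.intervalIntegrable (by fun_prop) _ _
    have h2 : ∫ s in (0 : ℝ)..u, C * Real.exp (r * s) = C / r * (Real.exp (r * u) - 1) := by
      rw [intervalIntegral.integral_const_mul,
        intervalIntegral.integral_comp_mul_left (fun x => Real.exp x) hr.ne', integral_exp]
      simp
      field_simp
    rw [h2] at h1
    rw [abs_of_nonneg hu]
    exact h1.trans (mul_le_mul_of_nonneg_left (by linarith) (by positivity))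
  rcases le_total 0 u with hu | hu
  · exact key F u hu hF
  · have := key (fun s => F (-s)) (-u) (by linarith) (fun s hs => by
      have h := hF (-s) (by
        rw [uIcc_of_le (by linarith)] at hs
        rw [uIcc_of_ge hu]
        exact ⟨by linarith [hs.2], by linarith [hs.1]⟩)
      rwa [abs_neg] at h)
    rw [intervalIntegral.integral_comp_neg, intervalIntegral.integral_symm, norm_neg,
      abs_neg] at this
    simpa using this

/-- The integral operator of the integral equation gains a factor `‖q‖₁ / r` in the norm weighted by
`exp (-r |u|)`. -/
lemma norm_double_integral_le {q : ℝ → ℂ} (hq : Integrable q) {h : ℝ → ℝ → ℂ} {M r u v : ℝ}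
    (hr : 0 < r) (hM : ∀ α ∈ uIcc 0 u, ∀ β ∈ uIcc 0 v, ‖h α β‖ ≤ M * Real.exp (r * |α|)) :
    ‖∫ α in (0 : ℝ)..u, ∫ β in (0 : ℝ)..v, q (α + β) * h α β‖ ≤
      (∫ s, ‖q s‖) * M / r * Real.exp (r * |u|) := by
  refine norm_integral_le_exp_weight hr fun α hα => ?_
  rw [mul_assoc]
  exact norm_integral_translate_le hq α v (fun β hβ => hM α hα β hβ)

lemma continuous_double_integral {q : ℝ → ℂ} (hq : LocallyIntegrable q) {h : ℝ → ℝ → ℂ}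
    (hh : Continuous (Function.uncurry h)) :
    Continuous (fun p : ℝ × ℝ => ∫ α in (0 : ℝ)..p.1, ∫ β in (0 : ℝ)..p.2, q (α + β) * h α β) := by
  have h1 : Continuous (Function.uncurry fun (p : ℝ × ℝ) (α : ℝ) =>
      ∫ β in (0 : ℝ)..p.2, q (α + β) * h α β) := by
    have := continuous_integral_affine_weight (X := (ℝ × ℝ) × ℝ) hq one_ne_zero
      (ψ := fun p β => h p.2 β) (c := fun p => p.2) (w := fun p => p.1.2)
      (hh.comp (f := fun r : ((ℝ × ℝ) × ℝ) × ℝ => (r.1.2, r.2)) (by fun_prop))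
      (by fun_prop) (by fun_prop)
    simpa [Function.uncurry_def] using this
  exact intervalIntegral.continuous_parametric_intervalIntegral_of_continuous h1 continuous_fst

lemma continuous_inner_integral {q : ℝ → ℂ} (hq : LocallyIntegrable q) {h : ℝ → ℝ → ℂ}
    (hh : Continuous (Function.uncurry h)) (v : ℝ) :
    Continuous (fun α : ℝ => ∫ β in (0 : ℝ)..v, q (α + β) * h α β) := by
  have := continuous_integral_affine_weight hq one_ne_zero (ψ := h) hh
    (c := fun α : ℝ => α) (w := fun _ => v) (by fun_prop) (by fun_prop)
  simpa using this

lemma intervalIntegrable_inner {q : ℝ → ℂ} (hq : LocallyIntegrable q) {h : ℝ → ℝ → ℂ}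
    (hh : Continuous (Function.uncurry h)) (α v : ℝ) :
    IntervalIntegrable (fun β => q (α + β) * h α β) volume 0 v := by
  have h1 := intervalIntegrable_of_locallyIntegrable
    (locallyIntegrable_comp_affine hq 1 one_ne_zero α) 0 v
  refine IntervalIntegrable.mul_continuousOn (f := fun β => q (α + β)) ?_
    (hh.comp (Continuous.prodMk_right α)).continuousOn
  simpa [add_comm] using h1

lemma double_integral_sub {q : ℝ → ℂ} (hq : LocallyIntegrable q) {h h' : ℝ → ℝ → ℂ}
    (hh : Continuous (Function.uncurry h)) (hh' : Continuous (Function.uncurry h')) (u v : ℝ) :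
    (∫ α in (0 : ℝ)..u, ∫ β in (0 : ℝ)..v, q (α + β) * h α β) -
      ∫ α in (0 : ℝ)..u, ∫ β in (0 : ℝ)..v, q (α + β) * h' α β =
    ∫ α in (0 : ℝ)..u, ∫ β in (0 : ℝ)..v, q (α + β) * (h α β - h' α β) := by
  rw [← intervalIntegral.integral_sub ((continuous_inner_integral hq hh v).intervalIntegrable _ _)
    ((continuous_inner_integral hq hh' v).intervalIntegrable _ _)]
  refine intervalIntegral.integral_congr fun α _ => ?_
  rw [← intervalIntegral.integral_sub (intervalIntegrable_inner hq hh α v)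
    (intervalIntegrable_inner hq hh' α v)]
  simp only [mul_sub]

/-! ### The integral equation on the plane -/

/-- A continuous solution on the whole plane of the integral equation with potential `q`. -/
structure IsGlobalSolution (q : ℝ → ℂ) (H : ℝ → ℝ → ℂ) : Prop where
  continuous : Continuous (Function.uncurry H)
  eq : ∀ u v : ℝ, H u v = (1 / 2) * (∫ s in (0 : ℝ)..u, q s) +
      ∫ α in (0 : ℝ)..u, ∫ β in (0 : ℝ)..v, q (α + β) * H α β

/-- The solution is sought in the form `exp (r |u|) G(u, v)` with `G` bounded and continuous. For
`r` larger than `2 ‖q‖₁` the equation for `G` is a fixed point equation for a contraction. -/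
theorem exists_isGlobalSolution {q : ℝ → ℂ} (hq : Integrable q) :
    ∃ H, IsGlobalSolution q H := by
  set N : ℝ := ∫ s, ‖q s‖ with hN
  have hN0 : 0 ≤ N := integral_nonneg fun _ => norm_nonneg _
  set r : ℝ := 2 * N + 1 with hr
  have hr0 : 0 < r := by positivity
  have hql := hq.locallyIntegrable
  let h : (ℝ × ℝ →ᵇ ℂ) → ℝ → ℝ → ℂ := fun G α β => (Real.exp (r * |α|) : ℂ) * G (α, β)
  have hh : ∀ G, Continuous (Function.uncurry (h G)) := fun G =>
    (Complex.continuous_ofReal.comp (by fun_prop)).mul G.continuous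
  let F : (ℝ × ℝ →ᵇ ℂ) → ℝ × ℝ → ℂ := fun G p => (Real.exp (-(r * |p.1|)) : ℂ) *
    ((1 / 2) * (∫ s in (0 : ℝ)..p.1, q s) +
      ∫ α in (0 : ℝ)..p.1, ∫ β in (0 : ℝ)..p.2, q (α + β) * h G α β)
  have hprim : Continuous (fun p : ℝ × ℝ => ∫ s in (0 : ℝ)..p.1, q s) :=
    (intervalIntegral.continuous_primitive (fun a b => hq.intervalIntegrable) 0).comp continuous_fst
  have hF : ∀ G, Continuous (F G) := fun G =>
    (Complex.continuous_ofReal.comp (by fun_prop)).mul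
      ((continuous_const.mul hprim).add (continuous_double_integral hql (hh G)))
  have hexp : ∀ x : ℝ, ‖(Real.exp (-(r * |x|)) : ℂ)‖ = Real.exp (-(r * |x|)) := fun x => by
    rw [Complex.norm_real, Real.norm_of_nonneg (Real.exp_pos _).le]
  have hexp' : ∀ x : ℝ, ‖(Real.exp (r * |x|) : ℂ)‖ = Real.exp (r * |x|) := fun x => by
    rw [Complex.norm_real, Real.norm_of_nonneg (Real.exp_pos _).le]
  -- the weighted integral operator has norm at most `N / r ≤ 1 / 2`
  have hdbl : ∀ (g : ℝ → ℝ → ℂ) (M : ℝ), (∀ α β, ‖g α β‖ ≤ M * Real.exp (r * |α|)) → ∀ p : ℝ × ℝ,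
      ‖(Real.exp (-(r * |p.1|)) : ℂ) *
        ∫ α in (0 : ℝ)..p.1, ∫ β in (0 : ℝ)..p.2, q (α + β) * g α β‖ ≤ 1 / 2 * M := by
    intro g M hg p
    have hM : 0 ≤ M := by simpa using (norm_nonneg _).trans (hg 0 0)
    rw [norm_mul, hexp]
    have h1 := norm_double_integral_le hq (u := p.1) (v := p.2) hr0 (fun α _ β _ => hg α β)
    calc _ ≤ Real.exp (-(r * |p.1|)) * (N * M / r * Real.exp (r * |p.1|)) :=
          mul_le_mul_of_nonneg_left h1 (Real.exp_pos _).le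
      _ = N / r * M := by
          rw [mul_comm, mul_assoc, ← Real.exp_add]; simp; ring
      _ ≤ 1 / 2 * M := by
          refine mul_le_mul_of_nonneg_right ?_ hM
          rw [div_le_div_iff₀ hr0 two_pos]; linarith
  have hhG : ∀ G α β, ‖h G α β‖ ≤ ‖G‖ * Real.exp (r * |α|) := fun G α β => by
    rw [norm_mul, hexp', mul_comm]
    exact mul_le_mul_of_nonneg_right (G.norm_coe_le_norm _) (Real.exp_pos _).le
  have hbd : ∀ G p, ‖F G p‖ ≤ 1 / 2 * N + 1 / 2 * ‖G‖ := by
    intro G p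
    simp only [F, mul_add]
    refine (norm_add_le _ _).trans (add_le_add ?_ (hdbl _ _ (hhG G) p))
    rw [norm_mul, hexp, norm_mul]
    have h1 : ‖∫ s in (0 : ℝ)..p.1, q s‖ ≤ N :=
      intervalIntegral.norm_integral_le_integral_norm_uIoc.trans
        (setIntegral_le_integral hq.norm (Filter.Eventually.of_forall fun _ => norm_nonneg _))
    have h2 : Real.exp (-(r * |p.1|)) ≤ 1 := Real.exp_le_one_iff.2 (by
      have := abs_nonneg p.1; nlinarith)
    have h3 : ‖(1 / 2 : ℂ)‖ = 1 / 2 := by norm_num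
    rw [h3]
    calc _ ≤ 1 * (1 / 2 * N) := by gcongr
      _ = _ := one_mul _
  let Φ : (ℝ × ℝ →ᵇ ℂ) → (ℝ × ℝ →ᵇ ℂ) := fun G =>
    BoundedContinuousFunction.ofNormedAddCommGroup (F G) (hF G) _ (hbd G)
  have hΦ : ContractingWith (1 / 2) Φ := by
    refine ⟨by rw [← NNReal.coe_lt_coe]; norm_num, LipschitzWith.of_dist_le_mul fun G G' => ?_⟩
    rw [BoundedContinuousFunction.dist_le (by positivity)]
    intro p
    rw [dist_eq_norm, dist_eq_norm]
    have h1 : Φ G p - Φ G' p = (Real.exp (-(r * |p.1|)) : ℂ) *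
        ∫ α in (0 : ℝ)..p.1, ∫ β in (0 : ℝ)..p.2, q (α + β) * (h G α β - h G' α β) := by
      rw [← double_integral_sub hql (hh G) (hh G')]
      change F G p - F G' p = _
      simp only [F]
      ring
    rw [h1]
    refine (hdbl _ ‖G - G'‖ (fun α β => ?_) p).trans (le_of_eq (by simp))
    have h2 : h G α β - h G' α β = h (G - G') α β := by simp [h, mul_sub]
    rw [h2]
    exact hhG _ _ _
  obtain ⟨G, hG⟩ : ∃ G, Φ G = G := ⟨_, hΦ.fixedPoint_isFixedPt⟩
  refine ⟨h G, hh G, fun u v => ?_⟩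
  have h1 : F G (u, v) = G (u, v) := congrArg (fun g : ℝ × ℝ →ᵇ ℂ => g (u, v)) hG
  change (Real.exp (r * |u|) : ℂ) * G (u, v) = _
  rw [← h1]
  simp only [F]
  rw [← mul_assoc, ← Complex.ofReal_mul, ← Real.exp_add]
  simp

/-! ### The integral equation on the diamond -/

lemma isClosed_diamond (a : ℝ) : IsClosed (Diamond a) :=
  isClosed_le (by fun_prop) continuous_const

lemma isCompact_diamond (a : ℝ) : IsCompact (Diamond a) := by
  refine Metric.isCompact_of_isClosed_isBounded (isClosed_diamond a) ?_
  refine (Metric.isBounded_closedBall (x := (0 : ℝ × ℝ)) (r := a)).subset fun p hp => ?_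
  have h : |p.1| + |p.2| ≤ a := hp
  rw [mem_closedBall_zero_iff, Prod.norm_def, Real.norm_eq_abs, Real.norm_eq_abs]
  exact max_le (by linarith [abs_nonneg p.2]) (by linarith [abs_nonneg p.1])

lemma abs_le_of_mem_uIcc_zero {s u : ℝ} (h : s ∈ uIcc 0 u) : |s| ≤ |u| := by
  rcases le_total 0 u with hu | hu
  · rw [uIcc_of_le hu] at h
    rw [abs_of_nonneg hu, abs_of_nonneg h.1]; exact h.2
  · rw [uIcc_of_ge hu] at h
    rw [abs_of_nonpos hu, abs_of_nonpos h.2]; linarith [h.1]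

lemma mem_diamond_of_mem_uIcc {a u v α β : ℝ} (h : (u, v) ∈ Diamond a) (hα : α ∈ uIcc 0 u)
    (hβ : β ∈ uIcc 0 v) : (α, β) ∈ Diamond a :=
  (add_le_add (abs_le_of_mem_uIcc_zero hα) (abs_le_of_mem_uIcc_zero hβ)).trans h

/-- The double integral only depends on the values of `q` almost everywhere in `(-a, a)` and on the
values of `H` on the diamond. -/
lemma double_integral_congr {a : ℝ} {q q' : ℝ → ℂ} {H H' : ℝ → ℝ → ℂ}
    (hq : q =ᵐ[volume.restrict (I a : Set ℝ)] q') (hH : ∀ u v, (u, v) ∈ Diamond a → H u v = H' u v)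
    {u v : ℝ} (h : (u, v) ∈ Diamond a) :
    ∫ α in (0 : ℝ)..u, ∫ β in (0 : ℝ)..v, q (α + β) * H α β =
      ∫ α in (0 : ℝ)..u, ∫ β in (0 : ℝ)..v, q' (α + β) * H' α β := by
  refine intervalIntegral.integral_congr fun α hα => ?_
  refine intervalIntegral.integral_congr_ae ?_
  have h1 : ∀ᵐ s : ℝ, s ∈ (I a : Set ℝ) → q s = q' s :=
    (ae_restrict_iff' measurableSet_Ioo).1 hq
  have h2 := (measurePreserving_add_left (volume : Measure ℝ) α).quasiMeasurePreserving.ae h1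
  have h3 : ∀ᵐ β : ℝ, β ≠ a - α := by simp [ae_iff]
  have h4 : ∀ᵐ β : ℝ, β ≠ -a - α := by simp [ae_iff]
  filter_upwards [h2, h3, h4] with β h2 h3 h4 hβ
  have hd := mem_diamond_of_mem_uIcc h hα (uIoc_subset_uIcc hβ)
  have hle : |α + β| ≤ a := (abs_add_le _ _).trans hd
  rw [hH α β hd, h2]
  rw [abs_le] at hle
  exact ⟨lt_of_le_of_ne hle.1 (fun h => h4 (by linarith)),
    lt_of_le_of_ne hle.2 (fun h => h3 (by linarith))⟩

lemma integral_congr_potential {a : ℝ} {q q' : ℝ → ℂ}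
    (hq : q =ᵐ[volume.restrict (I a : Set ℝ)] q') {u : ℝ} (h : |u| ≤ a) :
    ∫ s in (0 : ℝ)..u, q s = ∫ s in (0 : ℝ)..u, q' s := by
  refine intervalIntegral.integral_congr_ae ?_
  have h1 : ∀ᵐ s : ℝ, s ∈ (I a : Set ℝ) → q s = q' s :=
    (ae_restrict_iff' measurableSet_Ioo).1 hq
  have h3 : ∀ᵐ β : ℝ, β ≠ a := by simp [ae_iff]
  have h4 : ∀ᵐ β : ℝ, β ≠ -a := by simp [ae_iff]
  filter_upwards [h1, h3, h4] with s h1 h3 h4 hs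
  have hle := (abs_le_of_mem_uIcc_zero (uIoc_subset_uIcc hs)).trans h
  rw [abs_le] at hle
  exact h1 ⟨lt_of_le_of_ne hle.1 (Ne.symm h4), lt_of_le_of_ne hle.2 h3⟩

lemma SolvesIntegralEq.congr {a : ℝ} {q q' : ℝ → ℂ} {H H' : ℝ → ℝ → ℂ}
    (h : SolvesIntegralEq a q H) (hq : q =ᵐ[volume.restrict (I a : Set ℝ)] q')
    (hH : ∀ u v, (u, v) ∈ Diamond a → H u v = H' u v) : SolvesIntegralEq a q' H' := by
  refine ⟨h.continuousOn.congr fun p hp => (hH p.1 p.2 hp).symm, fun u v huv => ?_⟩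
  have hu : |u| ≤ a := by
    have h1 : |u| + |v| ≤ a := huv
    linarith [abs_nonneg v]
  rw [← hH u v huv, h.eq u v huv, double_integral_congr hq hH huv, integral_congr_potential hq hu]

/-- By Tietze's theorem a solution may be taken continuous on the whole plane; this makes all the
integrands involving it measurable and locally integrable. -/
lemma SolvesIntegralEq.exists_continuous_extension {a : ℝ} {q : ℝ → ℂ} {H : ℝ → ℝ → ℂ}
    (h : SolvesIntegralEq a q H) :
    ∃ H' : ℝ → ℝ → ℂ, Continuous (Function.uncurry H') ∧
      ∀ u v, (u, v) ∈ Diamond a → H u v = H' u v := by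
  obtain ⟨g, hg⟩ := ContinuousMap.exists_restrict_eq (isClosed_diamond a)
    ⟨_, h.continuousOn.domRestrict⟩
  refine ⟨fun u v => g (u, v), g.continuous, fun u v huv => ?_⟩
  exact (congrArg (fun f : C(Diamond a, ℂ) => f ⟨(u, v), huv⟩) hg).symm

theorem SolvesIntegralEq.unique_of_integrable {a : ℝ} {q : ℝ → ℂ} (hq : Integrable q)
    {H H' : ℝ → ℝ → ℂ} (h : SolvesIntegralEq a q H) (h' : SolvesIntegralEq a q H') :
    ∀ u v, (u, v) ∈ Diamond a → H u v = H' u v := by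
  obtain ⟨E, hE, hHE⟩ := h.exists_continuous_extension
  obtain ⟨E', hE', hHE'⟩ := h'.exists_continuous_extension
  have hs := h.congr (ae_eq_refl _) hHE
  have hs' := h'.congr (ae_eq_refl _) hHE'
  intro u v huv
  rw [hHE u v huv, hHE' u v huv]
  set N : ℝ := ∫ s, ‖q s‖ with hN
  have hN0 : 0 ≤ N := integral_nonneg fun _ => norm_nonneg _
  set r : ℝ := 2 * N + 1 with hr
  have hr0 : 0 < r := by positivity
  -- the weighted difference attains its maximum, which the equation bounds by half of itself
  obtain ⟨p, hp, hmax⟩ := (isCompact_diamond a).exists_isMaxOn ⟨_, huv⟩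
    (f := fun p : ℝ × ℝ => Real.exp (-(r * |p.1|)) * ‖E p.1 p.2 - E' p.1 p.2‖)
    (Continuous.continuousOn (by
      have h1 : Continuous fun p : ℝ × ℝ => E p.1 p.2 := hE
      have h2 : Continuous fun p : ℝ × ℝ => E' p.1 p.2 := hE'
      fun_prop))
  set M := Real.exp (-(r * |p.1|)) * ‖E p.1 p.2 - E' p.1 p.2‖ with hM
  have hle : ∀ α β, (α, β) ∈ Diamond a → ‖E α β - E' α β‖ ≤ M * Real.exp (r * |α|) := by
    intro α β hαβ
    have h1 : Real.exp (-(r * |α|)) * ‖E α β - E' α β‖ ≤ M := hmax hαβ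
    rw [Real.exp_neg, inv_mul_le_iff₀ (Real.exp_pos _)] at h1
    rwa [mul_comm]
  have hM0 : 0 ≤ M := by positivity
  have hM1 : M ≤ 1 / 2 * M := by
    have h1 : E p.1 p.2 - E' p.1 p.2 =
        ∫ α in (0 : ℝ)..p.1, ∫ β in (0 : ℝ)..p.2, q (α + β) * (E α β - E' α β) := by
      rw [← double_integral_sub hq.locallyIntegrable hE hE', hs.eq _ _ hp, hs'.eq _ _ hp]
      ring
    have h2 := norm_double_integral_le hq (u := p.1) (v := p.2) (M := M) hr0
      (fun α hα β hβ => hle α β (mem_diamond_of_mem_uIcc hp hα hβ))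
    rw [← h1] at h2
    calc M ≤ Real.exp (-(r * |p.1|)) * (N * M / r * Real.exp (r * |p.1|)) :=
          mul_le_mul_of_nonneg_left h2 (Real.exp_pos _).le
      _ = N / r * M := by
          rw [mul_comm, mul_assoc, ← Real.exp_add]; simp; ring
      _ ≤ 1 / 2 * M := by
          refine mul_le_mul_of_nonneg_right ?_ hM0
          rw [div_le_div_iff₀ hr0 two_pos]; linarith
  have hM2 : M = 0 := by linarith
  have h3 := hle u v huv
  rw [hM2, zero_mul] at h3
  exact sub_eq_zero.1 (norm_le_zero_iff.1 h3)

/-! ### Volterra operators with a kernel in characteristic coordinates -/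

lemma locallyIntegrable_mul_prod {f g : ℝ → ℂ} (hf : LocallyIntegrable f)
    (hg : LocallyIntegrable g) : LocallyIntegrable (fun p : ℝ × ℝ => f p.1 * g p.2) := by
  rw [locallyIntegrable_iff]
  intro K hK
  have h1 : IntegrableOn (fun p : ℝ × ℝ => f p.1 * g p.2)
      ((Prod.fst '' K) ×ˢ (Prod.snd '' K)) := by
    rw [IntegrableOn, Measure.volume_eq_prod, ← Measure.prod_restrict]
    exact Integrable.mul_prod (hf.integrableOn_isCompact (hK.image continuous_fst))
      (hg.integrableOn_isCompact (hK.image continuous_snd))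
  exact h1.mono_set fun p hp => ⟨⟨p, hp, rfl⟩, ⟨p, hp, rfl⟩⟩

lemma locallyIntegrable_snd {f : ℝ → ℂ} (hf : LocallyIntegrable f) :
    LocallyIntegrable (fun p : ℝ × ℝ => f p.2) := by
  simpa using locallyIntegrable_comp_plane hf 0 1 (Or.inr one_ne_zero)

lemma integral_symm_interval_subst (f : ℝ → ℂ) (x : ℝ) :
    ∫ t in (-x)..x, f t = 2 * ∫ s in (0 : ℝ)..x, f (2 * s - x) := by
  rw [intervalIntegral.integral_comp_mul_sub f two_ne_zero]
  simp only [mul_zero, zero_sub, Complex.real_smul, Complex.ofReal_inv, Complex.ofReal_ofNat]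
  rw [show (2 : ℝ) * x - x = x by ring, ← mul_assoc, mul_inv_cancel₀ two_ne_zero, one_mul]

/-- The part of the kernel depending on `x + t` only, after exchanging the integrations. -/
lemma integral_kernel_potential {p v : ℝ → ℂ} (hp : LocallyIntegrable p)
    (hv : LocallyIntegrable v) (x : ℝ) :
    ∫ t in (-x)..x, ((1 / 2) * ∫ s in (0 : ℝ)..((x + t) / 2), p s) * v t =
      ∫ α in (0 : ℝ)..x, (1 / 2) * p α * ∫ t in (2 * α - x)..x, v t := by
  rw [integral_symm_interval_subst]
  have hF : LocallyIntegrable (Function.uncurry fun s α => v (2 * s - x) * p α) := by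
    have := locallyIntegrable_comp_affine hv 2 two_ne_zero (-x)
    exact locallyIntegrable_mul_prod this hp
  have h1 := triangle_swap hF x
  have h2 : ∀ s : ℝ, ((1 / 2) * ∫ α in (0 : ℝ)..((x + (2 * s - x)) / 2), p α) * v (2 * s - x) =
      (1 / 2) * ∫ α in (0 : ℝ)..s, v (2 * s - x) * p α := by
    intro s
    rw [show (x + (2 * s - x)) / 2 = s by ring, intervalIntegral.integral_const_mul]
    ring
  simp only [h2]
  rw [intervalIntegral.integral_const_mul, h1, ← mul_assoc, mul_one_div_cancel two_ne_zero, one_mul]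
  refine intervalIntegral.integral_congr fun α _ => ?_
  rw [intervalIntegral.integral_mul_const, intervalIntegral.integral_comp_mul_sub v two_ne_zero,
    show (2 : ℝ) * x - x = x by ring]
  simp
  ring

section Generic

variable {q : ℝ → ℂ} (hq : LocallyIntegrable q) {ε : ℝ} (hε : ε ≠ 0) {h : ℝ → ℝ → ℂ}
  (hh : Continuous (Function.uncurry h))

include hq hε hh in
lemma locallyIntegrable_inner (α : ℝ) : LocallyIntegrable (fun β => q (α + ε * β) * h α β) := by
  have h1 := locallyIntegrable_comp_affine hq ε hε α
  have h2 := LocallyIntegrable.mul_continuous (hh.comp (Continuous.prodMk_right α)) h1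
  refine h2.congr (Filter.Eventually.of_forall fun β => ?_)
  simp [Function.uncurry, add_comm]

include hq hε hh in
/-- The part of the kernel given by a double integral, after exchanging the integrations. -/
lemma integral_kernel_double {v : ℝ → ℂ} (hv : LocallyIntegrable v) (x : ℝ) :
    ∫ t in (-x)..x, (∫ α in (0 : ℝ)..((x + t) / 2), ∫ β in (0 : ℝ)..((x - t) / 2),
        q (α + ε * β) * h α β) * v t =
      ∫ α in (0 : ℝ)..x, ∫ β in (0 : ℝ)..(x - α), q (α + ε * β) * h α β *
        ∫ t in (2 * α - x)..(x - 2 * β), v t := by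
  rw [integral_symm_interval_subst]
  have h2 : ∀ s : ℝ, (∫ α in (0 : ℝ)..((x + (2 * s - x)) / 2),
      ∫ β in (0 : ℝ)..((x - (2 * s - x)) / 2), q (α + ε * β) * h α β) * v (2 * s - x) =
      ∫ α in (0 : ℝ)..s, v (2 * s - x) * ∫ β in (0 : ℝ)..(x - s), q (α + ε * β) * h α β := by
    intro s
    rw [show (x + (2 * s - x)) / 2 = s by ring, show (x - (2 * s - x)) / 2 = x - s by ring,
      intervalIntegral.integral_const_mul]
    ring
  simp only [h2]
  have hF : LocallyIntegrable (Function.uncurry fun s α =>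
      v (2 * s - x) * ∫ β in (0 : ℝ)..(x - s), q (α + ε * β) * h α β) := by
    have h3 := locallyIntegrable_fst (locallyIntegrable_comp_affine hv 2 two_ne_zero (-x))
    have h4 := continuous_integral_affine_weight (X := ℝ × ℝ) hq hε (ψ := fun p β => h p.2 β)
      (c := fun p => p.2) (w := fun p => x - p.1)
      (hh.comp (f := fun r : (ℝ × ℝ) × ℝ => (r.1.2, r.2)) (by fun_prop))
      (by fun_prop) (by fun_prop)
    exact LocallyIntegrable.mul_continuous h4 h3
  rw [triangle_swap hF x, ← intervalIntegral.integral_const_mul]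
  refine intervalIntegral.integral_congr fun α _ => ?_
  -- for fixed `α`, the reflection `s ↦ x - s` produces a second triangle
  have h5 := intervalIntegral.integral_comp_sub_left (a := 0) (b := x - α) (fun s =>
    v (2 * s - x) * ∫ β in (0 : ℝ)..(x - s), q (α + ε * β) * h α β) x
  rw [show x - (x - α) = α by ring, sub_zero] at h5
  rw [← h5]
  have h6 : ∀ s : ℝ, v (2 * (x - s) - x) * (∫ β in (0 : ℝ)..(x - (x - s)), q (α + ε * β) * h α β) =
      ∫ β in (0 : ℝ)..s, v (x - 2 * s) * (q (α + ε * β) * h α β) := by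
    intro s
    rw [intervalIntegral.integral_const_mul, sub_sub_cancel,
      show 2 * (x - s) - x = x - 2 * s by ring]
  simp only [h6]
  have hG : LocallyIntegrable (Function.uncurry fun s β =>
      v (x - 2 * s) * (q (α + ε * β) * h α β)) := by
    have h7 := locallyIntegrable_comp_affine hv (-2) (by norm_num) x
    have h8 : LocallyIntegrable (fun s => v (x - 2 * s)) :=
      h7.congr (Filter.Eventually.of_forall fun s => by simp only; congr 1; ring)
    exact locallyIntegrable_mul_prod h8 (locallyIntegrable_inner hq hε hh α)
  rw [triangle_swap hG, ← intervalIntegral.integral_const_mul]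
  refine intervalIntegral.integral_congr fun β _ => ?_
  rw [intervalIntegral.integral_mul_const, intervalIntegral.integral_comp_sub_mul v two_ne_zero,
    show x - 2 * (x - α) = 2 * α - x by ring]
  simp
  ring

/-- Twofold integration of the integral of `v''` over the interval with centre `c` and radius
`ξ - y`: the outcome is the integral of `v` over the interval of radius `x - y`, minus its value by
the midpoint rule. -/
lemma integral_second_difference {v v₁ : ℝ → ℂ} (hv : ∀ x, HasDerivAt v (v₁ x) x)
    (hv₁ : Continuous v₁) (c y x : ℝ) :
    ∫ ξ in y..x, ((x - ξ : ℝ) : ℂ) * (v₁ (c + (ξ - y)) - v₁ (c - (ξ - y))) =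
      (∫ t in (c - (x - y))..(c + (x - y)), v t) - 2 * ((x - y : ℝ) : ℂ) * v c := by
  have hvc : Continuous v := continuous_iff_continuousAt.2 fun x => (hv x).continuousAt
  set V : ℝ → ℂ := fun x => ∫ t in (0 : ℝ)..x, v t with hV
  have hV' : ∀ x, HasDerivAt V (v x) x := fun x =>
    (hvc.integral_hasStrictDerivAt 0 x).hasDerivAt
  have h1 : ∀ ξ, HasDerivAt (fun ξ : ℝ => c + (ξ - y)) 1 ξ := fun ξ =>
    ((hasDerivAt_id ξ).sub_const y).const_add c
  have h2 : ∀ ξ, HasDerivAt (fun ξ : ℝ => c - (ξ - y)) (-1) ξ := fun ξ =>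
    ((hasDerivAt_id ξ).sub_const y).const_sub c
  have h3 : ∀ ξ, HasDerivAt (fun ξ : ℝ => ((x - ξ : ℝ) : ℂ)) (-1) ξ := fun ξ => by
    simpa using ((hasDerivAt_id ξ).const_sub x).ofReal_comp
  have hD : ∀ ξ, HasDerivAt (fun ξ : ℝ => ((x - ξ : ℝ) : ℂ) * (v (c + (ξ - y)) + v (c - (ξ - y))) +
      (V (c + (ξ - y)) - V (c - (ξ - y))))
      (((x - ξ : ℝ) : ℂ) * (v₁ (c + (ξ - y)) - v₁ (c - (ξ - y)))) ξ := by
    intro ξ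
    have ha := (hv (c + (ξ - y))).scomp ξ (h1 ξ)
    have hb := (hv (c - (ξ - y))).scomp ξ (h2 ξ)
    have hc := (hV' (c + (ξ - y))).scomp ξ (h1 ξ)
    have hd := (hV' (c - (ξ - y))).scomp ξ (h2 ξ)
    refine (((h3 ξ).mul (ha.add hb)).add (hc.sub hd)).congr_deriv ?_
    simp
    ring
  rw [intervalIntegral.integral_eq_sub_of_hasDerivAt (fun ξ _ => hD ξ)
    (Continuous.intervalIntegrable (by fun_prop) _ _)]
  have h4 : ∫ t in (c - (x - y))..(c + (x - y)), v t = V (c + (x - y)) - V (c - (x - y)) :=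
    (intervalIntegral.integral_interval_sub_left (hvc.intervalIntegrable _ _)
      (hvc.intervalIntegrable _ _)).symm
  rw [h4]
  simp
  ring

/-- `v` is twice differentiable with first derivative `v₁` and locally integrable second
derivative `f`, the latter in the sense that `v₁` is a primitive of `f`. -/
structure IsTwicePrimitive (v v₁ f : ℝ → ℂ) : Prop where
  hasDerivAt : ∀ x, HasDerivAt v (v₁ x) x
  continuous : Continuous v₁
  locallyIntegrable : LocallyIntegrable f
  integral_eq : ∀ c d, ∫ t in c..d, f t = v₁ d - v₁ c

variable {v v₁ f : ℝ → ℂ} (hv : IsTwicePrimitive v v₁ f)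

include hv in
lemma IsTwicePrimitive.continuous_zero : Continuous v :=
  continuous_iff_continuousAt.2 fun x => (hv.hasDerivAt x).continuousAt

include hv in
/-- Twice integrating the image of `f = v''` under the potential part of the kernel gives the image
of `v`, up to the term `p v`. -/
lemma weighted_potential_part {p : ℝ → ℂ} (hp : LocallyIntegrable p) (x : ℝ) :
    ∫ ξ in (0 : ℝ)..x, ((x - ξ : ℝ) : ℂ) *
        (∫ α in (0 : ℝ)..ξ, (1 / 2) * p α * ∫ t in (2 * α - ξ)..ξ, f t) =
      (∫ α in (0 : ℝ)..x, (1 / 2) * p α * ∫ t in (2 * α - x)..x, v t) -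
        ∫ α in (0 : ℝ)..x, ((x - α : ℝ) : ℂ) * (p α * v α) := by
  have hv₁ := hv.continuous
  have hvc := hv.continuous_zero
  have hL : ∀ ξ : ℝ, ((x - ξ : ℝ) : ℂ) *
        (∫ α in (0 : ℝ)..ξ, (1 / 2) * p α * ∫ t in (2 * α - ξ)..ξ, f t) =
      ∫ α in (0 : ℝ)..ξ, ((x - ξ : ℝ) : ℂ) * (1 / 2 * p α * (v₁ ξ - v₁ (2 * α - ξ))) := fun ξ => by
    simp only [hv.integral_eq, intervalIntegral.integral_const_mul]
  simp only [hL]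
  have hF : LocallyIntegrable (Function.uncurry fun ξ α : ℝ =>
      ((x - ξ : ℝ) : ℂ) * (1 / 2 * p α * (v₁ ξ - v₁ (2 * α - ξ)))) := by
    have h1 := LocallyIntegrable.continuous_mul
      (g := fun r : ℝ × ℝ => ((x - r.1 : ℝ) : ℂ) * (1 / 2 * (v₁ r.1 - v₁ (2 * r.2 - r.1))))
      (by fun_prop) (locallyIntegrable_snd hp)
    refine h1.congr (Filter.Eventually.of_forall fun r => ?_)
    simp only [Function.uncurry]
    ring
  rw [triangle_swap hF]
  have hV : Continuous fun α : ℝ => ∫ t in (2 * α - x)..x, v t := by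
    have := continuous_weighted_integral (X := ℝ) hvc.locallyIntegrable (ψ := fun _ _ => 1)
      (l := fun α => 2 * α - x) (r := fun _ => x) (by fun_prop) (by fun_prop) (by fun_prop)
    simpa using this
  rw [← intervalIntegral.integral_sub
    (intervalIntegrable_of_locallyIntegrable
      (LocallyIntegrable.mul_continuous hV
        (LocallyIntegrable.continuous_mul continuous_const hp)) 0 x)
    (intervalIntegrable_of_locallyIntegrable
      (LocallyIntegrable.continuous_mul (by fun_prop)
        (LocallyIntegrable.mul_continuous hvc hp)) 0 x)]
  refine intervalIntegral.integral_congr fun α _ => ?_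
  have h1 := integral_second_difference hv.hasDerivAt hv₁ α α x
  rw [show α - (x - α) = 2 * α - x by ring, show α + (x - α) = x by ring] at h1
  have h2 : ∀ ξ : ℝ, ((x - ξ : ℝ) : ℂ) * (1 / 2 * p α * (v₁ ξ - v₁ (2 * α - ξ))) =
      1 / 2 * p α * (((x - ξ : ℝ) : ℂ) * (v₁ (α + (ξ - α)) - v₁ (α - (ξ - α)))) := by
    intro ξ
    rw [show α + (ξ - α) = ξ by ring, show α - (ξ - α) = 2 * α - ξ by ring]
    ring
  simp only [h2]
  rw [intervalIntegral.integral_const_mul, h1]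
  simp
  ring

include hq hε hh hv in
/-- Twice integrating the image of `f = v''` under the double integral part of the kernel gives the
image of `v`, up to an integral of `v` against `q h` itself. -/
lemma weighted_double_part (x : ℝ) :
    ∫ ξ in (0 : ℝ)..x, ((x - ξ : ℝ) : ℂ) *
        (∫ α in (0 : ℝ)..ξ, ∫ β in (0 : ℝ)..(ξ - α), q (α + ε * β) * h α β *
          ∫ t in (2 * α - ξ)..(ξ - 2 * β), f t) =
      (∫ α in (0 : ℝ)..x, ∫ β in (0 : ℝ)..(x - α), q (α + ε * β) * h α β *
          ∫ t in (2 * α - x)..(x - 2 * β), v t) -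
        ∫ α in (0 : ℝ)..x, ∫ β in (0 : ℝ)..(x - α), q (α + ε * β) * h α β *
          (2 * ((x - α - β : ℝ) : ℂ) * v (α - β)) := by
  have hv₁ := hv.continuous
  have hvc := hv.continuous_zero
  have hL : ∀ ξ : ℝ, ((x - ξ : ℝ) : ℂ) *
        (∫ α in (0 : ℝ)..ξ, ∫ β in (0 : ℝ)..(ξ - α), q (α + ε * β) * h α β *
          ∫ t in (2 * α - ξ)..(ξ - 2 * β), f t) =
      ∫ α in (0 : ℝ)..ξ, ∫ β in (0 : ℝ)..(ξ - α), ((x - ξ : ℝ) : ℂ) *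
        (q (α + ε * β) * h α β * (v₁ (ξ - 2 * β) - v₁ (2 * α - ξ))) := fun ξ => by
    simp only [hv.integral_eq, intervalIntegral.integral_const_mul]
  simp only [hL]
  have hM : Continuous (Function.uncurry fun ξ α : ℝ => ∫ β in (0 : ℝ)..(ξ - α),
      ((x - ξ : ℝ) : ℂ) * (q (α + ε * β) * h α β * (v₁ (ξ - 2 * β) - v₁ (2 * α - ξ)))) := by
    have h1 := continuous_integral_affine_weight (X := ℝ × ℝ) hq hε
      (ψ := fun p β => ((x - p.1 : ℝ) : ℂ) * (h p.2 β * (v₁ (p.1 - 2 * β) - v₁ (2 * p.2 - p.1))))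
      (c := fun p => p.2) (w := fun p => p.1 - p.2)
      (by
        have h2 : Continuous fun r : (ℝ × ℝ) × ℝ => h r.1.2 r.2 :=
          hh.comp (f := fun r : (ℝ × ℝ) × ℝ => (r.1.2, r.2)) (by fun_prop)
        fun_prop)
      (by fun_prop) (by fun_prop)
    refine h1.congr fun r => ?_
    simp only [Function.uncurry]
    refine intervalIntegral.integral_congr fun β _ => ?_
    ring
  rw [triangle_swap hM.locallyIntegrable]
  have hV : Continuous (fun r : (ℝ × ℝ) => ∫ t in (2 * r.1 - x)..(x - 2 * r.2), v t) := by
    have := continuous_weighted_integral (X := ℝ × ℝ) hvc.locallyIntegrable (ψ := fun _ _ => 1)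
      (l := fun r => 2 * r.1 - x) (r := fun r => x - 2 * r.2) (by fun_prop) (by fun_prop)
      (by fun_prop)
    simpa using this
  have hhu : ∀ g : ℝ × ℝ → ℂ, Continuous g → Continuous (fun α : ℝ =>
      ∫ β in (0 : ℝ)..(x - α), q (α + ε * β) * h α β * g (α, β)) := by
    intro g hg
    have h1 := continuous_integral_affine_weight (X := ℝ) hq hε
      (ψ := fun α β => h α β * g (α, β)) (c := fun α => α) (w := fun α => x - α)
      (hh.mul hg) (by fun_prop) (by fun_prop)
    simpa only [mul_assoc] using h1
  have hi : ∀ (g : ℝ × ℝ → ℂ), Continuous g → ∀ α b : ℝ, IntervalIntegrable (fun β =>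
      q (α + ε * β) * h α β * g (α, β)) volume 0 b := fun g hg α b =>
    intervalIntegrable_of_locallyIntegrable (LocallyIntegrable.mul_continuous
      (hg.comp (Continuous.prodMk_right α)) (locallyIntegrable_inner hq hε hh α)) _ _
  have hB : Continuous fun r : ℝ × ℝ => 2 * ((x - r.1 - r.2 : ℝ) : ℂ) * v (r.1 - r.2) := by
    fun_prop
  rw [← intervalIntegral.integral_sub ((hhu _ hV).intervalIntegrable _ _)
    ((hhu _ hB).intervalIntegrable _ _)]
  refine intervalIntegral.integral_congr fun α _ => ?_
  simp only
  rw [← intervalIntegral.integral_sub (hi _ hV _ _) (hi _ hB _ _)]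
  have h5 := intervalIntegral.integral_comp_add_left (a := 0) (b := x - α) (fun ξ =>
    ∫ β in (0 : ℝ)..(ξ - α), ((x - ξ : ℝ) : ℂ) *
      (q (α + ε * β) * h α β * (v₁ (ξ - 2 * β) - v₁ (2 * α - ξ)))) α
  rw [add_zero, show α + (x - α) = x by ring] at h5
  rw [← h5]
  simp only [add_sub_cancel_left]
  have hG : LocallyIntegrable (Function.uncurry fun η β : ℝ => ((x - (α + η) : ℝ) : ℂ) *
      (q (α + ε * β) * h α β * (v₁ (α + η - 2 * β) - v₁ (2 * α - (α + η))))) := by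
    have h1 := LocallyIntegrable.continuous_mul
      (g := fun r : ℝ × ℝ => ((x - (α + r.1) : ℝ) : ℂ) *
        (v₁ (α + r.1 - 2 * r.2) - v₁ (2 * α - (α + r.1))))
      (by fun_prop) (locallyIntegrable_snd (locallyIntegrable_inner hq hε hh α))
    refine h1.congr (Filter.Eventually.of_forall fun r => ?_)
    simp only [Function.uncurry]
    ring
  rw [triangle_swap hG]
  refine intervalIntegral.integral_congr fun β _ => ?_
  have h1 := integral_second_difference hv.hasDerivAt hv₁ (α - β) β (x - α)
  rw [show α - β - (x - α - β) = 2 * α - x by ring,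
    show α - β + (x - α - β) = x - 2 * β by ring] at h1
  have h2 : ∀ η : ℝ, ((x - (α + η) : ℝ) : ℂ) *
      (q (α + ε * β) * h α β * (v₁ (α + η - 2 * β) - v₁ (2 * α - (α + η)))) =
      q (α + ε * β) * h α β * (((x - α - η : ℝ) : ℂ) *
        (v₁ (α - β + (η - β)) - v₁ (α - β - (η - β)))) := by
    intro η
    rw [show α - β + (η - β) = α + η - 2 * β by ring,
      show α - β - (η - β) = 2 * α - (α + η) by ring, show x - (α + η) = x - α - η by ring]
    ring
  simp only [h2]
  rw [intervalIntegral.integral_const_mul, h1, ← mul_sub]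

include hq hε hh in
/-- Passage from the characteristic coordinates `α, β` to `y = α + β`, `ρ = α - β`. -/
lemma integral_triangle_subst (hvc : Continuous v) (x : ℝ) :
    ∫ α in (0 : ℝ)..x, ∫ β in (0 : ℝ)..(x - α), q (α + ε * β) * h α β *
          (2 * ((x - α - β : ℝ) : ℂ) * v (α - β)) =
      ∫ y in (0 : ℝ)..x, ((x - y : ℝ) : ℂ) * ∫ ρ in (-y)..y,
        q ((y + ρ) / 2 + ε * ((y - ρ) / 2)) * h ((y + ρ) / 2) ((y - ρ) / 2) * v ρ := by
  have h1 : ∀ y : ℝ, ((x - y : ℝ) : ℂ) * (∫ ρ in (-y)..y,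
        q ((y + ρ) / 2 + ε * ((y - ρ) / 2)) * h ((y + ρ) / 2) ((y - ρ) / 2) * v ρ) =
      ∫ α in (0 : ℝ)..y, q (ε * y + (1 - ε) * α) *
        (h α (y - α) * (2 * ((x - y : ℝ) : ℂ) * v (2 * α - y))) := by
    intro y
    rw [integral_symm_interval_subst, ← intervalIntegral.integral_const_mul,
      ← intervalIntegral.integral_const_mul]
    refine intervalIntegral.integral_congr fun α _ => ?_
    rw [show (y + (2 * α - y)) / 2 = α by ring, show (y - (2 * α - y)) / 2 = y - α by ring,
      show α + ε * (y - α) = ε * y + (1 - ε) * α by ring]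
    ring
  simp only [h1]
  have hF : LocallyIntegrable (Function.uncurry fun y α : ℝ => q (ε * y + (1 - ε) * α) *
        (h α (y - α) * (2 * ((x - y : ℝ) : ℂ) * v (2 * α - y)))) := by
    have h2 := locallyIntegrable_comp_plane hq ε (1 - ε) (Or.inl hε)
    have h3 : Continuous fun r : ℝ × ℝ => h r.2 (r.1 - r.2) :=
      hh.comp (f := fun r : ℝ × ℝ => (r.2, r.1 - r.2)) (by fun_prop)
    exact LocallyIntegrable.mul_continuous (g := fun r : ℝ × ℝ =>
      h r.2 (r.1 - r.2) * (2 * ((x - r.1 : ℝ) : ℂ) * v (2 * r.2 - r.1))) (by fun_prop) h2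
  rw [triangle_swap hF]
  refine intervalIntegral.integral_congr fun α _ => ?_
  have h5 := intervalIntegral.integral_comp_add_left (a := 0) (b := x - α) (fun y =>
    q (ε * y + (1 - ε) * α) * (h α (y - α) * (2 * ((x - y : ℝ) : ℂ) * v (2 * α - y)))) α
  rw [add_zero, show α + (x - α) = x by ring] at h5
  rw [← h5]
  refine intervalIntegral.integral_congr fun β _ => ?_
  rw [show ε * (α + β) + (1 - ε) * α = α + ε * β by ring, add_sub_cancel_left,
    show x - (α + β) = x - α - β by ring, show 2 * α - (α + β) = α - β by ring, mul_assoc]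

include hq hε hh hv in
/-- For a kernel `G = ½ ∫₀ᵘ p + ∫₀ᵘ ∫₀ʷ q(α + ε β) h(α, β)` in characteristic coordinates, the
Volterra operator with kernel `G((x + t)/2, (x - t)/2)` intertwines `v'' = f` and `v` up to terms
containing `p` and `q`. -/
theorem volterra_intertwining {p : ℝ → ℂ} (hp : LocallyIntegrable p) {G : ℝ → ℝ → ℂ}
    (hG : ∀ u w, G u w = (1 / 2) * (∫ s in (0 : ℝ)..u, p s) +
      ∫ α in (0 : ℝ)..u, ∫ β in (0 : ℝ)..w, q (α + ε * β) * h α β) (x : ℝ) :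
    ∫ t in (-x)..x, kernel G x t * v t =
      (∫ ξ in (0 : ℝ)..x, ((x - ξ : ℝ) : ℂ) * ∫ t in (-ξ)..ξ, kernel G ξ t * f t) +
      (∫ ξ in (0 : ℝ)..x, ((x - ξ : ℝ) : ℂ) * (p ξ * v ξ)) +
      ∫ ξ in (0 : ℝ)..x, ((x - ξ : ℝ) : ℂ) * ∫ ρ in (-ξ)..ξ,
        q ((ξ + ρ) / 2 + ε * ((ξ - ρ) / 2)) * h ((ξ + ρ) / 2) ((ξ - ρ) / 2) * v ρ := by
  have hvc := hv.continuous_zero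
  have hv₁ := hv.continuous
  have hPc : Continuous fun u : ℝ => ∫ s in (0 : ℝ)..u, p s :=
    intervalIntegral.continuous_primitive (intervalIntegrable_of_locallyIntegrable hp) 0
  have hDc : Continuous fun r : ℝ × ℝ =>
      ∫ α in (0 : ℝ)..r.1, ∫ β in (0 : ℝ)..r.2, q (α + ε * β) * h α β := by
    have h1 : Continuous (Function.uncurry fun (p : ℝ × ℝ) (α : ℝ) =>
        ∫ β in (0 : ℝ)..p.2, q (α + ε * β) * h α β) := by
      have := continuous_integral_affine_weight (X := (ℝ × ℝ) × ℝ) hq hε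
        (ψ := fun p β => h p.2 β) (c := fun p => p.2) (w := fun p => p.1.2)
        (hh.comp (f := fun r : ((ℝ × ℝ) × ℝ) × ℝ => (r.1.2, r.2)) (by fun_prop))
        (by fun_prop) (by fun_prop)
      simpa [Function.uncurry_def] using this
    exact intervalIntegral.continuous_parametric_intervalIntegral_of_continuous h1 continuous_fst
  have split : ∀ w : ℝ → ℂ, LocallyIntegrable w → ∀ x : ℝ,
      ∫ t in (-x)..x, kernel G x t * w t =
        (∫ α in (0 : ℝ)..x, (1 / 2) * p α * ∫ t in (2 * α - x)..x, w t) +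
        ∫ α in (0 : ℝ)..x, ∫ β in (0 : ℝ)..(x - α), q (α + ε * β) * h α β *
          ∫ t in (2 * α - x)..(x - 2 * β), w t := by
    intro w hw x
    rw [← integral_kernel_potential hp hw, ← integral_kernel_double hq hε hh hw,
      ← intervalIntegral.integral_add]
    · refine intervalIntegral.integral_congr fun t _ => ?_
      simp only [kernel, hG, add_mul]
    · exact intervalIntegrable_of_locallyIntegrable (LocallyIntegrable.continuous_mul
        (continuous_const.mul (hPc.comp (f := fun t => (x + t) / 2) (by fun_prop))) hw) _ _
    · exact intervalIntegrable_of_locallyIntegrable (LocallyIntegrable.continuous_mul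
        (hDc.comp (f := fun t => ((x + t) / 2, (x - t) / 2)) (by fun_prop)) hw) _ _
  have hA : Continuous fun ξ : ℝ =>
      ∫ α in (0 : ℝ)..ξ, (1 / 2) * p α * ∫ t in (2 * α - ξ)..ξ, f t := by
    have h1 := continuous_weighted_integral (X := ℝ) hp
      (ψ := fun ξ α => 1 / 2 * (v₁ ξ - v₁ (2 * α - ξ))) (l := fun _ => 0) (r := fun ξ => ξ)
      (by fun_prop) (by fun_prop) (by fun_prop)
    refine h1.congr fun ξ => intervalIntegral.integral_congr fun α _ => ?_
    simp only [hv.integral_eq]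
    ring
  have hB : Continuous fun ξ : ℝ => ∫ α in (0 : ℝ)..ξ, ∫ β in (0 : ℝ)..(ξ - α),
      q (α + ε * β) * h α β * ∫ t in (2 * α - ξ)..(ξ - 2 * β), f t := by
    have h1 : Continuous (Function.uncurry fun ξ α : ℝ => ∫ β in (0 : ℝ)..(ξ - α),
        q (α + ε * β) * h α β * ∫ t in (2 * α - ξ)..(ξ - 2 * β), f t) := by
      have h2 := continuous_integral_affine_weight (X := ℝ × ℝ) hq hε
        (ψ := fun p β => h p.2 β * (v₁ (p.1 - 2 * β) - v₁ (2 * p.2 - p.1)))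
        (c := fun p => p.2) (w := fun p => p.1 - p.2)
        (by
          have h2 : Continuous fun r : (ℝ × ℝ) × ℝ => h r.1.2 r.2 :=
            hh.comp (f := fun r : (ℝ × ℝ) × ℝ => (r.1.2, r.2)) (by fun_prop)
          fun_prop)
        (by fun_prop) (by fun_prop)
      refine h2.congr fun r => intervalIntegral.integral_congr fun β _ => ?_
      simp only [hv.integral_eq, mul_assoc]
    exact intervalIntegral.continuous_parametric_intervalIntegral_of_continuous h1 continuous_id
  have h1 : ∫ ξ in (0 : ℝ)..x, ((x - ξ : ℝ) : ℂ) * ∫ t in (-ξ)..ξ, kernel G ξ t * f t =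
      (∫ ξ in (0 : ℝ)..x, ((x - ξ : ℝ) : ℂ) *
        (∫ α in (0 : ℝ)..ξ, (1 / 2) * p α * ∫ t in (2 * α - ξ)..ξ, f t)) +
      ∫ ξ in (0 : ℝ)..x, ((x - ξ : ℝ) : ℂ) *
        (∫ α in (0 : ℝ)..ξ, ∫ β in (0 : ℝ)..(ξ - α), q (α + ε * β) * h α β *
          ∫ t in (2 * α - ξ)..(ξ - 2 * β), f t) := by
    rw [← intervalIntegral.integral_add (Continuous.intervalIntegrable (by fun_prop) _ _)
      (Continuous.intervalIntegrable (by fun_prop) _ _)]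
    refine intervalIntegral.integral_congr fun ξ _ => ?_
    simp only [split f hv.locallyIntegrable, mul_add]
  rw [h1, weighted_potential_part hv hp, weighted_double_part hq hε hh hv,
    integral_triangle_subst hq hε hh hvc, split v hvc.locallyIntegrable]
  ring

end Generic

/-! ### The transmutation operator and its inverse on functions -/

/-- The function `x ↦ u(x) + ∫_{-x}^x K(x, t) u(t) dt`. -/
noncomputable def transmute (H : ℝ → ℝ → ℂ) (u : ℝ → ℂ) (x : ℝ) : ℂ :=
  u x + ∫ t in (-x)..x, kernel H x t * u t

/-- The function `x ↦ u(x) - ∫_{-x}^x K(t, x) u(t) dt`. -/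
noncomputable def invTransmute (H : ℝ → ℝ → ℂ) (u : ℝ → ℂ) (x : ℝ) : ℂ :=
  u x - ∫ t in (-x)..x, kernel H t x * u t

lemma hasDerivAt_ofReal (x : ℝ) : HasDerivAt (fun x : ℝ => (x : ℂ)) 1 x :=
  Complex.ofRealCLM.hasDerivAt

lemma isTwicePrimitive_of_integral {g : ℝ → ℂ} (hg : LocallyIntegrable g) (c₀ c₁ : ℂ) :
    IsTwicePrimitive (fun x => c₀ + c₁ * x + ∫ ξ in (0 : ℝ)..x, ((x - ξ : ℝ) : ℂ) * g ξ)
      (fun x => c₁ + ∫ ξ in (0 : ℝ)..x, g ξ) g := by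
  have hi := intervalIntegrable_of_locallyIntegrable hg
  have hc : Continuous fun x : ℝ => ∫ ξ in (0 : ℝ)..x, g ξ :=
    intervalIntegral.continuous_primitive hi 0
  refine ⟨fun x => ?_, by fun_prop, hg, fun c d => ?_⟩
  · have h1 : ∀ x : ℝ, ∫ ξ in (0 : ℝ)..x, ((x - ξ : ℝ) : ℂ) * g ξ =
        ∫ s in (0 : ℝ)..x, ∫ ξ in (0 : ℝ)..s, g ξ := by
      intro x
      rw [triangle_swap (F := fun _ ξ => g ξ) (locallyIntegrable_snd hg)]
      refine intervalIntegral.integral_congr fun ξ _ => ?_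
      simp
    simp only [h1]
    refine ((((hasDerivAt_ofReal x).const_mul c₁).const_add c₀).add
      (hc.integral_hasStrictDerivAt 0 x).hasDerivAt).congr_deriv ?_
    simp
  · rw [← intervalIntegral.integral_interval_sub_left (hi 0 d) (hi 0 c)]
    ring

/-- Taylor's formula of order one with integral remainder. -/
lemma IsTwicePrimitive.eq_integral {v v₁ f : ℝ → ℂ} (hv : IsTwicePrimitive v v₁ f) (x : ℝ) :
    v x = v 0 + v₁ 0 * x + ∫ ξ in (0 : ℝ)..x, ((x - ξ : ℝ) : ℂ) * f ξ := by
  have h1 := isTwicePrimitive_of_integral hv.locallyIntegrable (v 0) (v₁ 0)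
  have h2 : ∀ x : ℝ, v₁ 0 + ∫ ξ in (0 : ℝ)..x, f ξ = v₁ x := fun x => by
    rw [hv.integral_eq]; ring
  have h3 : ∀ x : ℝ, HasDerivAt (fun x => v x - (v 0 + v₁ 0 * x +
      ∫ ξ in (0 : ℝ)..x, ((x - ξ : ℝ) : ℂ) * f ξ)) 0 x := fun x => by
    have := (hv.hasDerivAt x).sub (h1.hasDerivAt x)
    rwa [h2, sub_self] at this
  have h4 := is_const_of_deriv_eq_zero (fun x => (h3 x).differentiableAt)
    (fun x => (h3 x).deriv) x 0
  simp only [intervalIntegral.integral_same] at h4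
  simpa [sub_eq_zero] using h4

lemma IsTwicePrimitive.congr {v w v₁ f g : ℝ → ℂ} (hv : IsTwicePrimitive v v₁ f)
    (hw : ∀ x, w x = v x) (hg : ∀ x, g x = f x) : IsTwicePrimitive w v₁ g := by
  rw [funext hw, funext hg]; exact hv

section Operators

variable {H : ℝ → ℝ → ℂ} (hH : Continuous (Function.uncurry H))

include hH in
lemma continuous_kernel : Continuous (Function.uncurry (kernel H)) :=
  hH.comp (f := fun p : ℝ × ℝ => ((p.1 + p.2) / 2, (p.1 - p.2) / 2)) (by fun_prop)

include hH in
lemma continuous_kernel_integral {u : ℝ → ℂ} (hu : LocallyIntegrable u) :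
    Continuous fun x : ℝ => ∫ t in (-x)..x, kernel H x t * u t := by
  have := continuous_weighted_integral (X := ℝ) hu (continuous_kernel hH) continuous_neg
    (r := fun x => x) continuous_id
  simpa only [mul_comm] using this

include hH in
lemma continuous_kernel_integral' {u : ℝ → ℂ} (hu : LocallyIntegrable u) :
    Continuous fun x : ℝ => ∫ t in (-x)..x, kernel H t x * u t := by
  have := continuous_weighted_integral (X := ℝ) hu (ψ := fun x t => kernel H t x)
    ((continuous_kernel hH).comp continuous_swap) continuous_neg
    (r := fun x => x) continuous_id
  simpa only [mul_comm] using this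

include hH in
lemma locallyIntegrable_transmute {u : ℝ → ℂ} (hu : LocallyIntegrable u) :
    LocallyIntegrable (transmute H u) :=
  hu.add (continuous_kernel_integral hH hu).locallyIntegrable

include hH in
lemma locallyIntegrable_invTransmute {u : ℝ → ℂ} (hu : LocallyIntegrable u) :
    LocallyIntegrable (invTransmute H u) :=
  hu.sub (continuous_kernel_integral' hH hu).locallyIntegrable

include hH in
lemma invTransmute_sub {u w : ℝ → ℂ} (hu : LocallyIntegrable u) (hw : LocallyIntegrable w)
    (x : ℝ) : invTransmute H (u - w) x = invTransmute H u x - invTransmute H w x := by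
  have hi : ∀ u : ℝ → ℂ, LocallyIntegrable u →
      IntervalIntegrable (fun t => kernel H t x * u t) volume (-x) x := fun u hu =>
    intervalIntegrable_of_locallyIntegrable (LocallyIntegrable.continuous_mul
      ((continuous_kernel hH).comp (Continuous.prodMk_left x)) hu) _ _
  simp only [invTransmute, Pi.sub_apply, mul_sub]
  rw [intervalIntegral.integral_sub (hi u hu) (hi w hw)]
  ring

end Operators

lemma transmute_const_mul (H : ℝ → ℝ → ℂ) (c : ℂ) (u : ℝ → ℂ) (x : ℝ) :
    transmute H (fun t => c * u t) x = c * transmute H u x := by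
  simp only [transmute, mul_add, ← intervalIntegral.integral_const_mul]
  congr 1
  exact intervalIntegral.integral_congr fun t _ => by ring

lemma invTransmute_const_mul (H : ℝ → ℝ → ℂ) (c : ℂ) (u : ℝ → ℂ) (x : ℝ) :
    invTransmute H (fun t => c * u t) x = c * invTransmute H u x := by
  simp only [invTransmute, mul_sub, ← intervalIntegral.integral_const_mul]
  congr 1
  exact intervalIntegral.integral_congr fun t _ => by ring

section Solution

variable {q : ℝ → ℂ} (hq : LocallyIntegrable q) {H : ℝ → ℝ → ℂ} (hH : IsGlobalSolution q H)

include hq hH in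
/-- The transmutation property `(T v)'' - q T v = T v''`, together with the conservation of the
initial values at `0`. -/
theorem isTwicePrimitive_transmute {v v₁ f : ℝ → ℂ} (hv : IsTwicePrimitive v v₁ f) :
    ∃ w₁ : ℝ → ℂ, IsTwicePrimitive (transmute H v) w₁
      (fun x => transmute H f x + q x * transmute H v x) ∧ w₁ 0 = v₁ 0 := by
  have hvc := hv.continuous_zero
  have hf := hv.locallyIntegrable
  have hK := continuous_kernel_integral hH.continuous hvc.locallyIntegrable
  have hKf := continuous_kernel_integral hH.continuous hf
  have hTv : Continuous (transmute H v) := hvc.add hK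
  have hg : LocallyIntegrable
      (fun x => transmute H f x + q x * transmute H v x) :=
    (locallyIntegrable_transmute hH.continuous hf).add (LocallyIntegrable.mul_continuous hTv hq)
  refine ⟨_, (isTwicePrimitive_of_integral hg (v 0) (v₁ 0)).congr (fun x => ?_) (fun _ => rfl),
    by simp⟩
  have h1 := volterra_intertwining hq one_ne_zero hH.continuous hv hq (G := H)
    (fun u w => by simpa using hH.eq u w) x
  have h2 : ∀ ξ : ℝ, (∫ ρ in (-ξ)..ξ, q ((ξ + ρ) / 2 + 1 * ((ξ - ρ) / 2)) *
      H ((ξ + ρ) / 2) ((ξ - ρ) / 2) * v ρ) = q ξ * ∫ ρ in (-ξ)..ξ, kernel H ξ ρ * v ρ := by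
    intro ξ
    rw [← intervalIntegral.integral_const_mul]
    refine intervalIntegral.integral_congr fun ρ _ => ?_
    simp only [kernel]
    rw [show (ξ + ρ) / 2 + 1 * ((ξ - ρ) / 2) = ξ by ring, mul_assoc]
  simp only [h2] at h1
  have hi : ∀ g : ℝ → ℂ, LocallyIntegrable g →
      IntervalIntegrable (fun ξ : ℝ => ((x - ξ : ℝ) : ℂ) * g ξ) volume 0 x := fun g hg =>
    intervalIntegrable_of_locallyIntegrable (LocallyIntegrable.continuous_mul (by fun_prop) hg) _ _
  have h3 : (fun ξ : ℝ => ((x - ξ : ℝ) : ℂ) * (transmute H f ξ + q ξ * transmute H v ξ)) =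
      fun ξ : ℝ => ((x - ξ : ℝ) : ℂ) * f ξ +
        ((((x - ξ : ℝ) : ℂ) * ∫ t in (-ξ)..ξ, kernel H ξ t * f t) +
        ((x - ξ : ℝ) : ℂ) * (q ξ * v ξ) +
        ((x - ξ : ℝ) : ℂ) * (q ξ * ∫ ρ in (-ξ)..ξ, kernel H ξ ρ * v ρ)) := by
    ext ξ
    simp only [transmute]
    ring
  have ha := hi _ hf
  have hb := hi _ hKf.locallyIntegrable
  have hc := hi _ (LocallyIntegrable.mul_continuous hvc hq)
  have hd := hi _ (LocallyIntegrable.mul_continuous hK hq)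
  rw [h3, intervalIntegral.integral_add ha ((hb.add hc).add hd),
    intervalIntegral.integral_add (hb.add hc) hd, intervalIntegral.integral_add hb hc, ← h1,
    ← add_assoc, ← hv.eq_integral x]
  rfl

include hq hH in
/-- The inverse transmutation property `(S v)'' = S (v'' - q v)`, together with the conservation of
the initial values at `0`. The kernel `-K(t, x)` of `S` has the form required by
`volterra_intertwining`, with `ε = -1` and `q` replaced by `-q` on the diagonal. -/
theorem isTwicePrimitive_invTransmute {v v₁ f : ℝ → ℂ} (hv : IsTwicePrimitive v v₁ f) :
    ∃ w₁ : ℝ → ℂ, IsTwicePrimitive (invTransmute H v) w₁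
      (invTransmute H (fun x => f x - q x * v x)) ∧ w₁ 0 = v₁ 0 := by
  have hvc := hv.continuous_zero
  have hf := hv.locallyIntegrable
  have hqv : LocallyIntegrable fun x => q x * v x := LocallyIntegrable.mul_continuous hvc hq
  have hKq := continuous_kernel_integral' hH.continuous hqv
  have hKf := continuous_kernel_integral' hH.continuous hf
  have hg : LocallyIntegrable (invTransmute H (fun x => f x - q x * v x)) :=
    locallyIntegrable_invTransmute hH.continuous (hf.sub hqv)
  refine ⟨_, (isTwicePrimitive_of_integral hg (v 0) (v₁ 0)).congr (fun x => ?_) (fun _ => rfl),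
    by simp⟩
  have hG : ∀ u w : ℝ, -H u (-w) = (1 / 2) * (∫ s in (0 : ℝ)..u, -q s) +
      ∫ α in (0 : ℝ)..u, ∫ β in (0 : ℝ)..w, q (α + (-1) * β) * H α (-β) := by
    intro u w
    have h1 : ∀ α : ℝ, ∫ β in (0 : ℝ)..w, q (α + (-1) * β) * H α (-β) =
        -∫ β in (0 : ℝ)..(-w), q (α + β) * H α β := by
      intro α
      have := intervalIntegral.integral_comp_neg (a := 0) (b := w) (fun β => q (α + β) * H α β)
      rw [neg_zero] at this
      rw [intervalIntegral.integral_symm (-w) 0]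
      simp only [neg_neg]
      rw [← this]
      simp
    simp only [h1, intervalIntegral.integral_neg]
    rw [hH.eq u (-w)]
    ring
  have h1 := volterra_intertwining hq (ε := -1) (by norm_num) (h := fun α β => H α (-β))
    (hH.continuous.comp (f := fun r : ℝ × ℝ => (r.1, -r.2)) (by fun_prop)) hv
    (p := fun s => -q s) hq.neg (G := fun u w => -H u (-w)) hG x
  have hk : ∀ x t : ℝ, kernel (fun u w => -H u (-w)) x t = -kernel H t x := by
    intro x t
    simp only [kernel]
    rw [show -((x - t) / 2) = (t - x) / 2 by ring, add_comm]
  have h2 : ∀ ξ : ℝ, (∫ ρ in (-ξ)..ξ, q ((ξ + ρ) / 2 + (-1) * ((ξ - ρ) / 2)) *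
      H ((ξ + ρ) / 2) (-((ξ - ρ) / 2)) * v ρ) = ∫ ρ in (-ξ)..ξ, kernel H ρ ξ * (q ρ * v ρ) := by
    intro ξ
    refine intervalIntegral.integral_congr fun ρ _ => ?_
    simp only [kernel]
    rw [show (ξ + ρ) / 2 + (-1) * ((ξ - ρ) / 2) = ρ by ring,
      show -((ξ - ρ) / 2) = (ρ - ξ) / 2 by ring, add_comm ξ ρ]
    ring
  simp only [h2] at h1
  simp only [hk, neg_mul, intervalIntegral.integral_neg, mul_neg] at h1
  have hi : ∀ g : ℝ → ℂ, LocallyIntegrable g →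
      IntervalIntegrable (fun ξ : ℝ => ((x - ξ : ℝ) : ℂ) * g ξ) volume 0 x := fun g hg =>
    intervalIntegrable_of_locallyIntegrable (LocallyIntegrable.continuous_mul (by fun_prop) hg) _ _
  have hsub : ∀ ξ : ℝ, invTransmute H (fun x => f x - q x * v x) ξ =
      invTransmute H f ξ - invTransmute H (fun x => q x * v x) ξ :=
    invTransmute_sub hH.continuous hf hqv
  have h3 : (fun ξ : ℝ => ((x - ξ : ℝ) : ℂ) * invTransmute H (fun x => f x - q x * v x) ξ) =
      fun ξ : ℝ => ((((x - ξ : ℝ) : ℂ) * f ξ -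
          (((x - ξ : ℝ) : ℂ) * ∫ t in (-ξ)..ξ, kernel H t ξ * f t)) -
        ((x - ξ : ℝ) : ℂ) * (q ξ * v ξ)) +
        ((x - ξ : ℝ) : ℂ) * ∫ ρ in (-ξ)..ξ, kernel H ρ ξ * (q ρ * v ρ) := by
    ext ξ
    rw [hsub]
    simp only [invTransmute]
    ring
  have ha := hi _ hf
  have hb := hi _ hKf.locallyIntegrable
  have hc := hi _ hqv
  have hd := hi _ hKq.locallyIntegrable
  rw [h3, intervalIntegral.integral_add ((ha.sub hb).sub hc) hd,
    intervalIntegral.integral_sub (ha.sub hb) hc, intervalIntegral.integral_sub ha hb]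
  have h4 := hv.eq_integral x
  simp only [invTransmute]
  linear_combination h1 + h4

include hq hH in
lemma invTransmute_transmute_of_isTwicePrimitive {v v₁ f : ℝ → ℂ} (hv : IsTwicePrimitive v v₁ f)
    (hf : ∀ x, invTransmute H (transmute H f) x = f x) (x : ℝ) :
    invTransmute H (transmute H v) x = v x := by
  obtain ⟨w₁, hw, hw0⟩ := isTwicePrimitive_transmute hq hH hv
  obtain ⟨z₁, hz, hz0⟩ := isTwicePrimitive_invTransmute hq hH hw
  simp only [add_sub_cancel_right] at hz
  rw [hz.eq_integral x, hv.eq_integral x, hz0, hw0]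
  have h1 : ∀ ξ : ℝ, invTransmute H (fun x => transmute H f x) ξ = f ξ := hf
  simp only [h1]
  simp [invTransmute, transmute]

lemma isTwicePrimitive_pow (k : ℕ) :
    IsTwicePrimitive (fun x : ℝ => (x : ℂ) ^ (k + 2)) (fun x => ((k : ℂ) + 2) * (x : ℂ) ^ (k + 1))
      (fun x => (((k : ℂ) + 2) * ((k : ℂ) + 1)) * (x : ℂ) ^ k) := by
  have hd : ∀ (n : ℕ) (x : ℝ), HasDerivAt (fun x : ℝ => (x : ℂ) ^ (n + 1))
      (((n : ℂ) + 1) * (x : ℂ) ^ n) x := fun n x => by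
    have := (hasDerivAt_ofReal x).fun_pow (n + 1)
    simpa using this
  refine ⟨fun x => ?_, by fun_prop, Continuous.locallyIntegrable (by fun_prop), fun c d => ?_⟩
  · refine (hd (k + 1) x).congr_deriv ?_
    push_cast
    ring
  · refine intervalIntegral.integral_eq_sub_of_hasDerivAt
      (f := fun x : ℝ => ((k : ℂ) + 2) * (x : ℂ) ^ (k + 1)) (fun x _ => ?_)
      (Continuous.intervalIntegrable (u := fun x : ℝ => ((k : ℂ) + 2) * ((k : ℂ) + 1) * (x : ℂ) ^ k)
        (by fun_prop) _ _)
    refine ((hd k x).const_mul ((k : ℂ) + 2)).congr_deriv ?_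
    ring

lemma isTwicePrimitive_one : IsTwicePrimitive (fun x : ℝ => (x : ℂ) ^ 0) (fun _ => 0)
    (fun _ => 0) :=
  ⟨fun x => by simpa using hasDerivAt_const x (1 : ℂ), continuous_const,
    locallyIntegrable_const _, fun c d => by simp⟩

lemma isTwicePrimitive_id : IsTwicePrimitive (fun x : ℝ => (x : ℂ) ^ 1) (fun _ => 1)
    (fun _ => 0) :=
  ⟨fun x => by simpa using hasDerivAt_ofReal x, continuous_const,
    locallyIntegrable_const _, fun c d => by simp⟩

include hq hH in
/-- On monomials the two operators are inverse to each other: both sides of the identity have the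
same initial values and, by induction on the degree, the same second derivative. -/
lemma invTransmute_transmute_pow (k : ℕ) (x : ℝ) :
    invTransmute H (transmute H fun x : ℝ => (x : ℂ) ^ k) x = (x : ℂ) ^ k := by
  have h0 : ∀ x, invTransmute H (transmute H fun _ => 0) x = 0 := by
    intro x; simp [invTransmute, transmute]
  induction k using Nat.twoStepInduction generalizing x with
  | zero => exact invTransmute_transmute_of_isTwicePrimitive hq hH isTwicePrimitive_one h0 x
  | one => exact invTransmute_transmute_of_isTwicePrimitive hq hH isTwicePrimitive_id h0 x
  | more k ih _ =>
    refine invTransmute_transmute_of_isTwicePrimitive hq hH (isTwicePrimitive_pow k)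
      (fun x => ?_) x
    have h1 := funext (transmute_const_mul H (((k : ℂ) + 2) * ((k : ℂ) + 1))
      (fun x : ℝ => (x : ℂ) ^ k))
    rw [h1, invTransmute_const_mul, ih]

end Solution

/-! ### Weak derivatives on an interval -/

/-- Integration by parts of an absolutely continuous function against a `C¹` function with compact
support. -/
lemma integral_primitive_mul_deriv {f : ℝ → ℂ} (hf : LocallyIntegrable f) (c : ℂ) {ψ : ℝ → ℂ}
    (hψ : ContDiff ℝ 1 ψ) (hs : HasCompactSupport ψ) :
    ∫ x, (c + ∫ t in (0 : ℝ)..x, f t) * deriv ψ x = -∫ x, f x * ψ x := by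
  obtain ⟨R, hR⟩ := hs.isBounded.subset_ball 0
  have hψ0 : ∀ x, R ≤ |x| → ψ x = 0 := by
    intro x hx
    by_contra hne
    have := hR (subset_tsupport _ (Function.mem_support.2 hne))
    rw [mem_ball_zero_iff, Real.norm_eq_abs] at this
    linarith
  have hd : Continuous (deriv ψ) := hψ.continuous_deriv le_rfl
  have hψd : ∀ x, HasDerivAt ψ (deriv ψ x) x := fun x =>
    (hψ.differentiable one_ne_zero x).hasDerivAt
  have hsupp : ∀ x, x ∉ Ioc (-(|R| + 1)) (|R| + 1) → ψ x = 0 ∧ deriv ψ x = 0 := by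
    intro x hx
    have h1 : x ∉ tsupport ψ := fun h => hx (by
      have := hR h
      rw [mem_ball_zero_iff, Real.norm_eq_abs] at this
      have h2 := abs_lt.1 (this.trans_le (le_abs_self R))
      exact ⟨by linarith, by linarith⟩)
    refine ⟨image_eq_zero_of_notMem_tsupport h1, ?_⟩
    by_contra hne
    exact h1 (support_deriv_subset (Function.mem_support.2 hne))
  set S := |R| + 1 with hS
  have hS0 : 0 < S := by positivity
  have hψS : ∀ X, |X| = S → ψ X = 0 := fun X hX =>
    hψ0 X (by rw [hX]; linarith [le_abs_self R])
  have hprim : Continuous fun x : ℝ => ∫ t in (0 : ℝ)..x, f t :=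
    intervalIntegral.continuous_primitive (intervalIntegrable_of_locallyIntegrable hf) 0
  have half : ∀ X, |X| = S → ∫ x in (0 : ℝ)..X, (c + ∫ t in (0 : ℝ)..x, f t) * deriv ψ x =
      -(c * ψ 0) - ∫ x in (0 : ℝ)..X, f x * ψ x := by
    intro X hX
    have hF : LocallyIntegrable (Function.uncurry fun x t => f t * deriv ψ x) :=
      LocallyIntegrable.mul_continuous (hd.comp continuous_fst) (locallyIntegrable_snd hf)
    have h1 := triangle_swap hF X
    have h2 : ∀ t, ∫ x in t..X, f t * deriv ψ x = -(f t * ψ t) := fun t => by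
      rw [intervalIntegral.integral_const_mul, intervalIntegral.integral_eq_sub_of_hasDerivAt
        (fun x _ => hψd x) (hd.intervalIntegrable _ _), hψS X hX]
      ring
    simp only [h2, intervalIntegral.integral_neg, intervalIntegral.integral_mul_const] at h1
    simp only [add_mul]
    rw [intervalIntegral.integral_add (Continuous.intervalIntegrable (by fun_prop) _ _)
      (Continuous.intervalIntegrable (by fun_prop) _ _), h1, intervalIntegral.integral_const_mul,
      intervalIntegral.integral_eq_sub_of_hasDerivAt (fun x _ => hψd x) (hd.intervalIntegrable _ _),
      hψS X hX]
    ring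
  have full : ∀ g : ℝ → ℂ, LocallyIntegrable g → (∀ x, x ∉ Ioc (-S) S → g x = 0) →
      ∫ x, g x = (∫ x in (0 : ℝ)..S, g x) - ∫ x in (0 : ℝ)..(-S), g x := by
    intro g hg h0
    have hi := intervalIntegrable_of_locallyIntegrable hg
    rw [intervalIntegral.integral_interval_sub_left (hi _ _) (hi _ _),
      intervalIntegral.integral_of_le (by linarith),
      setIntegral_eq_integral_of_forall_compl_eq_zero h0]
  rw [full _ (Continuous.locallyIntegrable (by fun_prop))
      (fun x hx => by rw [(hsupp x hx).2, mul_zero]),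
    full _ (LocallyIntegrable.mul_continuous hψ.continuous hf)
      (fun x hx => by rw [(hsupp x hx).1, mul_zero]),
    half S (abs_of_pos hS0), half (-S) (by rw [abs_neg, abs_of_pos hS0])]
  ring

section Weak

variable {a : ℝ}

lemma testFunction_eq_zero {E : Type*} [NormedAddCommGroup E] [NormedSpace ℝ E] {Ω : Opens E}
    (φ : TestFunction Ω ℂ ⊤) {x : E} (hx : x ∉ Ω) : φ x = 0 :=
  image_eq_zero_of_notMem_tsupport fun h => hx (φ.tsupport_subset h)

lemma fderiv_testFunction_eq_zero {E : Type*} [NormedAddCommGroup E] [NormedSpace ℝ E]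
    {Ω : Opens E} (φ : TestFunction Ω ℂ ⊤) {x : E} (hx : x ∉ Ω) : fderiv ℝ φ x = 0 := by
  by_contra hne
  exact hx (φ.tsupport_subset (support_fderiv_subset ℝ (Function.mem_support.2 hne)))

lemma contDiff_testFunction {E : Type*} [NormedAddCommGroup E] [NormedSpace ℝ E]
    {Ω : Opens E} (φ : TestFunction Ω ℂ ⊤) (n : ℕ) : ContDiff ℝ n φ :=
  φ.contDiff.of_le (by exact_mod_cast le_top)

/-- The derivative of a test function on the interval is a test function. -/
noncomputable def derivTest (φ : TestFunction (I a) ℂ ⊤) : TestFunction (I a) ℂ ⊤ where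
  toFun := deriv φ
  contDiff' := (contDiff_infty_iff_deriv.1 φ.contDiff).2
  hasCompactSupport' := φ.hasCompactSupport.deriv
  tsupport_subset' := (closure_minimal support_deriv_subset (isClosed_tsupport _)).trans
    φ.tsupport_subset

lemma setIntegral_mul_testFunction (g : ℝ → ℂ) (φ : TestFunction (I a) ℂ ⊤) :
    ∫ x in (I a : Set ℝ), g x * φ x = ∫ x, g x * φ x :=
  setIntegral_eq_integral_of_forall_compl_eq_zero fun x hx => by
    rw [testFunction_eq_zero φ hx, mul_zero]

lemma setIntegral_primitive_mul_deriv {v v₁ : ℝ → ℂ} (hv₁ : LocallyIntegrable v₁) (c : ℂ)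
    (hv : ∀ x, v x = c + ∫ t in (0 : ℝ)..x, v₁ t) (φ : TestFunction (I a) ℂ ⊤) :
    ∫ x in (I a : Set ℝ), v x * deriv φ x = -∫ x in (I a : Set ℝ), v₁ x * φ x := by
  rw [setIntegral_mul_testFunction]
  have h1 := setIntegral_mul_testFunction v (derivTest φ)
  change ∫ x in (I a : Set ℝ), v x * deriv φ x = ∫ x, v x * deriv φ x at h1
  rw [h1, ← integral_primitive_mul_deriv hv₁ c (contDiff_testFunction φ 1) φ.hasCompactSupport]
  simp only [hv]

lemma hasWeakDeriv_of_ae_eq {u u' v v₁ : ℝ → ℂ} (hv₁ : LocallyIntegrable v₁) (c : ℂ)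
    (hv : ∀ x, v x = c + ∫ t in (0 : ℝ)..x, v₁ t)
    (hu : u =ᵐ[volume.restrict (I a : Set ℝ)] v)
    (hu' : u' =ᵐ[volume.restrict (I a : Set ℝ)] v₁) : HasWeakDeriv (I a) 1 u u' := by
  intro φ
  have h1 := setIntegral_primitive_mul_deriv hv₁ c hv φ
  have h2 : ∫ x in (I a : Set ℝ), u x * fderiv ℝ φ x 1 =
      ∫ x in (I a : Set ℝ), v x * deriv φ x := by
    refine integral_congr_ae ?_
    filter_upwards [hu] with x hx
    rw [hx, fderiv_apply_one_eq_deriv]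
  have h3 : ∫ x in (I a : Set ℝ), u' x * φ x = ∫ x in (I a : Set ℝ), v₁ x * φ x := by
    refine integral_congr_ae ?_
    filter_upwards [hu'] with x hx
    rw [hx]
  rw [h2, h3, h1]

/-- The lemma of du Bois-Reymond: a function with zero weak derivative is constant. -/
lemma ae_eq_const_of_weakDeriv_zero (ha : 0 < a) {w : ℝ → ℂ} (hw : IntegrableOn w (I a : Set ℝ))
    (h : ∀ φ : TestFunction (I a) ℂ ⊤, ∫ x in (I a : Set ℝ), w x * deriv φ x = 0) :
    ∃ c : ℂ, ∀ᵐ x ∂(volume.restrict (I a : Set ℝ)), w x = c := by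
  let b : ContDiffBump (0 : ℝ) := ⟨a / 4, a / 2, by positivity, by linarith⟩
  let ψ : ℝ → ℝ := b.normed volume
  have hψ : ContDiff ℝ ((⊤ : ℕ∞) : WithTop ℕ∞) ψ := b.contDiff_normed
  have hψi : ∫ x, ψ x = 1 := b.integral_normed
  have hψs : HasCompactSupport ψ := b.hasCompactSupport_normed
  have hψt : tsupport ψ ⊆ (I a : Set ℝ) := by
    intro x hx
    have h1 : x ∈ Metric.closedBall (0 : ℝ) (a / 2) := by
      rw [← b.tsupport_normed_eq (μ := volume)]; exact hx
    rw [mem_closedBall_zero_iff, Real.norm_eq_abs, abs_le] at h1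
    exact ⟨by linarith [h1.1], by linarith [h1.2]⟩
  have hint : ∀ g : ℝ → ℝ, Continuous g →
      IntegrableOn (fun x => (g x : ℂ) * w x) (I a : Set ℝ) := by
    intro g hg
    have hwi : IntegrableOn w (Icc (-a) a) := by
      rw [integrableOn_Icc_iff_integrableOn_Ioo]; exact hw
    exact (hwi.continuousOn_mul (Complex.continuous_ofReal.comp hg).continuousOn
      isCompact_Icc).mono_set Ioo_subset_Icc_self
  set c : ℂ := ∫ x in (I a : Set ℝ), (ψ x : ℂ) * w x with hc
  refine ⟨c, ?_⟩
  have hwc : IntegrableOn (fun x => w x - c) (I a : Set ℝ) :=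
    hw.sub (integrableOn_const (by simp [I]))
  have key := (I a).isOpen.ae_eq_zero_of_integral_contDiff_smul_eq_zero
    (μ := (volume : Measure ℝ)) (f := fun x => w x - c) hwc.locallyIntegrableOn ?_
  · refine (ae_restrict_iff' (I a).isOpen.measurableSet).2 ?_
    filter_upwards [key] with x hx hxI
    exact sub_eq_zero.1 (hx hxI)
  intro g hg hgs hgt
  -- `g - (∫ g) ψ` has integral zero, hence it is the derivative of a test function
  set m : ℝ := ∫ x, g x with hm
  let η : ℝ → ℝ := fun x => g x - m * ψ x
  have hηd : ContDiff ℝ ((⊤ : ℕ∞) : WithTop ℕ∞) η := hg.sub (contDiff_const.mul hψ)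
  have hηs : HasCompactSupport η := hgs.sub hψs.mul_left
  have hηt : tsupport η ⊆ (I a : Set ℝ) := by
    refine (tsupport_sub _ _).trans (union_subset hgt ?_)
    exact (tsupport_mul_subset_right (f := fun _ => m) (g := ψ)).trans hψt
  have hη0 : ∫ x, η x = 0 := by
    have h1 : Integrable g := hg.continuous.integrable_of_hasCompactSupport hgs
    have h2 : Integrable ψ := hψ.continuous.integrable_of_hasCompactSupport hψs
    simp only [η]
    rw [integral_sub h1 (h2.const_mul m), integral_const_mul, hψi]
    simp [hm]
  have hηz : ∀ x, x ∉ (I a : Set ℝ) → η x = 0 := fun x hx =>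
    image_eq_zero_of_notMem_tsupport fun h => hx (hηt h)
  obtain ⟨l, r, hl, hr, hlr⟩ : ∃ l r : ℝ, -a < l ∧ r < a ∧ tsupport η ⊆ Icc l r := by
    rcases (tsupport η).eq_empty_or_nonempty with h0 | h0
    · exact ⟨0, 0, by linarith, ha, by rw [h0]; exact empty_subset _⟩
    · obtain ⟨l, hl, hl'⟩ := hηs.isCompact.exists_isLeast h0
      obtain ⟨r, hr, hr'⟩ := hηs.isCompact.exists_isGreatest h0
      exact ⟨l, r, (hηt hl).1, (hηt hr).2, fun x hx => ⟨hl' hx, hr' hx⟩⟩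
  have hηlr : ∀ x, x ∉ Icc l r → η x = 0 := fun x hx =>
    image_eq_zero_of_notMem_tsupport fun h => hx (hlr h)
  let P : ℝ → ℝ := fun x => ∫ t in (-a)..x, η t
  have hP : ∀ x, HasDerivAt P (η x) x := fun x =>
    (hηd.continuous.integral_hasStrictDerivAt _ x).hasDerivAt
  have hPd : deriv P = η := funext fun x => (hP x).deriv
  have hPs : ContDiff ℝ ((⊤ : ℕ∞) : WithTop ℕ∞) P := by
    rw [contDiff_infty_iff_deriv, hPd]
    exact ⟨fun x => (hP x).differentiableAt, hηd⟩
  have hP0 : ∀ x, x ∉ Icc l r → P x = 0 := by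
    intro x hx
    by_cases hxl : x < l
    · refine (intervalIntegral.integral_congr (g := fun _ => (0 : ℝ))
        fun t ht => ?_).trans (by simp)
      refine hηlr t fun ht' => ?_
      have := ht.2.trans (max_le hl.le hxl.le)
      rcases le_max_iff.1 ht.2 with h | h <;> linarith [ht'.1]
    · have hxr : r < x := by
        by_contra hcon
        exact hx ⟨not_lt.1 hxl, not_lt.1 hcon⟩
      by_cases hax : -a ≤ x
      · have h1 : ∫ t in Ioc (-a) x, η t = ∫ t, η t :=
          setIntegral_eq_integral_of_forall_compl_eq_zero fun t ht => hηlr t fun ht' =>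
            ht ⟨by linarith [ht'.1], by linarith [ht'.2]⟩
        change ∫ t in (-a)..x, η t = 0
        rw [intervalIntegral.integral_of_le hax, h1, hη0]
      · linarith [not_lt.1 hxl]
  have hPt : tsupport (fun x => (P x : ℂ)) ⊆ Icc l r := by
    refine closure_minimal (fun x hx => ?_) isClosed_Icc
    by_contra hcon
    exact hx (by simp [hP0 x hcon])
  let φ : TestFunction (I a) ℂ ⊤ :=
    ⟨fun x => (P x : ℂ), Complex.ofRealCLM.contDiff.comp hPs,
      HasCompactSupport.of_support_subset_isCompact isCompact_Icc
        ((subset_tsupport _).trans hPt), hPt.trans (Icc_subset_Ioo hl hr)⟩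
  have h1 := h φ
  have h2 : ∀ x, deriv φ x = (η x : ℂ) := fun x => ((hP x).ofReal_comp).deriv
  simp only [h2] at h1
  have h3 : ∫ x, g x • (w x - c) = ∫ x in (I a : Set ℝ), ((g x : ℂ) * w x - (g x : ℂ) * c) := by
    rw [← setIntegral_eq_integral_of_forall_compl_eq_zero (s := (I a : Set ℝ))]
    · simp only [Complex.real_smul, mul_sub]
    · intro x hx
      rw [image_eq_zero_of_notMem_tsupport fun h => hx (hgt h), zero_smul]
  have h4 : ∫ x in (I a : Set ℝ), (g x : ℂ) = (m : ℂ) := by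
    rw [setIntegral_eq_integral_of_forall_compl_eq_zero, integral_complex_ofReal]
    intro x hx
    rw [image_eq_zero_of_notMem_tsupport fun h => hx (hgt h)]; rfl
  have h5 : ∫ x in (I a : Set ℝ), w x * (η x : ℂ) =
      (∫ x in (I a : Set ℝ), (g x : ℂ) * w x) - m * c := by
    rw [hc, ← integral_const_mul, ← integral_sub (hint g hg.continuous)
      ((hint ψ hψ.continuous).const_mul _)]
    refine integral_congr_ae (Filter.Eventually.of_forall fun x => ?_)
    simp only [η]
    push_cast
    ring
  have hgi : IntegrableOn (fun x => (g x : ℂ) * c) (I a : Set ℝ) :=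
    ((hg.continuous.integrable_of_hasCompactSupport hgs).ofReal.mul_const c).integrableOn
  rw [h3, integral_sub (hint g hg.continuous) hgi, integral_mul_const, h4, ← h5, h1]

lemma abs_lt_of_mem_I {x : ℝ} (hx : x ∈ (I a : Set ℝ)) : |x| < a := abs_lt.2 hx

/-- A function with an integrable weak derivative is a primitive of it. -/
lemma HasWeakDeriv.ae_eq_primitive (ha : 0 < a) {u g : ℝ → ℂ}
    (hu : IntegrableOn u (I a : Set ℝ)) (hg : IntegrableOn g (I a : Set ℝ))
    (h : HasWeakDeriv (I a) 1 u g) :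
    ∃ c : ℂ, ∀ᵐ x ∂(volume.restrict (I a : Set ℝ)),
      u x = c + ∫ t in (0 : ℝ)..x, indicator (I a : Set ℝ) g t := by
  have hg' : Integrable (indicator (I a : Set ℝ) g) :=
    (integrable_indicator_iff (I a).isOpen.measurableSet).2 hg
  have hprim : Continuous fun x : ℝ => ∫ t in (0 : ℝ)..x, indicator (I a : Set ℝ) g t :=
    intervalIntegral.continuous_primitive
      (intervalIntegrable_of_locallyIntegrable hg'.locallyIntegrable) 0
  have hpi : IntegrableOn (fun x : ℝ => ∫ t in (0 : ℝ)..x, indicator (I a : Set ℝ) g t)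
      (I a : Set ℝ) :=
    (hprim.continuousOn.integrableOn_compact isCompact_Icc).mono_set Ioo_subset_Icc_self
  obtain ⟨c, hc⟩ := ae_eq_const_of_weakDeriv_zero ha (hu.sub hpi) (fun φ => by
    have h1 := h φ
    have h2 := setIntegral_primitive_mul_deriv hg'.locallyIntegrable 0
      (fun x => (zero_add _).symm) φ
    have h3 : ∫ x in (I a : Set ℝ), indicator (I a : Set ℝ) g x * φ x =
        ∫ x in (I a : Set ℝ), g x * φ x :=
      setIntegral_congr_fun (I a).isOpen.measurableSet fun x hx => by
        simp only [indicator_of_mem hx]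
    simp only [fderiv_apply_one_eq_deriv] at h1
    have hdc : Continuous (deriv φ) := (contDiff_testFunction φ 1).continuous_deriv le_rfl
    have hmul : ∀ f : ℝ → ℂ, IntegrableOn f (I a : Set ℝ) →
        IntegrableOn (fun x => f x * deriv φ x) (I a : Set ℝ) := fun f hf => by
      have hfi : IntegrableOn f (Icc (-a) a) := by
        rw [integrableOn_Icc_iff_integrableOn_Ioo]; exact hf
      exact (hfi.mul_continuousOn hdc.continuousOn isCompact_Icc).mono_set Ioo_subset_Icc_self
    simp only [Pi.sub_apply, sub_mul]
    rw [integral_sub (hmul _ hu) (hmul _ hpi), h1, h2, h3, sub_self])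
  refine ⟨c, ?_⟩
  filter_upwards [hc] with x hx
  rw [← hx]
  simp

end Weak

section Sobolev

variable {a : ℝ}

lemma integrableOn_I_of_locallyIntegrable {f : ℝ → ℂ} (hf : LocallyIntegrable f) :
    IntegrableOn f (I a : Set ℝ) :=
  (hf.integrableOn_isCompact isCompact_Icc).mono_set Ioo_subset_Icc_self

/-- An element of `L¹(-a, a)`, extended by zero to the line. -/
noncomputable def extend (u : L1 (I a)) : ℝ → ℂ := indicator (I a : Set ℝ) u

lemma integrableOn_coe (u : L1 (I a)) : IntegrableOn u (I a : Set ℝ) :=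
  L1.integrable_coeFn u

lemma integrable_extend (u : L1 (I a)) : Integrable (extend u) :=
  (integrable_indicator_iff (I a).isOpen.measurableSet).2 (integrableOn_coe u)

lemma locallyIntegrable_extend (u : L1 (I a)) : LocallyIntegrable (extend u) :=
  (integrable_extend u).locallyIntegrable

lemma extend_ae_eq (u : L1 (I a)) : u =ᵐ[volume.restrict (I a : Set ℝ)] extend u :=
  (indicator_ae_eq_restrict (I a).isOpen.measurableSet).symm

lemma IsTwicePrimitive.eq_primitive {v v₁ f : ℝ → ℂ} (hv : IsTwicePrimitive v v₁ f) (x : ℝ) :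
    v x = v 0 + ∫ t in (0 : ℝ)..x, v₁ t := by
  rw [intervalIntegral.integral_eq_sub_of_hasDerivAt (fun x _ => hv.hasDerivAt x)
    (hv.continuous.intervalIntegrable _ _)]
  ring

lemma IsTwicePrimitive.deriv_eq_primitive {v v₁ f : ℝ → ℂ} (hv : IsTwicePrimitive v v₁ f)
    (x : ℝ) : v₁ x = v₁ 0 + ∫ t in (0 : ℝ)..x, f t := by
  rw [hv.integral_eq]
  ring

/-- The class in `L¹(-a, a)` of a locally integrable function. -/
noncomputable def toL1I (a : ℝ) {f : ℝ → ℂ} (hf : LocallyIntegrable f) : L1 (I a) :=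
  Integrable.toL1 f (integrableOn_I_of_locallyIntegrable hf)

lemma coeFn_toL1I {f : ℝ → ℂ} (hf : LocallyIntegrable f) :
    toL1I a hf =ᵐ[volume.restrict (I a : Set ℝ)] f :=
  Integrable.coeFn_toL1 _

lemma IsTwicePrimitive.isSecondDeriv {v v₁ f : ℝ → ℂ} (hv : IsTwicePrimitive v v₁ f)
    {u u'' : L1 (I a)} (hu : u =ᵐ[volume.restrict (I a : Set ℝ)] v)
    (hu'' : u'' =ᵐ[volume.restrict (I a : Set ℝ)] f) : IsSecondDeriv a u u'' :=
  ⟨toL1I a hv.continuous.locallyIntegrable,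
    hasWeakDeriv_of_ae_eq hv.continuous.locallyIntegrable _ hv.eq_primitive hu (coeFn_toL1I _),
    hasWeakDeriv_of_ae_eq hv.locallyIntegrable _ hv.deriv_eq_primitive (coeFn_toL1I _) hu''⟩

lemma integral_congr_I {f g : ℝ → ℂ} (h : f =ᵐ[volume.restrict (I a : Set ℝ)] g) {x : ℝ}
    (hx : x ∈ (I a : Set ℝ)) : ∫ t in (0 : ℝ)..x, f t = ∫ t in (0 : ℝ)..x, g t :=
  integral_congr_potential h (abs_lt_of_mem_I hx).le

/-- Functions in `W^{2,1}(-a, a)` are, up to null sets, restrictions of twice primitives on the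
line. -/
lemma IsSecondDeriv.exists_isTwicePrimitive (ha : 0 < a) {u u'' : L1 (I a)}
    (h : IsSecondDeriv a u u'') : ∃ v v₁ : ℝ → ℂ, IsTwicePrimitive v v₁ (extend u'') ∧
      u =ᵐ[volume.restrict (I a : Set ℝ)] v := by
  obtain ⟨u', h1, h2⟩ := h
  obtain ⟨c₀, hc₀⟩ := h1.ae_eq_primitive ha (integrableOn_coe u) (integrableOn_coe u')
  obtain ⟨c₁, hc₁⟩ := h2.ae_eq_primitive ha (integrableOn_coe u') (integrableOn_coe u'')
  have hv := isTwicePrimitive_of_integral (locallyIntegrable_extend u'') c₀ c₁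
  refine ⟨_, _, hv, ?_⟩
  filter_upwards [hc₀, ae_restrict_mem (I a).isOpen.measurableSet] with x hx hxI
  rw [hx, hv.eq_primitive x]
  congr 1
  · simp
  · exact integral_congr_I ((extend_ae_eq u').symm.trans hc₁) hxI

lemma IsSecondDeriv.unique {u w w' : L1 (I a)} (h : IsSecondDeriv a u w)
    (h' : IsSecondDeriv a u w') : w =ᵐ[volume.restrict (I a : Set ℝ)] w' := by
  have key : ∀ {f g g' : L1 (I a)}, HasWeakDeriv (I a) 1 f g → HasWeakDeriv (I a) 1 f g' →
      g =ᵐ[volume.restrict (I a : Set ℝ)] g' := by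
    intro f g g' hg hg'
    have h1 := (I a).isOpen.ae_eq_zero_of_integral_contDiff_smul_eq_zero
      (μ := (volume : Measure ℝ)) (f := fun x => g x - g' x)
      ((integrableOn_coe g).sub (integrableOn_coe g')).locallyIntegrableOn ?_
    · refine (ae_restrict_iff' (I a).isOpen.measurableSet).2 ?_
      filter_upwards [h1] with x hx hxI
      exact sub_eq_zero.1 (hx hxI)
    intro ψ hψ hψs hψt
    have hsupp : tsupport (fun x => (ψ x : ℂ)) ⊆ tsupport ψ :=
      closure_mono fun x hx => fun h0 => hx (by simp [h0])
    let φ : TestFunction (I a) ℂ ⊤ :=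
      ⟨fun x => (ψ x : ℂ), Complex.ofRealCLM.contDiff.comp hψ,
        HasCompactSupport.of_support_subset_isCompact hψs.isCompact
          ((subset_tsupport _).trans hsupp), hsupp.trans hψt⟩
    have h2 : ∫ x in (I a : Set ℝ), g x * φ x = ∫ x in (I a : Set ℝ), g' x * φ x :=
      neg_injective ((hg φ).symm.trans (hg' φ))
    have hi : ∀ g : L1 (I a), IntegrableOn (fun x => g x * φ x) (I a : Set ℝ) := fun g => by
      have h3 : IntegrableOn g (Icc (-a) a) := by
        rw [integrableOn_Icc_iff_integrableOn_Ioo]; exact integrableOn_coe g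
      exact (h3.mul_continuousOn φ.continuous.continuousOn isCompact_Icc).mono_set
        Ioo_subset_Icc_self
    rw [← sub_eq_zero, ← integral_sub (hi g) (hi g')] at h2
    rw [← h2, ← setIntegral_eq_integral_of_forall_compl_eq_zero (s := (I a : Set ℝ))]
    · refine integral_congr_ae (Filter.Eventually.of_forall fun x => ?_)
      change ψ x • (g x - g' x) = g x * (ψ x : ℂ) - g' x * (ψ x : ℂ)
      rw [Complex.real_smul]
      ring
    · intro x hx
      rw [image_eq_zero_of_notMem_tsupport fun h => hx (hψt h), zero_smul]
  obtain ⟨u', h1, h2⟩ := h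
  obtain ⟨z', h1', h2'⟩ := h'
  have h3 : u' = z' := Lp.ext (key h1 h1')
  subst h3
  exact key h2 h2'

lemma IsTwicePrimitive.hasInitialValues {v v₁ f : ℝ → ℂ} (hv : IsTwicePrimitive v v₁ f)
    {u : L1 (I a)} (hu : u =ᵐ[volume.restrict (I a : Set ℝ)] v) :
    HasInitialValues a u (v 0) (v₁ 0) := by
  have hd : deriv v = v₁ := funext fun x => (hv.hasDerivAt x).deriv
  refine ⟨v, ContDiff.contDiffOn ?_, hu, rfl, by rw [hd]⟩
  rw [contDiff_one_iff_deriv, hd]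
  exact ⟨fun x => (hv.hasDerivAt x).differentiableAt, hv.continuous⟩

lemma IsTwicePrimitive.isWeakSolution {q v v₁ f : ℝ → ℂ} (hq : LocallyIntegrable q)
    (hv : IsTwicePrimitive v v₁ f) {h u : L1 (I a)}
    (hu : u =ᵐ[volume.restrict (I a : Set ℝ)] v)
    (hf : ∀ᵐ x ∂(volume.restrict (I a : Set ℝ)), f x = h x + q x * v x) :
    IsWeakSolution a q h u := by
  refine ⟨⟨toL1I a hv.continuous.locallyIntegrable, hasWeakDeriv_of_ae_eq
    hv.continuous.locallyIntegrable _ hv.eq_primitive hu (coeFn_toL1I _)⟩, fun φ => ?_⟩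
  have hvc := hv.continuous_zero
  have h1 : ∫ x in (I a : Set ℝ), v x * deriv (deriv φ) x =
      -∫ x in (I a : Set ℝ), v₁ x * deriv φ x :=
    setIntegral_primitive_mul_deriv hv.continuous.locallyIntegrable _ hv.eq_primitive (derivTest φ)
  have h2 := setIntegral_primitive_mul_deriv hv.locallyIntegrable _ hv.deriv_eq_primitive φ
  rw [h2, neg_neg] at h1
  have hqv : LocallyIntegrable fun x => q x * v x * φ x :=
    LocallyIntegrable.mul_continuous φ.continuous (LocallyIntegrable.mul_continuous hvc hq)
  have hd2 : Continuous (deriv (deriv φ)) :=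
    (contDiff_testFunction (derivTest φ) 1).continuous_deriv le_rfl
  have hfφ : LocallyIntegrable fun x => f x * φ x :=
    LocallyIntegrable.mul_continuous φ.continuous hv.locallyIntegrable
  calc ∫ x in (I a : Set ℝ), (u x * deriv (deriv φ) x - q x * u x * φ x)
      = ∫ x in (I a : Set ℝ), (v x * deriv (deriv φ) x - q x * v x * φ x) := by
        refine integral_congr_ae ?_
        filter_upwards [hu] with x hx
        rw [hx]
    _ = (∫ x in (I a : Set ℝ), f x * φ x) - ∫ x in (I a : Set ℝ), q x * v x * φ x := by
        rw [integral_sub _ (integrableOn_I_of_locallyIntegrable hqv), h1]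
        exact integrableOn_I_of_locallyIntegrable (hvc.mul hd2).locallyIntegrable
    _ = ∫ x in (I a : Set ℝ), h x * φ x := by
        rw [← integral_sub (integrableOn_I_of_locallyIntegrable hfφ)
          (integrableOn_I_of_locallyIntegrable hqv)]
        refine integral_congr_ae ?_
        filter_upwards [hf] with x hx
        rw [hx]
        ring

end Sobolev

/-! ### The operators on `L¹(-a, a)` -/

section L1Operators

variable {a : ℝ} {k : ℝ → ℝ → ℂ} (hk : Continuous (Function.uncurry k))

include hk in
lemma continuous_volterra {f : ℝ → ℂ} (hf : LocallyIntegrable f) :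
    Continuous fun x : ℝ => ∫ t in (-x)..x, k x t * f t := by
  have := continuous_weighted_integral (X := ℝ) hf hk continuous_neg
    (r := fun x => x) continuous_id
  simpa only [mul_comm] using this

include hk in
lemma intervalIntegrable_volterra {f : ℝ → ℂ} (hf : LocallyIntegrable f) (x b c : ℝ) :
    IntervalIntegrable (fun t => k x t * f t) volume b c :=
  intervalIntegrable_of_locallyIntegrable
    (LocallyIntegrable.continuous_mul (hk.comp (Continuous.prodMk_right x)) hf) b c

lemma volterra_congr {f g : ℝ → ℂ} (h : f =ᵐ[volume.restrict (I a : Set ℝ)] g) {x : ℝ}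
    (hx : |x| ≤ a) (k : ℝ → ℝ → ℂ) :
    ∫ t in (-x)..x, k x t * f t = ∫ t in (-x)..x, k x t * g t := by
  refine intervalIntegral.integral_congr_ae ?_
  have h1 : ∀ᵐ s : ℝ, s ∈ (I a : Set ℝ) → f s = g s :=
    (ae_restrict_iff' measurableSet_Ioo).1 h
  have h3 : ∀ᵐ s : ℝ, s ≠ a := by simp [ae_iff]
  have h4 : ∀ᵐ s : ℝ, s ≠ -a := by simp [ae_iff]
  filter_upwards [h1, h3, h4] with s h1 h3 h4 hs
  have hle : |s| ≤ a := by
    rw [abs_le] at hx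
    rcases mem_uIoc.1 hs with h | h <;> rw [abs_le] <;> constructor <;> linarith [h.1, h.2]
  rw [abs_le] at hle
  rw [h1 ⟨lt_of_le_of_ne hle.1 (Ne.symm h4), lt_of_le_of_ne hle.2 h3⟩]

/-- The Volterra operator `u ↦ ∫_{-x}^x k(x, t) u(t) dt` on `L¹(-a, a)`, for a continuous
kernel `k`. -/
noncomputable def volterra (a : ℝ) (k : ℝ → ℝ → ℂ) (hk : Continuous (Function.uncurry k)) :
    L1 (I a) →ₗ[ℂ] L1 (I a) where
  toFun u := toL1I a (continuous_volterra hk (locallyIntegrable_extend u)).locallyIntegrable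
  map_add' u w := by
    refine Lp.ext ?_
    filter_upwards [coeFn_toL1I (a := a)
        (continuous_volterra hk (locallyIntegrable_extend (u + w))).locallyIntegrable,
      coeFn_toL1I (a := a) (continuous_volterra hk (locallyIntegrable_extend u)).locallyIntegrable,
      coeFn_toL1I (a := a) (continuous_volterra hk (locallyIntegrable_extend w)).locallyIntegrable,
      Lp.coeFn_add
        (toL1I a (continuous_volterra hk (locallyIntegrable_extend u)).locallyIntegrable)
        (toL1I a (continuous_volterra hk (locallyIntegrable_extend w)).locallyIntegrable),
      ae_restrict_mem (I a).isOpen.measurableSet] with x h1 h2 h3 h4 hx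
    rw [h1, h4, Pi.add_apply, h2, h3, ← intervalIntegral.integral_add
      (intervalIntegrable_volterra hk (locallyIntegrable_extend u) _ _ _)
      (intervalIntegrable_volterra hk (locallyIntegrable_extend w) _ _ _)]
    simp only [← mul_add]
    refine volterra_congr (f := extend (u + w)) (g := fun t => extend u t + extend w t) ?_
      (abs_lt_of_mem_I hx).le k
    filter_upwards [extend_ae_eq (u + w), extend_ae_eq u, extend_ae_eq w, Lp.coeFn_add u w]
      with t e1 e2 e3 e4
    rw [← e1, e4, Pi.add_apply, e2, e3]
  map_smul' c u := by
    refine Lp.ext ?_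
    filter_upwards [coeFn_toL1I (a := a)
        (continuous_volterra hk (locallyIntegrable_extend (c • u))).locallyIntegrable,
      coeFn_toL1I (a := a) (continuous_volterra hk (locallyIntegrable_extend u)).locallyIntegrable,
      Lp.coeFn_smul c
        (toL1I a (continuous_volterra hk (locallyIntegrable_extend u)).locallyIntegrable),
      ae_restrict_mem (I a).isOpen.measurableSet] with x h1 h2 h4 hx
    rw [h1, RingHom.id_apply, h4, Pi.smul_apply, h2, smul_eq_mul,
      ← intervalIntegral.integral_const_mul]
    rw [volterra_congr (f := extend (c • u)) (g := fun t => c * extend u t) ?_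
      (abs_lt_of_mem_I hx).le k]
    · exact intervalIntegral.integral_congr fun t _ => by ring
    · filter_upwards [extend_ae_eq (c • u), extend_ae_eq u, Lp.coeFn_smul c u] with t e1 e2 e4
      rw [← e1, e4, Pi.smul_apply, e2, smul_eq_mul]

include hk in
lemma volterra_ae_eq (u : L1 (I a)) : ∀ᵐ x ∂(volume.restrict (I a : Set ℝ)),
    volterra a k hk u x = ∫ t in (-x)..x, k x t * extend u t :=
  coeFn_toL1I (continuous_volterra hk (locallyIntegrable_extend u)).locallyIntegrable

lemma integral_norm_extend (u : L1 (I a)) : ∫ t, ‖extend u t‖ = ‖u‖ := by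
  rw [L1.norm_eq_integral_norm, ← integral_indicator (I a).isOpen.measurableSet]
  congr 1
  ext t
  simp only [extend, norm_indicator_eq_indicator_norm]

lemma norm_volterra_le (ha : 0 ≤ a) :
    ∃ C : ℝ, ∀ u : L1 (I a), ‖volterra a k hk u‖ ≤ C * ‖u‖ := by
  obtain ⟨C, hC⟩ := ((isCompact_Icc (a := -a) (b := a)).prod
    (isCompact_Icc (a := -a) (b := a))).exists_bound_of_continuousOn hk.continuousOn
  have hC0 : 0 ≤ C := (norm_nonneg _).trans (hC (0, 0) ⟨⟨by simpa, ha⟩, ⟨by simpa, ha⟩⟩)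
  refine ⟨2 * a * C, fun u => ?_⟩
  have hbound : ∀ x ∈ (I a : Set ℝ), ‖∫ t in (-x)..x, k x t * extend u t‖ ≤ C * ‖u‖ := by
    intro x hx
    calc ‖∫ t in (-x)..x, k x t * extend u t‖
        ≤ ∫ t in uIoc (-x) x, ‖k x t * extend u t‖ :=
          intervalIntegral.norm_integral_le_integral_norm_uIoc
      _ ≤ ∫ t in uIoc (-x) x, C * ‖extend u t‖ := by
          refine setIntegral_mono_on
            (intervalIntegrable_iff.1
              (intervalIntegrable_volterra hk (locallyIntegrable_extend u) x (-x) x)).norm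
            ((integrable_extend u).norm.const_mul C).integrableOn measurableSet_uIoc fun t ht => ?_
          rw [norm_mul]
          refine mul_le_mul_of_nonneg_right (hC (x, t) ⟨Ioo_subset_Icc_self hx, ?_⟩) (norm_nonneg _)
          rcases mem_uIoc.1 ht with h | h <;> constructor <;> linarith [h.1, h.2, hx.1, hx.2]
      _ ≤ ∫ t, C * ‖extend u t‖ := setIntegral_le_integral
          ((integrable_extend u).norm.const_mul C)
          (Filter.Eventually.of_forall fun t => by positivity)
      _ = C * ‖u‖ := by rw [integral_const_mul, integral_norm_extend]
  rw [L1.norm_eq_integral_norm]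
  calc ∫ x in (I a : Set ℝ), ‖volterra a k hk u x‖
      ≤ ∫ _x in (I a : Set ℝ), C * ‖u‖ := by
        refine integral_mono_ae (integrableOn_coe _).norm (integrableOn_const (by simp [I])) ?_
        filter_upwards [volterra_ae_eq hk u, ae_restrict_mem (I a).isOpen.measurableSet]
          with x hx hxI
        rw [hx]
        exact hbound x hxI
    _ = 2 * a * C * ‖u‖ := by
        rw [setIntegral_const]
        have : volume.real (I a : Set ℝ) = 2 * a := by
          change volume.real (Ioo (-a) a) = 2 * a
          rw [Real.volume_real_Ioo_of_le (by linarith)]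
          ring
        rw [this, smul_eq_mul]
        ring

end L1Operators

section Inverse

variable {a : ℝ} {H : ℝ → ℝ → ℂ}

lemma transmute_congr (H : ℝ → ℝ → ℂ) {f g : ℝ → ℂ}
    (h : f =ᵐ[volume.restrict (I a : Set ℝ)] g) :
    transmute H f =ᵐ[volume.restrict (I a : Set ℝ)] transmute H g := by
  filter_upwards [h, ae_restrict_mem (I a).isOpen.measurableSet] with x hx hxI
  rw [transmute, transmute, hx, volterra_congr h (abs_lt_of_mem_I hxI).le (kernel H)]

lemma invTransmute_congr (H : ℝ → ℝ → ℂ) {f g : ℝ → ℂ}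
    (h : f =ᵐ[volume.restrict (I a : Set ℝ)] g) :
    invTransmute H f =ᵐ[volume.restrict (I a : Set ℝ)] invTransmute H g := by
  filter_upwards [h, ae_restrict_mem (I a).isOpen.measurableSet] with x hx hxI
  rw [invTransmute, invTransmute, hx,
    volterra_congr h (abs_lt_of_mem_I hxI).le (fun x t => kernel H t x)]

lemma continuous_kernel_swap (hH : Continuous (Function.uncurry H)) :
    Continuous (Function.uncurry fun x t => kernel H t x) :=
  (continuous_kernel hH).comp continuous_swap

/-- The operator with kernel `K(x, t)` on `L¹(-a, a)`, identity included. -/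
noncomputable def transmuteL (ha : 0 < a) (hH : Continuous (Function.uncurry H)) :
    L1 (I a) →L[ℂ] L1 (I a) :=
  ContinuousLinearMap.id ℂ _ +
    (volterra a (kernel H) (continuous_kernel hH)).mkContinuousOfExistsBound
      (norm_volterra_le (continuous_kernel hH) ha.le)

/-- The operator with kernel `-K(t, x)` on `L¹(-a, a)`, identity included. -/
noncomputable def invTransmuteL (ha : 0 < a) (hH : Continuous (Function.uncurry H)) :
    L1 (I a) →L[ℂ] L1 (I a) :=
  ContinuousLinearMap.id ℂ _ -
    (volterra a (fun x t => kernel H t x) (continuous_kernel_swap hH)).mkContinuousOfExistsBound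
      (norm_volterra_le (continuous_kernel_swap hH) ha.le)

lemma transmuteL_ae_eq (ha : 0 < a) (hH : Continuous (Function.uncurry H)) {u : L1 (I a)}
    {f : ℝ → ℂ} (h : u =ᵐ[volume.restrict (I a : Set ℝ)] f) :
    transmuteL ha hH u =ᵐ[volume.restrict (I a : Set ℝ)] transmute H f := by
  refine Filter.EventuallyEq.trans ?_
    ((transmute_congr H (extend_ae_eq u).symm).trans (transmute_congr H h))
  filter_upwards [Lp.coeFn_add u (volterra a (kernel H) (continuous_kernel hH) u),
    volterra_ae_eq (continuous_kernel hH) u, extend_ae_eq u] with x h1 h2 h3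
  change (u + volterra a (kernel H) (continuous_kernel hH) u : L1 (I a)) x = _
  rw [h1, Pi.add_apply, h2, h3]
  rfl

lemma invTransmuteL_ae_eq (ha : 0 < a) (hH : Continuous (Function.uncurry H)) {u : L1 (I a)}
    {f : ℝ → ℂ} (h : u =ᵐ[volume.restrict (I a : Set ℝ)] f) :
    invTransmuteL ha hH u =ᵐ[volume.restrict (I a : Set ℝ)] invTransmute H f := by
  refine Filter.EventuallyEq.trans ?_
    ((invTransmute_congr H (extend_ae_eq u).symm).trans (invTransmute_congr H h))
  filter_upwards [Lp.coeFn_sub u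
    (volterra a (fun x t => kernel H t x) (continuous_kernel_swap hH) u),
    volterra_ae_eq (continuous_kernel_swap hH) u, extend_ae_eq u] with x h1 h2 h3
  change (u - volterra a (fun x t => kernel H t x) (continuous_kernel_swap hH) u : L1 (I a)) x = _
  rw [h1, Pi.sub_apply, h2, h3]
  rfl

/-- Injectivity of `S`: a solution of the homogeneous Volterra equation is continuous, and the
maximum of its modulus with weight `exp (-r |x|)` is at most half of itself for large `r`. -/
lemma eq_zero_of_invTransmuteL_eq_zero (ha : 0 < a) (hH : Continuous (Function.uncurry H))
    {u : L1 (I a)} (hu : invTransmuteL ha hH u = 0) : u = 0 := by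
  set g : ℝ → ℂ := fun x => ∫ t in (-x)..x, kernel H t x * extend u t with hg
  have hgc : Continuous g := continuous_kernel_integral' hH (locallyIntegrable_extend u)
  have hug : u =ᵐ[volume.restrict (I a : Set ℝ)] g := by
    have h1 := invTransmuteL_ae_eq ha hH (extend_ae_eq u)
    rw [hu] at h1
    filter_upwards [h1, Lp.coeFn_zero ℂ 1 (volume.restrict (I a : Set ℝ)), extend_ae_eq u]
      with x h1 h2 h3
    rw [h2, invTransmute] at h1
    rw [h3]
    exact sub_eq_zero.1 h1.symm
  have hgg : ∀ x, |x| ≤ a → g x = ∫ t in (-x)..x, kernel H t x * g t := fun x hx =>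
    volterra_congr ((extend_ae_eq u).symm.trans hug) hx (fun x t => kernel H t x)
  obtain ⟨C, hC⟩ := ((isCompact_Icc (a := -a) (b := a)).prod
    (isCompact_Icc (a := -a) (b := a))).exists_bound_of_continuousOn
    (continuous_kernel_swap hH).continuousOn
  have hC0 : 0 ≤ C := (norm_nonneg _).trans
    (hC (0, 0) ⟨⟨by simpa using ha.le, ha.le⟩, ⟨by simpa using ha.le, ha.le⟩⟩)
  set r : ℝ := 4 * C + 1 with hr
  have hr0 : 0 < r := by positivity
  obtain ⟨x₀, hx₀, hmax⟩ := (isCompact_Icc (a := -a) (b := a)).exists_isMaxOn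
    ⟨0, by simpa using ha.le, ha.le⟩ (f := fun x => Real.exp (-(r * |x|)) * ‖g x‖)
    (Continuous.continuousOn (by fun_prop))
  set M := Real.exp (-(r * |x₀|)) * ‖g x₀‖ with hM
  have hle : ∀ x, |x| ≤ a → ‖g x‖ ≤ M * Real.exp (r * |x|) := by
    intro x hx
    have h1 : Real.exp (-(r * |x|)) * ‖g x‖ ≤ M := hmax (abs_le.1 hx)
    rw [Real.exp_neg, inv_mul_le_iff₀ (Real.exp_pos _)] at h1
    rwa [mul_comm]
  have hM0 : 0 ≤ M := by positivity
  have hx₀' : |x₀| ≤ a := abs_le.2 hx₀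
  have half : ∀ X, |X| = |x₀| → ‖∫ t in (0 : ℝ)..X, kernel H t x₀ * g t‖ ≤
      C * M / r * Real.exp (r * |x₀|) := by
    intro X hX
    have h1 := norm_integral_le_exp_weight (F := fun t => kernel H t x₀ * g t) (C := C * M)
      (u := X) hr0 fun t ht => by
        have ht' : |t| ≤ a := (abs_le_of_mem_uIcc_zero ht).trans (hX.le.trans hx₀')
        rw [norm_mul, mul_assoc]
        exact mul_le_mul (hC (x₀, t) ⟨hx₀, abs_le.1 ht'⟩) (hle t ht') (norm_nonneg _) hC0
    rwa [hX] at h1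
  have hM1 : ‖g x₀‖ ≤ 2 * (C * M / r * Real.exp (r * |x₀|)) := by
    have hi : ∀ b c, IntervalIntegrable (fun t => kernel H t x₀ * g t) volume b c :=
      intervalIntegrable_volterra (continuous_kernel_swap hH) hgc.locallyIntegrable x₀
    rw [hgg x₀ hx₀', ← intervalIntegral.integral_interval_sub_left (hi 0 x₀) (hi 0 (-x₀)), two_mul]
    exact (norm_sub_le _ _).trans (add_le_add (half _ rfl) (half _ (abs_neg _)))
  have hM2 : M ≤ 1 / 2 * M := by
    calc M ≤ Real.exp (-(r * |x₀|)) * (2 * (C * M / r * Real.exp (r * |x₀|))) :=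
          mul_le_mul_of_nonneg_left hM1 (Real.exp_pos _).le
      _ = (2 * C / r) * M * (Real.exp (-(r * |x₀|)) * Real.exp (r * |x₀|)) := by ring
      _ = (2 * C / r) * M := by rw [← Real.exp_add]; simp
      _ ≤ 1 / 2 * M := by
          refine mul_le_mul_of_nonneg_right ?_ hM0
          rw [div_le_div_iff₀ hr0 two_pos]; linarith
  have hM3 : M = 0 := by linarith
  refine Lp.ext ?_
  filter_upwards [hug, Lp.coeFn_zero ℂ 1 (volume.restrict (I a : Set ℝ)),
    ae_restrict_mem (I a).isOpen.measurableSet] with x h1 h2 hx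
  have h3 := hle x (abs_lt_of_mem_I hx).le
  rw [hM3, zero_mul] at h3
  rw [h1, h2, Pi.zero_apply]
  exact norm_le_zero_iff.1 h3

/-- A continuous operator on `L¹(-a, a)` that fixes all monomials is the identity, since
polynomials are dense. -/
lemma eq_self_of_monomial (ha : 0 < a) (A : L1 (I a) →L[ℂ] L1 (I a))
    (hA : ∀ k, A (monomial a k) = monomial a k) (u : L1 (I a)) : A u = u := by
  have hpoly : ∀ p : Polynomial ℝ, ∀ w : L1 (I a),
      (w =ᵐ[volume.restrict (I a : Set ℝ)] fun x => ((p.eval x : ℝ) : ℂ)) → A w = w := by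
    intro p
    induction p using Polynomial.induction_on' with
    | add p r hp hr =>
      intro w hw
      have hcp : LocallyIntegrable fun x : ℝ => ((p.eval x : ℝ) : ℂ) :=
        Continuous.locallyIntegrable (by fun_prop)
      have hcr : LocallyIntegrable fun x : ℝ => ((r.eval x : ℝ) : ℂ) :=
        Continuous.locallyIntegrable (by fun_prop)
      have h1 : w = toL1I a hcp + toL1I a hcr := by
        refine Lp.ext ?_
        filter_upwards [hw, Lp.coeFn_add (toL1I a hcp) (toL1I a hcr), coeFn_toL1I (a := a) hcp,
          coeFn_toL1I (a := a) hcr] with x h1 h2 h3 h4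
        rw [h1, h2, Pi.add_apply, h3, h4]
        simp
      rw [h1, map_add, hp _ (coeFn_toL1I hcp), hr _ (coeFn_toL1I hcr)]
    | monomial n c =>
      intro w hw
      have h1 : w = (c : ℂ) • monomial a n := by
        refine Lp.ext ?_
        filter_upwards [hw, Lp.coeFn_smul (c : ℂ) (monomial a n),
          Integrable.coeFn_toL1 (integrable_pow a n)] with x h1 h2 h3
        rw [h1, h2, Pi.smul_apply, monomial, h3]
        simp
      rw [h1, map_smul, hA]
  have hclosed : IsClosed {w : L1 (I a) | A w = w} := isClosed_eq A.continuous continuous_id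
  refine hclosed.closure_subset (Metric.mem_closure_iff.2 fun ε hε => ?_)
  obtain ⟨g, -, hug, hgc, hgi⟩ := (integrableOn_coe u).exists_hasCompactSupport_integral_sub_le
    (ε := ε / 2) (by positivity)
  set δ : ℝ := ε / (16 * a) with hδ
  have hδ0 : 0 < δ := by positivity
  obtain ⟨p, hp⟩ := exists_polynomial_near_of_continuousOn (-a) a (fun x => (g x).re)
    (Complex.continuous_re.comp hgc).continuousOn δ hδ0
  obtain ⟨r, hr⟩ := exists_polynomial_near_of_continuousOn (-a) a (fun x => (g x).im)
    (Complex.continuous_im.comp hgc).continuousOn δ hδ0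
  have hcp : LocallyIntegrable fun x : ℝ => ((p.eval x : ℝ) : ℂ) :=
    Continuous.locallyIntegrable (by fun_prop)
  have hcr : LocallyIntegrable fun x : ℝ => ((r.eval x : ℝ) : ℂ) :=
    Continuous.locallyIntegrable (by fun_prop)
  set w := toL1I a hcp + Complex.I • toL1I a hcr with hw
  refine ⟨w, ?_, ?_⟩
  · change A w = w
    rw [hw, map_add, map_smul, hpoly p _ (coeFn_toL1I hcp), hpoly r _ (coeFn_toL1I hcr)]
  have hwx : w =ᵐ[volume.restrict (I a : Set ℝ)]
      fun x => ((p.eval x : ℝ) : ℂ) + Complex.I * ((r.eval x : ℝ) : ℂ) := by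
    filter_upwards [Lp.coeFn_add (toL1I a hcp) (Complex.I • toL1I a hcr),
      Lp.coeFn_smul Complex.I (toL1I a hcr), coeFn_toL1I (a := a) hcp,
      coeFn_toL1I (a := a) hcr] with x h1 h2 h3 h4
    rw [hw, h1, Pi.add_apply, h2, Pi.smul_apply, h3, h4, smul_eq_mul]
  rw [dist_eq_norm, L1.norm_eq_integral_norm]
  have hgδ : ∀ x ∈ (I a : Set ℝ),
      ‖g x - (((p.eval x : ℝ) : ℂ) + Complex.I * ((r.eval x : ℝ) : ℂ))‖ ≤ 2 * δ := by
    intro x hx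
    have h1 := (hp x (Ioo_subset_Icc_self hx)).le
    have h2 := (hr x (Ioo_subset_Icc_self hx)).le
    refine (Complex.norm_le_abs_re_add_abs_im _).trans ?_
    simp only [Complex.sub_re, Complex.add_re, Complex.ofReal_re, Complex.mul_re, Complex.I_re,
      zero_mul, Complex.I_im, Complex.ofReal_im, mul_zero, sub_self, add_zero, Complex.sub_im,
      Complex.add_im, Complex.mul_im, one_mul, zero_add]
    rw [abs_sub_comm, abs_sub_comm (g x).im]
    linarith
  have hgw : ∀ᵐ x ∂(volume.restrict (I a : Set ℝ)),
      ‖(u - w : L1 (I a)) x‖ ≤ ‖u x - g x‖ + 2 * δ := by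
    filter_upwards [Lp.coeFn_sub u w, hwx, ae_restrict_mem (I a).isOpen.measurableSet]
      with x h1 h2 hx
    rw [h1, Pi.sub_apply, h2, ← sub_add_sub_cancel _ (g x) _]
    exact (norm_add_le _ _).trans (add_le_add le_rfl (hgδ x hx))
  have hvol : volume.real (I a : Set ℝ) = 2 * a := by
    change volume.real (Ioo (-a) a) = 2 * a
    rw [Real.volume_real_Ioo_of_le (by linarith)]
    ring
  have hc : Integrable (fun _ : ℝ => 2 * δ) (volume.restrict (I a : Set ℝ)) :=
    integrableOn_const (by simp [I])
  have hs : Integrable (fun x => ‖u x - g x‖) (volume.restrict (I a : Set ℝ)) :=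
    ((integrableOn_coe u).sub hgi).norm
  calc ∫ x in (I a : Set ℝ), ‖(u - w : L1 (I a)) x‖
      ≤ ∫ x in (I a : Set ℝ), (‖u x - g x‖ + 2 * δ) :=
        integral_mono_ae (integrableOn_coe (u - w)).norm (hs.add hc) hgw
    _ = (∫ x in (I a : Set ℝ), ‖u x - g x‖) + 2 * a * (2 * δ) := by
        rw [integral_add hs hc, setIntegral_const, hvol, smul_eq_mul]
    _ ≤ ε / 2 + 2 * a * (2 * δ) := by gcongr
    _ = ε / 2 + ε / 4 := by rw [hδ]; field_simp; ring
    _ < ε := by linarith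

section Solution

variable {q : ℝ → ℂ} (hq : LocallyIntegrable q) (hH : IsGlobalSolution q H) (ha : 0 < a)

include hq in
/-- The identity holds on monomials, hence everywhere. -/
lemma invTransmuteL_transmuteL (u : L1 (I a)) :
    invTransmuteL ha hH.continuous (transmuteL ha hH.continuous u) = u := by
  refine eq_self_of_monomial ha
    ((invTransmuteL ha hH.continuous).comp (transmuteL ha hH.continuous)) (fun k => ?_) u
  have h0 : monomial a k =ᵐ[volume.restrict (I a : Set ℝ)] fun x : ℝ => (x : ℂ) ^ k :=
    Integrable.coeFn_toL1 (integrable_pow a k)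
  refine Lp.ext ?_
  filter_upwards [invTransmuteL_ae_eq ha hH.continuous (transmuteL_ae_eq ha hH.continuous h0), h0]
    with x h1 h2
  rw [h2, ← invTransmute_transmute_pow hq hH k x]
  exact h1

/-- The transmutation operator as an automorphism of `L¹(-a, a)`. -/
noncomputable def transmuteEquiv : L1 (I a) ≃L[ℂ] L1 (I a) :=
  ContinuousLinearEquiv.equivOfInverse (transmuteL ha hH.continuous)
    (invTransmuteL ha hH.continuous) (invTransmuteL_transmuteL hq hH ha) (fun w => by
      have h1 := invTransmuteL_transmuteL hq hH ha (invTransmuteL ha hH.continuous w)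
      rw [← sub_eq_zero, ← map_sub] at h1
      exact sub_eq_zero.1 (eq_zero_of_invTransmuteL_eq_zero ha hH.continuous h1))

lemma transmuteEquiv_ae_eq {u : L1 (I a)} {f : ℝ → ℂ}
    (h : u =ᵐ[volume.restrict (I a : Set ℝ)] f) :
    transmuteEquiv hq hH ha u =ᵐ[volume.restrict (I a : Set ℝ)] transmute H f :=
  transmuteL_ae_eq ha hH.continuous h

lemma transmuteEquiv_symm_ae_eq {u : L1 (I a)} {f : ℝ → ℂ}
    (h : u =ᵐ[volume.restrict (I a : Set ℝ)] f) :
    (transmuteEquiv hq hH ha).symm u =ᵐ[volume.restrict (I a : Set ℝ)] invTransmute H f :=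
  invTransmuteL_ae_eq ha hH.continuous h

/-- A function in `W^{2,1}` has a twice primitive representative, to which
`isTwicePrimitive_transmute` applies. -/
lemma exists_isSecondDeriv_transmuteEquiv {u u'' : L1 (I a)} (h : IsSecondDeriv a u u'') :
    ∃ w : L1 (I a), IsSecondDeriv a (transmuteEquiv hq hH ha u) w ∧
      ∀ᵐ x ∂(volume.restrict (I a : Set ℝ)), w x =
        transmuteEquiv hq hH ha u'' x + q x * transmuteEquiv hq hH ha u x := by
  obtain ⟨v, v₁, hv, huv⟩ := h.exists_isTwicePrimitive ha
  obtain ⟨w₁, hw, -⟩ := isTwicePrimitive_transmute hq hH hv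
  have hTu := transmuteEquiv_ae_eq hq hH ha huv
  refine ⟨toL1I a hw.locallyIntegrable, hw.isSecondDeriv hTu (coeFn_toL1I _), ?_⟩
  filter_upwards [coeFn_toL1I (a := a) hw.locallyIntegrable, hTu,
    transmuteEquiv_ae_eq hq hH ha (extend_ae_eq u'')] with x h1 h2 h3
  rw [h1, h2, h3]

/-- Both `T` and its inverse map twice primitives to twice primitives. -/
lemma transmuteEquiv_mem_W21_iff (u : L1 (I a)) :
    transmuteEquiv hq hH ha u ∈ W21 a ↔ u ∈ W21 a := by
  constructor
  · rintro ⟨w, hw⟩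
    obtain ⟨v, v₁, hv, huv⟩ := hw.exists_isTwicePrimitive ha
    obtain ⟨z₁, hz, -⟩ := isTwicePrimitive_invTransmute hq hH hv
    have h1 := transmuteEquiv_symm_ae_eq hq hH ha huv
    rw [ContinuousLinearEquiv.symm_apply_apply] at h1
    exact ⟨_, hz.isSecondDeriv h1 (coeFn_toL1I hz.locallyIntegrable)⟩
  · rintro ⟨u'', h⟩
    obtain ⟨w, hw, -⟩ := exists_isSecondDeriv_transmuteEquiv hq hH ha h
    exact ⟨w, hw⟩

lemma isTransmutationOn_transmuteEquiv :
    IsTransmutationOn a q ((transmuteEquiv hq hH ha : L1 (I a) →L[ℂ] L1 (I a)) :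
      L1 (I a) →ₗ[ℂ] L1 (I a)) (W21 a) := by
  refine ⟨Subset.rfl, fun u hu => ⟨(transmuteEquiv_mem_W21_iff hq hH ha u).2 hu, ?_⟩⟩
  intro u'' w h h'
  obtain ⟨z, hz, hzx⟩ := exists_isSecondDeriv_transmuteEquiv hq hH ha h
  filter_upwards [IsSecondDeriv.unique h' hz, hzx] with x h1 h2
  change w x - q x * transmuteEquiv hq hH ha u x = transmuteEquiv hq hH ha u'' x
  rw [h1, h2]
  ring

/-- The image of a monomial: its representative, its initial values, and the equation it solves. -/
lemma transmuteEquiv_monomial {k : ℕ} {v₁ f : ℝ → ℂ} {h : L1 (I a)}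
    (hv : IsTwicePrimitive (fun x : ℝ => (x : ℂ) ^ k) v₁ f)
    (hf : ∀ᵐ x ∂(volume.restrict (I a : Set ℝ)), h x = transmute H f x) :
    IsWeakSolution a q h (transmuteEquiv hq hH ha (monomial a k)) ∧
      HasInitialValues a (transmuteEquiv hq hH ha (monomial a k)) ((0 : ℂ) ^ k) (v₁ 0) := by
  have h0 : monomial a k =ᵐ[volume.restrict (I a : Set ℝ)] fun x : ℝ => (x : ℂ) ^ k :=
    Integrable.coeFn_toL1 (integrable_pow a k)
  have h1 := transmuteEquiv_ae_eq hq hH ha h0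
  obtain ⟨w₁, hw, hw0⟩ := isTwicePrimitive_transmute hq hH hv
  refine ⟨hw.isWeakSolution hq h1 ?_, ?_⟩
  · filter_upwards [hf] with x hx
    rw [hx]
  · have h2 := hw.hasInitialValues h1
    rw [hw0] at h2
    simpa [transmute] using h2

lemma transmute_zero (H : ℝ → ℝ → ℂ) (x : ℝ) : transmute H (fun _ => 0) x = 0 := by
  simp [transmute]

lemma transmuteEquiv_monomial_zero :
    IsWeakSolution a q 0 (transmuteEquiv hq hH ha (monomial a 0)) ∧
      HasInitialValues a (transmuteEquiv hq hH ha (monomial a 0)) 1 0 := by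
  have h := transmuteEquiv_monomial hq hH ha (h := 0) isTwicePrimitive_one (by
    filter_upwards [Lp.coeFn_zero ℂ 1 (volume.restrict (I a : Set ℝ))] with x hx
    rw [hx, transmute_zero]; rfl)
  simpa using h

lemma transmuteEquiv_monomial_one :
    IsWeakSolution a q 0 (transmuteEquiv hq hH ha (monomial a 1)) ∧
      HasInitialValues a (transmuteEquiv hq hH ha (monomial a 1)) 0 1 := by
  have h := transmuteEquiv_monomial hq hH ha (h := 0) isTwicePrimitive_id (by
    filter_upwards [Lp.coeFn_zero ℂ 1 (volume.restrict (I a : Set ℝ))] with x hx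
    rw [hx, transmute_zero]; rfl)
  simpa using h

lemma transmuteEquiv_monomial_add_two (k : ℕ) :
    IsWeakSolution a q ((((k : ℂ) + 2) * ((k : ℂ) + 1)) • transmuteEquiv hq hH ha (monomial a k))
      (transmuteEquiv hq hH ha (monomial a (k + 2))) ∧
      HasInitialValues a (transmuteEquiv hq hH ha (monomial a (k + 2))) 0 0 := by
  have h0 : monomial a k =ᵐ[volume.restrict (I a : Set ℝ)] fun x : ℝ => (x : ℂ) ^ k :=
    Integrable.coeFn_toL1 (integrable_pow a k)
  have h := transmuteEquiv_monomial hq hH ha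
    (h := (((k : ℂ) + 2) * ((k : ℂ) + 1)) • transmuteEquiv hq hH ha (monomial a k))
    (isTwicePrimitive_pow k) (by
      filter_upwards [Lp.coeFn_smul (((k : ℂ) + 2) * ((k : ℂ) + 1))
        (transmuteEquiv hq hH ha (monomial a k)), transmuteEquiv_ae_eq hq hH ha h0] with x h1 h2
      rw [h1, Pi.smul_apply, h2, transmute_const_mul, smul_eq_mul])
  simpa using h

lemma isStandardTransmutationOn_transmuteEquiv :
    IsStandardTransmutationOn a q ((transmuteEquiv hq hH ha : L1 (I a) →L[ℂ] L1 (I a)) :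
      L1 (I a) →ₗ[ℂ] L1 (I a)) (W21 a) := by
  refine ⟨isTransmutationOn_transmuteEquiv hq hH ha,
    ⟨(transmuteEquiv_monomial_zero hq hH ha).1, (transmuteEquiv_monomial_one hq hH ha).1,
      fun k => (transmuteEquiv_monomial_add_two hq hH ha k).1⟩, fun k hk => ?_⟩
  obtain ⟨k, rfl⟩ := Nat.exists_eq_add_of_le' hk
  exact (transmuteEquiv_monomial_add_two hq hH ha k).2

end Solution

end Inverse

/-! ### The Goursat problem -/

lemma integrable_mul_compactSupport {f g : ℝ × ℝ → ℂ} (hf : LocallyIntegrable f)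
    (hg : Continuous g) (hs : HasCompactSupport g) : Integrable (fun p => f p * g p) := by
  have h := hf.integrable_smul_right_of_hasCompactSupport hg hs
  simpa [smul_eq_mul] using h

lemma hasCompactSupport_fderiv_apply {ψ : ℝ × ℝ → ℂ} (hs : HasCompactSupport ψ) (v : ℝ × ℝ) :
    HasCompactSupport fun p => fderiv ℝ ψ p v :=
  hs.fderiv_apply ℝ v

lemma continuous_fderiv_apply {ψ : ℝ × ℝ → ℂ} (hψ : ContDiff ℝ 1 ψ) (v : ℝ × ℝ) :
    Continuous fun p => fderiv ℝ ψ p v :=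
  (hψ.continuous_fderiv one_ne_zero).clm_apply continuous_const

/-- Integration by parts in the second variable for a function that is absolutely continuous on
vertical lines. -/
lemma integral_mul_fderiv_snd {F f : ℝ → ℝ → ℂ} {c : ℝ → ℂ}
    (hF : LocallyIntegrable (Function.uncurry F))
    (hf : LocallyIntegrable (Function.uncurry f)) (hfs : ∀ u, LocallyIntegrable (f u))
    (hFf : ∀ u v, F u v = c u + ∫ β in (0 : ℝ)..v, f u β) {ψ : ℝ × ℝ → ℂ} (hψ : ContDiff ℝ 1 ψ)
    (hs : HasCompactSupport ψ) :
    ∫ p : ℝ × ℝ, F p.1 p.2 * fderiv ℝ ψ p (0, 1) = -∫ p : ℝ × ℝ, f p.1 p.2 * ψ p := by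
  have h1 : Integrable (fun p : ℝ × ℝ => F p.1 p.2 * fderiv ℝ ψ p (0, 1)) :=
    integrable_mul_compactSupport hF (continuous_fderiv_apply hψ _)
      (hasCompactSupport_fderiv_apply hs _)
  have h2 : Integrable (fun p : ℝ × ℝ => f p.1 p.2 * ψ p) :=
    integrable_mul_compactSupport hf hψ.continuous hs
  rw [Measure.volume_eq_prod] at h1 h2 ⊢
  rw [integral_prod _ h1, integral_prod _ h2, ← integral_neg]
  congr 1
  ext u
  have hψu : ContDiff ℝ 1 fun v => ψ (u, v) := hψ.comp (contDiff_const.prodMk contDiff_id)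
  have hsu : HasCompactSupport fun v => ψ (u, v) :=
    .of_support_subset_isCompact (hs.isCompact.image continuous_snd)
      fun v hv => ⟨(u, v), subset_tsupport _ hv, rfl⟩
  have hd : ∀ v, fderiv ℝ ψ (u, v) (0, 1) = deriv (fun v => ψ (u, v)) v := by
    intro v
    have h3 : HasDerivAt (fun v : ℝ => (u, v)) (0, 1) v :=
      (hasDerivAt_const v u).prodMk (hasDerivAt_id v)
    exact (((hψ.differentiable one_ne_zero (u, v)).hasFDerivAt.comp_hasDerivAt v h3).deriv).symm
  simp only [hd, hFf]
  exact integral_primitive_mul_deriv (hfs u) (c u) hψu hsu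

/-- Integration by parts in the first variable. -/
lemma integral_mul_fderiv_fst {F f : ℝ → ℝ → ℂ} {c : ℝ → ℂ}
    (hF : LocallyIntegrable (Function.uncurry F))
    (hf : LocallyIntegrable (Function.uncurry f)) (hfs : ∀ v, LocallyIntegrable fun u => f u v)
    (hFf : ∀ u v, F u v = c v + ∫ α in (0 : ℝ)..u, f α v) {ψ : ℝ × ℝ → ℂ} (hψ : ContDiff ℝ 1 ψ)
    (hs : HasCompactSupport ψ) :
    ∫ p : ℝ × ℝ, F p.1 p.2 * fderiv ℝ ψ p (1, 0) = -∫ p : ℝ × ℝ, f p.1 p.2 * ψ p := by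
  have hsw : ∀ {g : ℝ → ℝ → ℂ}, LocallyIntegrable (Function.uncurry g) →
      LocallyIntegrable (Function.uncurry fun v u => g u v) := fun hg => by
    have := locallyIntegrable_comp_equiv hg (ContinuousLinearEquiv.prodComm ℝ ℝ ℝ)
    exact this
  have h1 := integral_mul_fderiv_snd (hsw hF) (hsw hf) hfs (fun v u => hFf u v)
    (ψ := fun p => ψ p.swap)
    (hψ.comp (ContinuousLinearEquiv.prodComm ℝ ℝ ℝ).contDiff)
    (hs.comp_homeomorph (Homeomorph.prodComm ℝ ℝ))
  have hd : ∀ p : ℝ × ℝ, fderiv ℝ (fun p => ψ p.swap) p (0, 1) = fderiv ℝ ψ p.swap (1, 0) := by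
    intro p
    have h3 := (hψ.differentiable one_ne_zero p.swap).hasFDerivAt.comp p
      (ContinuousLinearEquiv.prodComm ℝ ℝ ℝ).hasFDerivAt
    have h4 : HasFDerivAt (fun p : ℝ × ℝ => ψ p.swap) _ p := h3
    rw [h4.fderiv]
    rfl
  simp only [hd] at h1
  rw [Measure.volume_eq_prod] at h1 ⊢
  have e1 := integral_prod_swap (μ := (volume : Measure ℝ)) (ν := (volume : Measure ℝ))
    (fun p : ℝ × ℝ => F p.1 p.2 * fderiv ℝ ψ p (1, 0))
  have e2 := integral_prod_swap (μ := (volume : Measure ℝ)) (ν := (volume : Measure ℝ))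
    (fun p : ℝ × ℝ => f p.1 p.2 * ψ p)
  rw [← e1, ← e2]
  exact h1

section Goursat

variable {q : ℝ → ℂ} {H : ℝ → ℝ → ℂ}

/-- The weak derivative of `H` in the first characteristic variable. -/
noncomputable def derivU (q : ℝ → ℂ) (H : ℝ → ℝ → ℂ) (u v : ℝ) : ℂ :=
  (1 / 2) * q u + ∫ β in (0 : ℝ)..v, q (u + β) * H u β

/-- The weak derivative of `H` in the second characteristic variable. -/
noncomputable def derivV (q : ℝ → ℂ) (H : ℝ → ℝ → ℂ) (u v : ℝ) : ℂ :=
  ∫ α in (0 : ℝ)..u, q (α + v) * H α v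

variable (hq : LocallyIntegrable q) (hH : IsGlobalSolution q H)

include hq hH

lemma continuous_inner : Continuous (Function.uncurry fun u v : ℝ =>
    ∫ β in (0 : ℝ)..v, q (u + β) * H u β) := by
  have := continuous_integral_affine_weight (X := ℝ × ℝ) hq one_ne_zero (ψ := fun p β => H p.1 β)
    (c := fun p => p.1) (w := fun p => p.2)
    (hH.continuous.comp (f := fun r : (ℝ × ℝ) × ℝ => (r.1.1, r.2)) (by fun_prop))
    (by fun_prop) (by fun_prop)
  simpa only [one_mul, Function.uncurry_def] using this

lemma continuous_derivV : Continuous (Function.uncurry (derivV q H)) := by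
  have := continuous_integral_affine_weight (X := ℝ × ℝ) hq one_ne_zero (ψ := fun p α => H α p.2)
    (c := fun p => p.2) (w := fun p => p.1)
    (hH.continuous.comp (f := fun r : (ℝ × ℝ) × ℝ => (r.2, r.1.2)) (by fun_prop))
    (by fun_prop) (by fun_prop)
  refine this.congr fun p => intervalIntegral.integral_congr fun α _ => ?_
  simp only [one_mul, add_comm]

lemma locallyIntegrable_derivU : LocallyIntegrable (Function.uncurry (derivU q H)) :=
  (LocallyIntegrable.continuous_mul continuous_const (locallyIntegrable_fst hq)).add
    (continuous_inner hq hH).locallyIntegrable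

lemma locallyIntegrable_qH :
    LocallyIntegrable (Function.uncurry fun u v => q (u + v) * H u v) := by
  have h1 := locallyIntegrable_comp_plane hq 1 1 (Or.inl one_ne_zero)
  simp only [one_mul] at h1
  exact LocallyIntegrable.mul_continuous hH.continuous h1

lemma locallyIntegrable_qH_right (u : ℝ) : LocallyIntegrable fun v => q (u + v) * H u v := by
  have h1 := locallyIntegrable_comp_affine hq 1 one_ne_zero u
  simp only [one_mul, add_comm _ u] at h1
  exact LocallyIntegrable.mul_continuous (hH.continuous.comp (Continuous.prodMk_right u)) h1

lemma locallyIntegrable_qH_left (v : ℝ) : LocallyIntegrable fun u => q (u + v) * H u v := by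
  have h1 := locallyIntegrable_comp_affine hq 1 one_ne_zero v
  simp only [one_mul] at h1
  exact LocallyIntegrable.mul_continuous (hH.continuous.comp (Continuous.prodMk_left v)) h1

lemma eq_integral_derivU (u v : ℝ) : H u v = 0 + ∫ α in (0 : ℝ)..u, derivU q H α v := by
  have h1 : Continuous fun α : ℝ => ∫ β in (0 : ℝ)..v, q (α + β) * H α β :=
    (continuous_inner hq hH).comp (Continuous.prodMk_left v)
  simp only [derivU]
  rw [intervalIntegral.integral_add ((intervalIntegrable_of_locallyIntegrable hq _ _).const_mul _)
    (h1.intervalIntegrable _ _), intervalIntegral.integral_const_mul, zero_add]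
  exact hH.eq u v

lemma eq_integral_derivV (u v : ℝ) :
    H u v = (1 / 2) * (∫ s in (0 : ℝ)..u, q s) + ∫ β in (0 : ℝ)..v, derivV q H u β := by
  rw [hH.eq u v]
  congr 1
  refine intervalIntegral_intervalIntegral_swap ?_
  exact ((locallyIntegrable_qH hq hH).integrableOn_isCompact
    (isCompact_uIcc.prod isCompact_uIcc)).mono_set (prod_mono uIoc_subset_uIcc uIoc_subset_uIcc)

section Tested

variable {ψ : ℝ × ℝ → ℂ} (hψ : ContDiff ℝ 1 ψ) (hs : HasCompactSupport ψ)

include hψ hs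

lemma integral_mul_fderiv_u : ∫ p : ℝ × ℝ, H p.1 p.2 * fderiv ℝ ψ p (1, 0) =
    -∫ p : ℝ × ℝ, derivU q H p.1 p.2 * ψ p := by
  refine integral_mul_fderiv_fst (c := fun _ => 0) hH.continuous.locallyIntegrable
    (locallyIntegrable_derivU hq hH) (fun v => ?_) (eq_integral_derivU hq hH) hψ hs
  exact (LocallyIntegrable.continuous_mul continuous_const hq).add
    ((continuous_inner hq hH).comp (Continuous.prodMk_left v)).locallyIntegrable

lemma integral_mul_fderiv_v : ∫ p : ℝ × ℝ, H p.1 p.2 * fderiv ℝ ψ p (0, 1) =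
    -∫ p : ℝ × ℝ, derivV q H p.1 p.2 * ψ p :=
  integral_mul_fderiv_snd hH.continuous.locallyIntegrable
    (continuous_derivV hq hH).locallyIntegrable
    (fun u => ((continuous_derivV hq hH).comp (Continuous.prodMk_right u)).locallyIntegrable)
    (eq_integral_derivV hq hH) hψ hs

lemma integral_derivU_mul_fderiv_v : ∫ p : ℝ × ℝ, derivU q H p.1 p.2 * fderiv ℝ ψ p (0, 1) =
    -∫ p : ℝ × ℝ, q (p.1 + p.2) * H p.1 p.2 * ψ p :=
  integral_mul_fderiv_snd (locallyIntegrable_derivU hq hH) (locallyIntegrable_qH hq hH)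
    (locallyIntegrable_qH_right hq hH) (fun _ _ => rfl) hψ hs

lemma integral_derivV_mul_fderiv_u : ∫ p : ℝ × ℝ, derivV q H p.1 p.2 * fderiv ℝ ψ p (1, 0) =
    -∫ p : ℝ × ℝ, q (p.1 + p.2) * H p.1 p.2 * ψ p :=
  integral_mul_fderiv_fst (c := fun _ => 0) (continuous_derivV hq hH).locallyIntegrable
    (locallyIntegrable_qH hq hH) (locallyIntegrable_qH_left hq hH)
    (fun _ _ => (zero_add _).symm) hψ hs

end Tested

end Goursat

/-- The passage `(u, v) ↦ (u + v, u - v)` from the characteristic coordinates to `(x, t)`. -/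
noncomputable def charEquiv : (ℝ × ℝ) ≃L[ℝ] (ℝ × ℝ) := planeEquiv 1 1 1 (-1) (by norm_num)

lemma charEquiv_apply (p : ℝ × ℝ) : charEquiv p = (p.1 + p.2, p.1 - p.2) := by
  simp [charEquiv, planeEquiv_apply, sub_eq_add_neg]

lemma charEquiv_symm_apply (p : ℝ × ℝ) :
    charEquiv.symm p = ((p.1 + p.2) / 2, (p.1 - p.2) / 2) := by
  rw [ContinuousLinearEquiv.symm_apply_eq, charEquiv_apply]
  ext <;> simp only <;> ring

section GoursatProblem

variable {a : ℝ} {q : ℝ → ℂ} {H : ℝ → ℝ → ℂ}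

lemma integrableOn_Q {f : ℝ × ℝ → ℂ} (hf : LocallyIntegrable f) :
    IntegrableOn f (Q a : Set (ℝ × ℝ)) :=
  (hf.integrableOn_isCompact (isCompact_Icc.prod isCompact_Icc)).mono_set
    (prod_mono Ioo_subset_Icc_self Ioo_subset_Icc_self)

/-- The derivative of the kernel in `x`, by the chain rule in characteristic coordinates. -/
noncomputable def kernelDerivX (q : ℝ → ℂ) (H : ℝ → ℝ → ℂ) (p : ℝ × ℝ) : ℂ :=
  (1 / 2) * (derivU q H ((p.1 + p.2) / 2) ((p.1 - p.2) / 2) +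
    derivV q H ((p.1 + p.2) / 2) ((p.1 - p.2) / 2))

/-- The derivative of the kernel in `t`, by the chain rule in characteristic coordinates. -/
noncomputable def kernelDerivT (q : ℝ → ℂ) (H : ℝ → ℝ → ℂ) (p : ℝ × ℝ) : ℂ :=
  (1 / 2) * (derivU q H ((p.1 + p.2) / 2) ((p.1 - p.2) / 2) -
    derivV q H ((p.1 + p.2) / 2) ((p.1 - p.2) / 2))

lemma kernel_charEquiv (p : ℝ × ℝ) :
    kernel H (charEquiv p).1 (charEquiv p).2 = H p.1 p.2 := by
  rw [charEquiv_apply, kernel]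
  congr 1 <;> ring

lemma kernelDerivX_charEquiv (p : ℝ × ℝ) : kernelDerivX q H (charEquiv p) =
    (1 / 2) * (derivU q H p.1 p.2 + derivV q H p.1 p.2) := by
  rw [charEquiv_apply, kernelDerivX, show (p.1 + p.2 + (p.1 - p.2)) / 2 = p.1 by ring,
    show (p.1 + p.2 - (p.1 - p.2)) / 2 = p.2 by ring]

lemma kernelDerivT_charEquiv (p : ℝ × ℝ) : kernelDerivT q H (charEquiv p) =
    (1 / 2) * (derivU q H p.1 p.2 - derivV q H p.1 p.2) := by
  rw [charEquiv_apply, kernelDerivT, show (p.1 + p.2 + (p.1 - p.2)) / 2 = p.1 by ring,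
    show (p.1 + p.2 - (p.1 - p.2)) / 2 = p.2 by ring]

/-- Integrals over the square against a test function, up to a constant factor, in characteristic
coordinates. -/
lemma exists_setIntegral_Q_eq : ∃ c : ℂ, ∀ f : ℝ × ℝ → ℂ,
    (∀ p, p ∉ (Q a : Set (ℝ × ℝ)) → f p = 0) →
      ∫ p in (Q a : Set (ℝ × ℝ)), f p = c * ∫ p, f (charEquiv p) := by
  obtain ⟨c, hc, h⟩ := integral_comp_equiv charEquiv
  refine ⟨(c : ℂ)⁻¹, fun f hf => ?_⟩
  rw [setIntegral_eq_integral_of_forall_compl_eq_zero hf, h, ← mul_assoc, inv_mul_cancel₀, one_mul]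
  exact_mod_cast hc.ne'

lemma contDiff_comp_charEquiv (φ : TestFunction (Q a) ℂ ⊤) :
    ContDiff ℝ 1 fun p => φ (charEquiv p) :=
  (contDiff_testFunction φ 1).comp charEquiv.contDiff

lemma hasCompactSupport_comp_charEquiv (φ : TestFunction (Q a) ℂ ⊤) :
    HasCompactSupport fun p => φ (charEquiv p) :=
  φ.hasCompactSupport.comp_homeomorph charEquiv.toHomeomorph

lemma fderiv_comp_charEquiv (φ : TestFunction (Q a) ℂ ⊤) (p v : ℝ × ℝ) :
    fderiv ℝ (fun p => φ (charEquiv p)) p v = fderiv ℝ φ (charEquiv p) (charEquiv v) := by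
  have h := (((contDiff_testFunction φ 1).differentiable (by norm_num)
    (charEquiv p)).hasFDerivAt.comp p charEquiv.hasFDerivAt)
  have h4 : HasFDerivAt (fun p : ℝ × ℝ => φ (charEquiv p)) _ p := h
  rw [h4.fderiv]
  rfl

lemma fderiv_x_charEquiv (φ : TestFunction (Q a) ℂ ⊤) (p : ℝ × ℝ) :
    fderiv ℝ φ (charEquiv p) (1, 0) = (1 / 2) * (fderiv ℝ (fun p => φ (charEquiv p)) p (1, 0) +
      fderiv ℝ (fun p => φ (charEquiv p)) p (0, 1)) := by
  rw [fderiv_comp_charEquiv, fderiv_comp_charEquiv, ← map_add, ← map_add]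
  have hv : charEquiv ((1, 0) + (0, 1)) = (2 : ℝ) • ((1, 0) : ℝ × ℝ) := by
    rw [charEquiv_apply]
    ext <;> norm_num
  rw [hv, map_smul, Complex.real_smul]
  push_cast
  ring

lemma fderiv_t_charEquiv (φ : TestFunction (Q a) ℂ ⊤) (p : ℝ × ℝ) :
    fderiv ℝ φ (charEquiv p) (0, 1) = (1 / 2) * (fderiv ℝ (fun p => φ (charEquiv p)) p (1, 0) -
      fderiv ℝ (fun p => φ (charEquiv p)) p (0, 1)) := by
  rw [fderiv_comp_charEquiv, fderiv_comp_charEquiv, ← map_sub, ← map_sub]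
  have hv : charEquiv ((1, 0) - (0, 1)) = (2 : ℝ) • ((0, 1) : ℝ × ℝ) := by
    rw [charEquiv_apply]
    ext <;> norm_num
  rw [hv, map_smul, Complex.real_smul]
  push_cast
  ring

lemma integrable_mul_test (φ : TestFunction (Q a) ℂ ⊤) {f : ℝ → ℝ → ℂ}
    (hf : LocallyIntegrable (Function.uncurry f)) :
    Integrable fun p : ℝ × ℝ => f p.1 p.2 * φ (charEquiv p) :=
  integrable_mul_compactSupport hf (contDiff_comp_charEquiv φ).continuous
    (hasCompactSupport_comp_charEquiv φ)

lemma integrable_mul_fderiv_test (φ : TestFunction (Q a) ℂ ⊤) {f : ℝ → ℝ → ℂ}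
    (hf : LocallyIntegrable (Function.uncurry f))
    (v : ℝ × ℝ) :
    Integrable fun p : ℝ × ℝ => f p.1 p.2 * fderiv ℝ (fun p => φ (charEquiv p)) p v :=
  integrable_mul_compactSupport hf (continuous_fderiv_apply (contDiff_comp_charEquiv φ) v)
    (hasCompactSupport_fderiv_apply (hasCompactSupport_comp_charEquiv φ) v)

variable (hq : LocallyIntegrable q) (hH : IsGlobalSolution q H)

include hq hH

lemma locallyIntegrable_kernelDerivX : LocallyIntegrable (kernelDerivX q H) := by
  have h := locallyIntegrable_comp_equiv (LocallyIntegrable.continuous_mul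
    (continuous_const (y := (1 / 2 : ℂ))) ((locallyIntegrable_derivU hq hH).add
      (continuous_derivV hq hH).locallyIntegrable)) charEquiv.symm
  refine h.congr (Filter.Eventually.of_forall fun p => ?_)
  simp only [charEquiv_symm_apply, Pi.add_apply, Function.uncurry, kernelDerivX]

lemma locallyIntegrable_kernelDerivT : LocallyIntegrable (kernelDerivT q H) := by
  have h := locallyIntegrable_comp_equiv (LocallyIntegrable.continuous_mul
    (continuous_const (y := (1 / 2 : ℂ))) ((locallyIntegrable_derivU hq hH).sub
      (continuous_derivV hq hH).locallyIntegrable)) charEquiv.symm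
  refine h.congr (Filter.Eventually.of_forall fun p => ?_)
  simp only [charEquiv_symm_apply, Pi.sub_apply, Function.uncurry, kernelDerivT]

section

variable (φ : TestFunction (Q a) ℂ ⊤)

lemma hasWeakDeriv_kernel_x :
    ∫ p in (Q a : Set (ℝ × ℝ)), kernel H p.1 p.2 * fderiv ℝ φ p (1, 0) =
      -∫ p in (Q a : Set (ℝ × ℝ)), kernelDerivX q H p * φ p := by
  obtain ⟨c, hc⟩ := exists_setIntegral_Q_eq (a := a)
  rw [hc _ fun p hp => by rw [fderiv_testFunction_eq_zero φ hp]; simp,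
    hc _ fun p hp => by rw [testFunction_eq_zero φ hp, mul_zero], ← mul_neg]
  have hψ := contDiff_comp_charEquiv φ
  have hs := hasCompactSupport_comp_charEquiv φ
  have h1 := integral_mul_fderiv_u hq hH hψ hs
  have h2 := integral_mul_fderiv_v hq hH hψ hs
  have hHl := hH.continuous.locallyIntegrable (μ := (volume : Measure (ℝ × ℝ)))
  have e1 : ∀ p : ℝ × ℝ, kernel H (charEquiv p).1 (charEquiv p).2 *
      fderiv ℝ φ (charEquiv p) (1, 0) = (1 / 2) *
        (H p.1 p.2 * fderiv ℝ (fun p => φ (charEquiv p)) p (1, 0) +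
          H p.1 p.2 * fderiv ℝ (fun p => φ (charEquiv p)) p (0, 1)) := fun p => by
    rw [kernel_charEquiv, fderiv_x_charEquiv]; ring
  have e2 : ∀ p : ℝ × ℝ, kernelDerivX q H (charEquiv p) * φ (charEquiv p) = (1 / 2) *
      (derivU q H p.1 p.2 * φ (charEquiv p) + derivV q H p.1 p.2 * φ (charEquiv p)) := fun p => by
    rw [kernelDerivX_charEquiv]; ring
  simp only [e1, e2]
  rw [integral_const_mul, integral_const_mul,
    integral_add (integrable_mul_fderiv_test φ hHl _) (integrable_mul_fderiv_test φ hHl _),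
    integral_add (integrable_mul_test φ (locallyIntegrable_derivU hq hH))
      (integrable_mul_test φ (continuous_derivV hq hH).locallyIntegrable), h1, h2]
  ring

lemma hasWeakDeriv_kernel_t :
    ∫ p in (Q a : Set (ℝ × ℝ)), kernel H p.1 p.2 * fderiv ℝ φ p (0, 1) =
      -∫ p in (Q a : Set (ℝ × ℝ)), kernelDerivT q H p * φ p := by
  obtain ⟨c, hc⟩ := exists_setIntegral_Q_eq (a := a)
  rw [hc _ fun p hp => by rw [fderiv_testFunction_eq_zero φ hp]; simp,
    hc _ fun p hp => by rw [testFunction_eq_zero φ hp, mul_zero], ← mul_neg]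
  have hψ := contDiff_comp_charEquiv φ
  have hs := hasCompactSupport_comp_charEquiv φ
  have h1 := integral_mul_fderiv_u hq hH hψ hs
  have h2 := integral_mul_fderiv_v hq hH hψ hs
  have hHl := hH.continuous.locallyIntegrable (μ := (volume : Measure (ℝ × ℝ)))
  have e1 : ∀ p : ℝ × ℝ, kernel H (charEquiv p).1 (charEquiv p).2 *
      fderiv ℝ φ (charEquiv p) (0, 1) = (1 / 2) *
        (H p.1 p.2 * fderiv ℝ (fun p => φ (charEquiv p)) p (1, 0) -
          H p.1 p.2 * fderiv ℝ (fun p => φ (charEquiv p)) p (0, 1)) := fun p => by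
    rw [kernel_charEquiv, fderiv_t_charEquiv]; ring
  have e2 : ∀ p : ℝ × ℝ, kernelDerivT q H (charEquiv p) * φ (charEquiv p) = (1 / 2) *
      (derivU q H p.1 p.2 * φ (charEquiv p) - derivV q H p.1 p.2 * φ (charEquiv p)) := fun p => by
    rw [kernelDerivT_charEquiv]; ring
  simp only [e1, e2]
  rw [integral_const_mul, integral_const_mul,
    integral_sub (integrable_mul_fderiv_test φ hHl _) (integrable_mul_fderiv_test φ hHl _),
    integral_sub (integrable_mul_test φ (locallyIntegrable_derivU hq hH))
      (integrable_mul_test φ (continuous_derivV hq hH).locallyIntegrable), h1, h2]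
  ring

/-- In characteristic coordinates the bilinear form of the wave equation is
`-½ (H_u ψ_v + H_v ψ_u)`, and `∂_v H_u = ∂_u H_v = q(u + v) H`. -/
lemma kernel_weak_equation :
    ∫ p in (Q a : Set (ℝ × ℝ)), (kernelDerivT q H p * fderiv ℝ φ p (0, 1) -
      kernelDerivX q H p * fderiv ℝ φ p (1, 0) - q p.1 * kernel H p.1 p.2 * φ p) = 0 := by
  obtain ⟨c, hc⟩ := exists_setIntegral_Q_eq (a := a)
  rw [hc _ fun p hp => by rw [fderiv_testFunction_eq_zero φ hp, testFunction_eq_zero φ hp]; simp]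
  have hψ := contDiff_comp_charEquiv φ
  have hs := hasCompactSupport_comp_charEquiv φ
  have h1 := integral_derivU_mul_fderiv_v hq hH hψ hs
  have h2 := integral_derivV_mul_fderiv_u hq hH hψ hs
  have e1 : ∀ p : ℝ × ℝ, kernelDerivT q H (charEquiv p) * fderiv ℝ φ (charEquiv p) (0, 1) -
      kernelDerivX q H (charEquiv p) * fderiv ℝ φ (charEquiv p) (1, 0) -
        q (charEquiv p).1 * kernel H (charEquiv p).1 (charEquiv p).2 * φ (charEquiv p) =
      -(1 / 2) * (derivU q H p.1 p.2 * fderiv ℝ (fun p => φ (charEquiv p)) p (0, 1) +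
        derivV q H p.1 p.2 * fderiv ℝ (fun p => φ (charEquiv p)) p (1, 0)) -
        q (p.1 + p.2) * H p.1 p.2 * φ (charEquiv p) := fun p => by
    rw [kernelDerivT_charEquiv, kernelDerivX_charEquiv, kernel_charEquiv, fderiv_x_charEquiv,
      fderiv_t_charEquiv, show (charEquiv p).1 = p.1 + p.2 by rw [charEquiv_apply]]
    ring
  simp only [e1]
  have i1 := integrable_mul_fderiv_test φ (locallyIntegrable_derivU hq hH) (0, 1)
  have i2 := integrable_mul_fderiv_test φ (continuous_derivV hq hH).locallyIntegrable (1, 0)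
  have i3 : Integrable fun p : ℝ × ℝ => -(1 / 2) *
      (derivU q H p.1 p.2 * fderiv ℝ (fun p => φ (charEquiv p)) p (0, 1) +
        derivV q H p.1 p.2 * fderiv ℝ (fun p => φ (charEquiv p)) p (1, 0)) :=
    (i1.add i2).const_mul _
  rw [integral_sub i3 (integrable_mul_test φ (locallyIntegrable_qH hq hH)),
    integral_const_mul, integral_add i1 i2, h1, h2]
  ring

end

theorem isWeakGoursatSolution_kernel : IsWeakGoursatSolution a q (kernel H) := by
  have hX := integrableOn_Q (a := a) (locallyIntegrable_kernelDerivX hq hH)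
  have hT := integrableOn_Q (a := a) (locallyIntegrable_kernelDerivT hq hH)
  have hXe := Integrable.coeFn_toL1 hX
  have hTe := Integrable.coeFn_toL1 hT
  refine ⟨(continuous_kernel hH.continuous).continuousOn, ⟨hX.toL1 _, hT.toL1 _, fun φ => ?_,
    fun φ => ?_, fun φ => ?_⟩, fun x _ => ?_, fun x _ => ?_⟩
  · rw [hasWeakDeriv_kernel_x hq hH φ]
    congr 1
    refine integral_congr_ae ?_
    filter_upwards [hXe] with p hp
    rw [hp]
  · rw [hasWeakDeriv_kernel_t hq hH φ]
    congr 1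
    refine integral_congr_ae ?_
    filter_upwards [hTe] with p hp
    rw [hp]
  · rw [← kernel_weak_equation hq hH φ]
    refine integral_congr_ae ?_
    filter_upwards [hXe, hTe] with p hp hp'
    rw [hp, hp']
  · rw [kernel, hH.eq, sub_self, zero_div]
    simp
  · rw [kernel, hH.eq, add_neg_cancel, zero_div]
    simp

end GoursatProblem

/-! ### Dependence on the potential on `(-a, a)` only -/

section Congr

variable {a : ℝ} {q q' : ℝ → ℂ}

lemma IsWeakSolution.congr {h u : L1 (I a)} (hu : IsWeakSolution a q h u)
    (hq : EqOn q q' (I a : Set ℝ)) : IsWeakSolution a q' h u := by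
  refine ⟨hu.1, fun φ => ?_⟩
  rw [← hu.2 φ]
  exact setIntegral_congr_fun (I a).isOpen.measurableSet fun x hx => by simp only [hq hx]

lemma IsStandardTransmutationOn.congr {T : L1 (I a) →ₗ[ℂ] L1 (I a)} {χ : Set (L1 (I a))}
    (hT : IsStandardTransmutationOn a q T χ) (hq : EqOn q q' (I a : Set ℝ)) :
    IsStandardTransmutationOn a q' T χ := by
  obtain ⟨⟨hχ, hT⟩, ⟨h0, h1, h2⟩, hi⟩ := hT
  refine ⟨⟨hχ, fun u hu => ⟨(hT u hu).1, fun u'' w h h' => ?_⟩⟩,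
    ⟨h0.congr hq, h1.congr hq, fun k => (h2 k).congr hq⟩, hi⟩
  filter_upwards [(hT u hu).2 u'' w h h', ae_restrict_mem (I a).isOpen.measurableSet] with x hx hxI
  rw [← hq hxI, hx]

lemma IsWeakGoursatSolution.congr {K K' : ℝ → ℝ → ℂ} (h : IsWeakGoursatSolution a q K)
    (hq : EqOn q q' (I a : Set ℝ)) (hK : ∀ x t, |x| ≤ a → |t| ≤ a → K x t = K' x t) :
    IsWeakGoursatSolution a q' K' := by
  have hK' : ∀ p ∈ (Q a : Set (ℝ × ℝ)), K p.1 p.2 = K' p.1 p.2 := fun p hp =>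
    hK _ _ (abs_lt.2 hp.1).le (abs_lt.2 hp.2).le
  have hm := (Q a).isOpen.measurableSet
  have hqae : q =ᵐ[volume.restrict (I a : Set ℝ)] q' := by
    filter_upwards [ae_restrict_mem (I a).isOpen.measurableSet] with x hx using hq hx
  obtain ⟨Kx, Kt, hx, ht, hw⟩ := h.weak
  refine ⟨h.continuousOn.congr fun p hp => (hK _ _ (abs_le.2 hp.1) (abs_le.2 hp.2)).symm,
    ⟨Kx, Kt, fun φ => ?_, fun φ => ?_, fun φ => ?_⟩, fun x hx => ?_, fun x hx => ?_⟩
  · rw [← hx φ]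
    exact setIntegral_congr_fun hm fun p hp => by simp only [hK' p hp]
  · rw [← ht φ]
    exact setIntegral_congr_fun hm fun p hp => by simp only [hK' p hp]
  · rw [← hw φ]
    exact setIntegral_congr_fun hm fun p hp => by simp only [hK' p hp, hq hp.1]
  · have hxa := abs_le.2 hx
    rw [← hK x x hxa hxa, h.diag x hx, integral_congr_potential hqae hxa]
  · have hxa := abs_le.2 hx
    rw [← hK x (-x) hxa (by rwa [abs_neg]), h.antidiag x hx]

lemma kernel_congr {H H' : ℝ → ℝ → ℂ} (h : ∀ u v, (u, v) ∈ Diamond a → H u v = H' u v) {x t : ℝ}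
    (hx : |x| ≤ a) (ht : |t| ≤ a) : kernel H x t = kernel H' x t := by
  refine h _ _ ?_
  rw [Diamond, mem_ofPred_eq]
  rw [abs_le] at hx ht
  rcases abs_cases ((x + t) / 2) with h1 | h1 <;> rcases abs_cases ((x - t) / 2) with h2 | h2 <;>
    simp only [h1.1, h2.1] <;> linarith

lemma integral_kernel_congr {K K' : ℝ → ℝ → ℂ} (hK : ∀ x t, |x| ≤ a → |t| ≤ a → K x t = K' x t)
    {x : ℝ} (hx : |x| ≤ a) (f : ℝ → ℂ) :
    ∫ t in (-x)..x, K x t * f t = ∫ t in (-x)..x, K' x t * f t := by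
  refine intervalIntegral.integral_congr fun t ht => ?_
  have h1 : |t| ≤ |x| := by
    rcases mem_uIcc.1 ht with h | h
    · exact (abs_le.2 h).trans (le_abs_self x)
    · exact (abs_le.2 ⟨by linarith, h.2⟩ : |t| ≤ -x).trans (neg_le_abs x)
  simp only [hK x t hx (h1.trans hx)]

end Congr

lemma IsGlobalSolution.solvesIntegralEq {q : ℝ → ℂ} {H : ℝ → ℝ → ℂ} (h : IsGlobalSolution q H)
    (a : ℝ) : SolvesIntegralEq a q H :=
  ⟨h.continuous.continuousOn, fun u v _ => h.eq u v⟩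

end Transmutation

open Transmutation in
theorem mainTheorem2 (a : ℝ) (ha : 0 < a) (q : ℝ → ℂ)
    (hq : IntegrableOn q (Transmutation.I a : Set ℝ)) :
    (∃ H : ℝ → ℝ → ℂ, Transmutation.SolvesIntegralEq a q H) ∧
    (∀ H H' : ℝ → ℝ → ℂ, Transmutation.SolvesIntegralEq a q H →
      Transmutation.SolvesIntegralEq a q H' →
      ∀ u v : ℝ, (u, v) ∈ Transmutation.Diamond a → H u v = H' u v) ∧
    ∀ H : ℝ → ℝ → ℂ, Transmutation.SolvesIntegralEq a q H →
      Transmutation.IsWeakGoursatSolution a q (Transmutation.kernel H) ∧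
      ∃ T : Transmutation.L1 (Transmutation.I a) ≃L[ℂ] Transmutation.L1 (Transmutation.I a),
        (∀ u : Transmutation.L1 (Transmutation.I a),
          ∀ᵐ x ∂(volume.restrict (Transmutation.I a : Set ℝ)),
            T u x = u x + ∫ t in (-x)..x, Transmutation.kernel H x t * u t) ∧
        Transmutation.IsStandardTransmutationOn a q
          (T : Transmutation.L1 (Transmutation.I a) →L[ℂ] Transmutation.L1 (Transmutation.I a))
          (Transmutation.W21 a) ∧
        Transmutation.HasInitialValues a (T (Transmutation.monomial a 0)) 1 0 ∧
        Transmutation.HasInitialValues a (T (Transmutation.monomial a 1)) 0 1 ∧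
        (∀ u : Transmutation.L1 (Transmutation.I a),
          ∀ᵐ x ∂(volume.restrict (Transmutation.I a : Set ℝ)),
            T.symm u x = u x - ∫ t in (-x)..x, Transmutation.kernel H t x * u t) ∧
        (∀ u : Transmutation.L1 (Transmutation.I a),
          T u ∈ Transmutation.W21 a ↔ u ∈ Transmutation.W21 a) := by
  have hm := (I a).isOpen.measurableSet
  -- Extending `q` by zero makes every object global without changing anything on the square.
  set q₀ : ℝ → ℂ := (I a : Set ℝ).indicator q with hq₀_def
  have hq₀ : Integrable q₀ := hq.integrable_indicator hm
  have hqe : EqOn q₀ q (I a : Set ℝ) := fun x hx => indicator_of_mem hx q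
  have hae : q₀ =ᵐ[volume.restrict (I a : Set ℝ)] q := by
    filter_upwards [ae_restrict_mem hm] with x hx using hqe hx
  obtain ⟨H₀, hH₀⟩ := exists_isGlobalSolution hq₀
  have huniq : ∀ H H' : ℝ → ℝ → ℂ, SolvesIntegralEq a q H → SolvesIntegralEq a q H' →
      ∀ u v : ℝ, (u, v) ∈ Diamond a → H u v = H' u v := fun H H' h h' =>
    (h.congr hae.symm fun _ _ _ => rfl).unique_of_integrable hq₀
      (h'.congr hae.symm fun _ _ _ => rfl)
  have hsol := (hH₀.solvesIntegralEq a).congr hae fun _ _ _ => rfl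
  refine ⟨⟨H₀, hsol⟩, huniq, fun H hH => ?_⟩
  have hK : ∀ x t, |x| ≤ a → |t| ≤ a → kernel H₀ x t = kernel H x t := fun x t =>
    kernel_congr (huniq H₀ H hsol hH)
  have hql := hq₀.locallyIntegrable
  refine ⟨(isWeakGoursatSolution_kernel hql hH₀).congr hqe hK, transmuteEquiv hql hH₀ ha,
    fun u => ?_, (isStandardTransmutationOn_transmuteEquiv hql hH₀ ha).congr hqe,
    (transmuteEquiv_monomial_zero hql hH₀ ha).2, (transmuteEquiv_monomial_one hql hH₀ ha).2,
    fun u => ?_, transmuteEquiv_mem_W21_iff hql hH₀ ha⟩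
  · filter_upwards [transmuteEquiv_ae_eq hql hH₀ ha (ae_eq_refl u), ae_restrict_mem hm]
      with x hx hxI
    rw [hx, transmute, integral_kernel_congr hK (abs_lt_of_mem_I hxI).le]
  · filter_upwards [transmuteEquiv_symm_ae_eq hql hH₀ ha (ae_eq_refl u), ae_restrict_mem hm]
      with x hx hxI
    rw [hx, invTransmute, integral_kernel_congr (K := fun x t => kernel H₀ t x)
      (K' := fun x t => kernel H t x) (fun x t h h' => hK t x h' h) (abs_lt_of_mem_I hxI).le]
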